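/- Let $\mathbb K\in\{\mathbb R,\mathbb C\}$, let $(A_\lambda:X_\lambda\to Y_\lambda)_{\lambda\in\Lambda}$ be bounded linear operators between Banach spaces over $\mathbb K$ with $\sup_\lambda\|A_\lambda\|<\infty$, and write $\ell_0$ for $c_0$. Let $p,r\in\{0\}\cup[1,\infty]$ be such that either $r=0$ and $p<\infty$, or $1\le p\le r\le\infty$, $1<r$ and $p<\infty$, and let $$D=D^{p,r}_\Lambda:\Bigl(\bigoplus_{\lambda\in\Lambda} X_\lambda\Bigr)_{\ell_p(\Lambda)}\to\Bigl(\bigoplus_{\lambda\in\Lambda} Y_\lambda\Bigr)_{\ell_r(\Lambda)},\qquad D(x_\lambda)_\lambda=(A_\lambda x_\lambda)_\lambda .$$ **Szlenk index.** For a weak$^*$-compact $K\subset X^*$ and $\varepsilon>0$ let $s_\varepsilon(K)$ be the set of $x^*\in K$ such that $\operatorname{diam}(V\cap K)>\varepsilon$ for every weak$^*$-neighbourhood $V$ of $x^*$; let $s^0_\varepsilon(K)=K$, $s^{\alpha+1}_\varepsilon(K)=s_\varepsilon(s^\alpha_\varepsilon(K))$, and $s^\alpha_\varepsilon(K)=\bigcap_{\beta<\alpha}s^\beta_\varepsilon(K)$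 for limit $\alpha$. $Sz(K,\varepsilon)$ is the least ordinal $\alpha$ with $s^\alpha_\varepsilon(K)=\varnothing$ ($\infty$ if there is none), and $Sz(K)=\sup_{\varepsilon>0}Sz(K,\varepsilon)$. For an operator $A:X\to Y$, $Sz(A,\varepsilon)=Sz(A^*B_{Y^*},\varepsilon)$ and $Sz(A)=Sz(A^*B_{Y^*})$. **Trees and coefficients.** For ordinals $\xi$ and integers $n\ge1$, the sets $\Gamma_{\xi,n}$ of non-empty finite sequences of ordinals, ordered by extension, and the functions $\mathbb P_{\xi,n}:\Gamma_{\xi,n}\to[0,1]$ are defined as follows, where $\beta+(\zeta_j)_j=(\beta+\zeta_j)_j$. $\Gamma_{0,1}=\{(0)\}$ and $\mathbb P_{0,1}((0))=1$. $\Gamma_{\xi,n}$ is the set of all $s=(\omega^\xi(n-1)+t_1)\smallfrown\cdots\smallfrown(\omega^\xi(n-i)+t_i)$ with $1\le i\le n$, $t_1,\dots,t_i\in\Gamma_{\xi,1}$ and $t_1,\dots,t_{i-1}$ maximal in $\Gamma_{\xi,1}$, and $\mathbb P_{\xi,n}(s)=\mathbb P_{\xi,1}(t_i)$. $\Gamma_{\xi+1,1}=\bigcup_{n\ge1}\Gamma_{\xi,n}$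 (a disjoint union) and $\mathbb P_{\xi+1,1}=\frac1n\mathbb P_{\xi,n}$ on $\Gamma_{\xi,n}$. For limit $\xi$, $\Gamma_{\xi,1}=\bigcup_{\zeta<\xi}(\omega^\zeta+\Gamma_{\zeta+1,1})$ and $\mathbb P_{\xi,1}(\omega^\zeta+t)=\mathbb P_{\zeta+1,1}(t)$. For a directed set $D_0$, $\Gamma_{\xi,n}.D_0$ is the set of all $(\zeta_j,u_j)_{j=1}^k$ with $(\zeta_j)_{j=1}^k\in\Gamma_{\xi,n}$ and $u_j\in D_0$, with $\mathbb P_{\xi,n}$ evaluated at $(\zeta_j)_j$. A family $(x_t)_{t\in\Gamma_{\xi,n}.D_0}\subset X$ is weakly null if for every $t\in\{\varnothing\}\cup\Gamma_{\xi,n}.D_0$ and every ordinal $\zeta$ such that $t\smallfrown(\zeta,u)\in\Gamma_{\xi,n}.D_0$ for all $u\in D_0$, the net $(x_{t\smallfrown(\zeta,u)})_{u\in D_0}$ is weakly null. **The quantities $\theta_{\xi,n}$.** For a non-empty weak$^*$-compact $K\subset X^*$, $\theta_{\xi,n}(K)$ is the infimum of all $\theta>0$ such that for every directed set $D_0$ and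 every weakly null $(x_t)_{t\in\Gamma_{\xi,n}.D_0}\subset B_X$, $$\inf_{t\in MAX(\Gamma_{\xi,n}.D_0)}\ \max_{x^*\in K}\operatorname{Re}x^*\Bigl(\frac1n\sum_{\varnothing<s\le t}\mathbb P_{\xi,n}(s)x_s\Bigr)\le\theta ,$$ and $\theta_{\xi,n}(A)=\theta_{\xi,n}(A^*B_{Y^*})$. **Theorem.** Suppose that $\sup_{\lambda\in\Lambda}Sz(A_\lambda)=\omega^\xi>1$ for an ordinal $\xi$. Then the following are equivalent: 1. $Sz(D)=\omega^\xi$; 2. for every $\varepsilon>0$, $\sup_{\lambda\in\Lambda}Sz(A_\lambda,\varepsilon)<\omega^\xi$; 3. $\inf\{\sup_{\lambda\in\Lambda}\theta_{\zeta,m}(A_\lambda):\zeta<\xi,\ m\in\mathbb N,\ m\ge 1\}=0$. Moreover, if these conditions fail, then $Sz(D)=\omega^{\xi+1}$. -/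

import Mathlib

open Filter Topology
open scoped ENNReal Ordinal

universe u v

namespace Szlenk

noncomputable section

/-! ### Szlenk index -/

section Index

variable {𝕜 : Type*} [RCLike 𝕜] {X : Type u} [NormedAddCommGroup X] [NormedSpace 𝕜 X]

/-- The Szlenk derivation `s_ε(K)`: all `x* ∈ K` such that for every weak* neighbourhood `V` of
`x*`, the norm diameter of `V ∩ K` exceeds `ε` (only used with `ε > 0`). -/
def deriv (ε : ℝ) (K : Set (WeakDual 𝕜 X)) : Set (WeakDual 𝕜 X) :=
  {f | f ∈ K ∧ ∀ V ∈ 𝓝 f,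
    ENNReal.ofReal ε < Metric.ediam (WeakDual.toStrongDual '' (V ∩ K))}

/-- The transfinite derivations `s_ε^α(K)`. -/
def iterDeriv (ε : ℝ) (K : Set (WeakDual 𝕜 X)) (α : Ordinal.{u}) : Set (WeakDual 𝕜 X) :=
  Ordinal.limitRecOn α K (fun _ S => deriv ε S) (fun β _ S => ⋂ (γ) (h : γ < β), S γ h)

/-- `Sz(K, ε)`, with `⊤` playing the role of `∞`. -/
def indexEps (K : Set (WeakDual 𝕜 X)) (ε : ℝ) : WithTop Ordinal.{u} :=
  sInf {a | ∃ α : Ordinal.{u}, iterDeriv ε K α = ∅ ∧ a = α}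

/-- `Sz(K) = sup_{ε > 0} Sz(K, ε)`. -/
def index (K : Set (WeakDual 𝕜 X)) : WithTop Ordinal.{u} :=
  ⨆ ε : {ε : ℝ // 0 < ε}, indexEps K ε

variable {Y : Type v} [NormedAddCommGroup Y] [NormedSpace 𝕜 Y]

/-- `A* B_{Y*}`, the image of the closed dual unit ball under the adjoint of `A : X → Y`. -/
def dualBallImage (A : X →L[𝕜] Y) : Set (WeakDual 𝕜 X) :=
  {f | ∃ g : StrongDual 𝕜 Y, ‖g‖ ≤ 1 ∧ f = StrongDual.toWeakDual (g.comp A)}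

/-- `Sz(A, ε) = Sz(A* B_{Y*}, ε)`. -/
def opIndexEps (A : X →L[𝕜] Y) (ε : ℝ) : WithTop Ordinal.{u} := indexEps (dualBallImage A) ε

/-- `Sz(A) = Sz(A* B_{Y*})`. -/
def opIndex (A : X →L[𝕜] Y) : WithTop Ordinal.{u} := index (dualBallImage A)

end Index

/-! ### The trees `Γ_{ξ,n}`, `Γ_{ξ,n}.D` and the coefficients `ℙ_{ξ,n}` -/

/-- `β + (ζ_i)_i = (β + ζ_i)_i`. -/
def shift (β : Ordinal.{u}) (t : List Ordinal.{u}) : List Ordinal.{u} := t.map (β + ·)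

/-- The maximal members of a set of finite sequences, ordered by extension. -/
def maxNodes {α : Type*} (G : Set (List α)) : Set (List α) :=
  {t | t ∈ G ∧ ∀ s ∈ G, t <+: s → s = t}

/-- If `G = Γ_{ξ,1}`, this is `Γ_{ξ,n}`, i.e. the set of all
`(ω^ξ(n-1)+t_1)⌢…⌢(ω^ξ(n-i)+t_i)` with `1 ≤ i ≤ n`, `t_1, …, t_i ∈ G` and
`t_1, …, t_{i-1}` maximal in `G` (built by splitting off the first block). -/
def stack (ξ : Ordinal.{u}) (G : Set (List Ordinal.{u})) : ℕ → Set (List Ordinal.{u})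
  | 0 => ∅
  | n + 1 => {l | ∃ t ∈ G, l = shift (ω ^ ξ * n) t} ∪
      {l | ∃ t ∈ maxNodes G, ∃ s ∈ stack ξ G n, l = shift (ω ^ ξ * n) t ++ s}

/-- `Γ_{ξ,1}`: `Γ_{0,1} = {(0)}`, `Γ_{ξ+1,1} = ⋃_{n ≥ 1} Γ_{ξ,n}`, and
`Γ_{ξ,1} = ⋃_{ζ<ξ} (ω^ζ + Γ_{ζ+1,1})` for limit `ξ`. -/
def treeOne (ξ : Ordinal.{u}) : Set (List Ordinal.{u}) :=
  Ordinal.limitRecOn ξ {[0]} (fun ζ G => {l | ∃ n : ℕ, 1 ≤ n ∧ l ∈ stack ζ G n})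
    (fun ξ hξ G => {l | ∃ (ζ : Ordinal.{u}) (h : ζ < ξ),
      ∃ t ∈ G (Order.succ ζ) (hξ.succ_lt h), l = shift (ω ^ ζ) t})

/-- `Γ_{ξ,n}`. -/
def tree (ξ : Ordinal.{u}) (n : ℕ) : Set (List Ordinal.{u}) := stack ξ (treeOne ξ) n

/-- For `s = (ω^ξ(n-1)+t_1)⌢…⌢(ω^ξ(n-i)+t_i) ∈ Γ_{ξ,n}`, this is `t_i`: the entries of the last
block are those with the same quotient by `ω^ξ` as the last entry of `s`. -/
def lastBlock (ξ : Ordinal.{u}) (s : List Ordinal.{u}) : List Ordinal.{u} :=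
  (s.filter (fun a => decide (a / ω ^ ξ = s.getLastD 0 / ω ^ ξ))).map (· % ω ^ ξ)

/-- The coefficients `ℙ_{ξ,1}` on `Γ_{ξ,1}` (irrelevant values elsewhere):
* `ℙ_{0,1}((0)) = 1`;
* `ℙ_{ξ+1,1}(s) = ℙ_{ξ,n}(s) / n` for `s ∈ Γ_{ξ,n}`; here `n` is the least natural number such that
  the first entry of `s` is below `ω^ξ n`;
* `ℙ_{ξ,1}(ω^ζ + t) = ℙ_{ζ+1,1}(t)` for `ξ` limit, `ζ < ξ`, `t ∈ Γ_{ζ+1,1}`; here `ζ` is the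
  base-`ω` logarithm of the first entry of `ω^ζ + t`. -/
def coeffOne (ξ : Ordinal.{u}) : List Ordinal.{u} → ℝ :=
  Ordinal.limitRecOn ξ (fun _ => 1)
    (fun ζ P s => P (lastBlock ζ s) / (sInf {n : ℕ | s.headD 0 < ω ^ ζ * n} : ℕ))
    (fun ξ _ P s =>
      if h : Order.succ (Ordinal.log ω (s.headD 0)) < ξ then
        P (Order.succ (Ordinal.log ω (s.headD 0))) h
          (s.map (· - ω ^ (Ordinal.log ω (s.headD 0))))
      else 0)

/-- The coefficients `ℙ_{ξ,n}` on `Γ_{ξ,n}`: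
`ℙ_{ξ,n}((ω^ξ(n-1)+t_1)⌢…⌢(ω^ξ(n-i)+t_i)) = ℙ_{ξ,1}(t_i)`; this formula does not
involve `n`. -/
def coeff (ξ : Ordinal.{u}) (s : List Ordinal.{u}) : ℝ := coeffOne ξ (lastBlock ξ s)

/-- `Γ_{ξ,n}.D`: sequences `(ζ_j, u_j)_j` with `(ζ_j)_j ∈ Γ_{ξ,n}` and `u_j ∈ D`. -/
def treeD (ξ : Ordinal.{u}) (n : ℕ) (D : Type u) : Set (List (Ordinal.{u} × D)) :=
  {t | t.map Prod.fst ∈ tree ξ n}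

/-! ### The quantities `θ_{ξ,n}` -/

section Theta

variable {𝕜 : Type*} [RCLike 𝕜] {X : Type u} [NormedAddCommGroup X] [NormedSpace 𝕜 X]

/-- `r_K(x) = max_{x* ∈ K} Re x*(x)`, and `0` if `K` is empty. -/
def supportFun (K : Set (WeakDual 𝕜 X)) (x : X) : ℝ := sSup ((fun f => RCLike.re (f x)) '' K)

variable (𝕜) in
/-- `(x_t)_{t ∈ Γ_{ξ,n}.D}` is weakly null: for each `t` (empty or in the tree) and each ordinal
`ζ` for which the sequences `t⌢(ζ,u)`, `u ∈ D`, lie in the tree, the net `(x_{t⌢(ζ,u)})_{u ∈ D}`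
converges weakly to `0`. Only the values of `x` on the tree matter. -/
def WeaklyNull (ξ : Ordinal.{u}) (n : ℕ) (D : Type u) [Preorder D]
    (x : List (Ordinal.{u} × D) → X) : Prop :=
  ∀ (t : List (Ordinal.{u} × D)) (ζ : Ordinal.{u}), (∀ a : D, t ++ [(ζ, a)] ∈ treeD ξ n D) →
    ∀ f : StrongDual 𝕜 X, Tendsto (fun a : D => f (x (t ++ [(ζ, a)]))) atTop (𝓝 0)

/-- For `t` maximal in `Γ_{ξ,n}.D`, the vector `∑_{∅ < s ≤ t} ℙ_{ξ,n}(s) x_s = ∑_{i=1}^n z_i^t`;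
`s` runs over the nonempty initial segments of `t`. -/
def branchSum (𝕜 : Type*) [RCLike 𝕜] {X : Type u} [NormedAddCommGroup X] [NormedSpace 𝕜 X]
    (ξ : Ordinal.{u}) {D : Type u} (x : List (Ordinal.{u} × D) → X)
    (t : List (Ordinal.{u} × D)) : X :=
  ∑ k ∈ Finset.range t.length,
    ((coeff ξ ((t.take (k + 1)).map Prod.fst) : ℝ) : 𝕜) • x (t.take (k + 1))

/-- `θ_{ξ,n}(K)`, for `n ≥ 1`. -/
def theta (ξ : Ordinal.{u}) (n : ℕ) (K : Set (WeakDual 𝕜 X)) : ℝ :=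
  sInf {θ : ℝ | 0 < θ ∧
    ∀ (D : Type u) [Preorder D] [IsDirectedOrder D] [Nonempty D]
      (x : List (Ordinal.{u} × D) → X),
      WeaklyNull 𝕜 ξ n D x → (∀ t ∈ treeD ξ n D, ‖x t‖ ≤ 1) →
      ⨅ t : maxNodes (treeD ξ n D), supportFun K ((1 / (n : 𝕜)) • branchSum 𝕜 ξ x t) ≤ θ}

/-- `θ_{ξ,n}(A) = θ_{ξ,n}(A* B_{Y*})`. -/
def opTheta {Y : Type v} [NormedAddCommGroup Y] [NormedSpace 𝕜 Y]
    (ξ : Ordinal.{u}) (n : ℕ) (A : X →L[𝕜] Y) : ℝ := theta ξ n (dualBallImage A)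

end Theta

/-! ### Direct sums and diagonal operators -/

/-- Exponents in `{0} ∪ [1, ∞]`. -/
abbrev Exponent := {p : ℝ≥0∞ // p = 0 ∨ 1 ≤ p}

/-- The `ℓ_q` whose norm is used for the exponent `p`: `q = p` if `p ≥ 1`, and `q = ∞` if
`p = 0`. -/
def Exponent.norm (p : Exponent) : ℝ≥0∞ := if p.1 = 0 then ∞ else p.1

instance (p : Exponent) : Fact (1 ≤ p.norm) := ⟨by
  unfold Exponent.norm
  split_ifs with h
  · exact le_top
  · exact p.2.resolve_left h⟩

section Sums

variable {ι : Type u} (𝕜 : Type*) [RCLike 𝕜]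

/-- `(⊕_i X_i)_{ℓ_p}` for `p ∈ {0} ∪ [1, ∞]`, where `ℓ_0` means `c_0`: for `p ≥ 1` this is all of
`lp X p`, and for `p = 0` it is the subspace of `lp X ∞` of all families tending to `0` in norm. -/
def directSum (X : ι → Type v) [∀ i, NormedAddCommGroup (X i)] [∀ i, NormedSpace 𝕜 (X i)]
    (p : Exponent) : Submodule 𝕜 (lp X p.norm) where
  carrier := {x | p.1 = 0 → Tendsto (fun i => ‖x i‖) cofinite (𝓝 0)}
  zero_mem' := fun _ => by simpa using tendsto_const_nhds
  add_mem' := by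
    intro a b ha hb h
    have := (ha h).add (hb h)
    rw [add_zero] at this
    exact squeeze_zero (fun _ => norm_nonneg _) (fun i => norm_add_le _ _) this
  smul_mem' := by
    intro c x hx h
    have := (hx h).const_mul ‖c‖
    rw [mul_zero] at this
    exact squeeze_zero (fun _ => norm_nonneg _) (fun i => (norm_smul_le c (x i))) this

variable {𝕜}
variable {X : ι → Type u} [∀ i, NormedAddCommGroup (X i)] [∀ i, NormedSpace 𝕜 (X i)]
  {Y : ι → Type v} [∀ i, NormedAddCommGroup (Y i)] [∀ i, NormedSpace 𝕜 (Y i)]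

/-- Either `r = 0` and `p < ∞`, or `1 ≤ p ≤ r ≤ ∞`, `1 < r` and `p < ∞`. -/
def Admissible (p r : Exponent) : Prop :=
  (r.1 = 0 ∧ p.1 < ∞) ∨ (1 ≤ p.1 ∧ p.1 ≤ r.1 ∧ 1 < r.1 ∧ p.1 < ∞)

variable (A : ∀ i, X i →L[𝕜] Y i) {p r : Exponent}

/-- The values of the diagonal operator lie in the target space. -/
theorem diag_memℓp (hA : ∃ R, ∀ i, ‖A i‖ ≤ R) (h : Admissible p r) (x : directSum 𝕜 X p) :
    Memℓp (fun i => A i (x.1 i)) r.norm := by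
  obtain ⟨R, hR⟩ := hA
  have h1 : Memℓp (fun i => A i (x.1 i)) p.norm := by
    have hx : Memℓp (fun i => R • ‖x.1 i‖) p.norm := (lp.memℓp x.1).norm.const_smul R
    refine hx.mono' fun i => ?_
    have := (A i).le_of_opNorm_le (hR i) (x.1 i)
    rw [norm_smul, norm_norm, Real.norm_eq_abs]
    exact this.trans (mul_le_mul_of_nonneg_right (le_abs_self R) (norm_nonneg _))
  refine h1.of_exponent_ge ?_
  rcases h with ⟨hr, -⟩ | ⟨hp, hpr, -, -⟩
  · simp [Exponent.norm, hr]
  · have h0 : p.1 ≠ 0 := (zero_lt_one.trans_le hp).ne'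
    have h0' : r.1 ≠ 0 := (zero_lt_one.trans_le (hp.trans hpr)).ne'
    simpa [Exponent.norm, h0, h0'] using hpr

theorem tendsto_norm_zero (h : p.1 < ∞) (x : directSum 𝕜 X p) :
    Tendsto (fun i => ‖x.1 i‖) cofinite (𝓝 0) := by
  by_cases hp : p.1 = 0
  · exact x.2 hp
  · have hn : p.norm = p.1 := by simp [Exponent.norm, hp]
    have hpos : 0 < p.norm.toReal := by
      rw [hn]; exact ENNReal.toReal_pos hp h.ne
    have := ((lp.memℓp x.1).summable hpos).tendsto_cofinite_zero
    have h2 := this.rpow_const (p := p.norm.toReal⁻¹) (Or.inr (by positivity))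
    rw [Real.zero_rpow (by positivity)] at h2
    refine h2.congr fun i => ?_
    rw [← Real.rpow_mul (norm_nonneg _), mul_inv_cancel₀ hpos.ne', Real.rpow_one]

/-- `D^{p,r}` as a linear map, `(x_i)_i ↦ (A_i x_i)_i`. -/
def diagLinear (hA : ∃ R, ∀ i, ‖A i‖ ≤ R) (h : Admissible p r) :
    directSum 𝕜 X p →ₗ[𝕜] directSum 𝕜 Y r where
  toFun x := ⟨⟨fun i => A i (x.1 i), diag_memℓp A hA h x⟩, fun hr => by
    obtain ⟨R, hR⟩ := hA
    have hp : p.1 < ∞ := by rcases h with h | h <;> tauto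
    have := (tendsto_norm_zero hp x).const_mul R
    rw [mul_zero] at this
    exact squeeze_zero (fun _ => norm_nonneg _)
      (fun i => (A i).le_of_opNorm_le (hR i) (x.1 i)) this⟩
  map_add' x y := by
    ext i
    exact map_add (A i) _ _
  map_smul' c x := by
    ext i
    exact map_smul (A i) _ _

theorem norm_diagLinear_le (hA : ∃ R, ∀ i, ‖A i‖ ≤ R) (h : Admissible p r) :
    ∃ C, ∀ x, ‖diagLinear A hA h x‖ ≤ C * ‖x‖ := by
  obtain ⟨R, hR⟩ := id hA
  refine ⟨max R 0, fun x => ?_⟩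
  have hR0 : (0 : ℝ) ≤ max R 0 := le_max_right _ _
  have hpt : ∀ i, ‖A i (x.1 i)‖ ≤ max R 0 * ‖x.1 i‖ := fun i =>
    (A i).le_of_opNorm_le ((hR i).trans (le_max_left _ _)) _
  have hp0 : p.norm ≠ 0 := (zero_lt_one.trans_le Fact.out).ne'
  have hr0 : r.norm ≠ 0 := (zero_lt_one.trans_le Fact.out).ne'
  have hx0 : 0 ≤ ‖x.1‖ := norm_nonneg _
  change ‖(diagLinear A hA h x).1‖ ≤ max R 0 * ‖x.1‖
  have hval : ∀ i, (diagLinear A hA h x).1 i = A i (x.1 i) := fun _ => rfl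
  generalize (diagLinear A hA h x).1 = y at hval ⊢
  have hCx : 0 ≤ max R 0 * ‖x.1‖ := mul_nonneg hR0 hx0
  by_cases hrt : r.norm = ∞
  · have hy : ∀ i, ‖y i‖ ≤ max R 0 * ‖x.1‖ := fun i => by
      rw [hval]
      exact (hpt i).trans (mul_le_mul_of_nonneg_left (lp.norm_apply_le_norm hp0 x.1 i) hR0)
    generalize r.norm = q at y hrt hy
    subst hrt
    exact lp.norm_le_of_forall_le hCx hy
  · have hrpos : 0 < r.norm.toReal := ENNReal.toReal_pos hr0 hrt
    have hpr : p.norm ≤ r.norm := by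
      rcases h with ⟨hr, -⟩ | ⟨hp, hpr, -, -⟩
      · exact absurd (by simp [Exponent.norm, hr]) hrt
      · have h0 : p.1 ≠ 0 := (zero_lt_one.trans_le hp).ne'
        have h0' : r.1 ≠ 0 := (zero_lt_one.trans_le (hp.trans hpr)).ne'
        simpa [Exponent.norm, h0, h0'] using hpr
    have hpt' : p.norm ≠ ∞ := ne_top_of_le_ne_top hrt hpr
    have hppos : 0 < p.norm.toReal := ENNReal.toReal_pos hp0 hpt'
    have hle : p.norm.toReal ≤ r.norm.toReal := ENNReal.toReal_mono hrt hpr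
    refine lp.norm_le_of_forall_sum_le hrpos hCx fun s => ?_
    have key : ∀ i, ‖y i‖ ^ r.norm.toReal ≤ max R 0 ^ r.norm.toReal *
        ‖x.1‖ ^ (r.norm.toReal - p.norm.toReal) * ‖x.1 i‖ ^ p.norm.toReal := fun i => by
      rw [hval]
      calc ‖A i (x.1 i)‖ ^ r.norm.toReal
          ≤ (max R 0 * ‖x.1 i‖) ^ r.norm.toReal :=
            Real.rpow_le_rpow (norm_nonneg _) (hpt i) hrpos.le
        _ = max R 0 ^ r.norm.toReal *
            (‖x.1 i‖ ^ (r.norm.toReal - p.norm.toReal) * ‖x.1 i‖ ^ p.norm.toReal) := by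
            rw [Real.mul_rpow hR0 (norm_nonneg _), ← Real.rpow_add_of_nonneg (norm_nonneg _)
              (sub_nonneg.2 hle) hppos.le, sub_add_cancel]
        _ ≤ _ := by
            rw [mul_assoc]
            gcongr
            exact lp.norm_apply_le_norm hp0 x.1 i
    calc ∑ i ∈ s, ‖y i‖ ^ r.norm.toReal
        ≤ ∑ i ∈ s, max R 0 ^ r.norm.toReal *
          ‖x.1‖ ^ (r.norm.toReal - p.norm.toReal) * ‖x.1 i‖ ^ p.norm.toReal :=
          Finset.sum_le_sum fun i _ => key i
      _ = max R 0 ^ r.norm.toReal * ‖x.1‖ ^ (r.norm.toReal - p.norm.toReal) *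
          ∑ i ∈ s, ‖x.1 i‖ ^ p.norm.toReal := by rw [Finset.mul_sum]
      _ ≤ max R 0 ^ r.norm.toReal * ‖x.1‖ ^ (r.norm.toReal - p.norm.toReal) *
          ‖x.1‖ ^ p.norm.toReal := by
          gcongr
          exact lp.sum_rpow_le_norm_rpow hppos x.1 s
      _ = (max R 0 * ‖x.1‖) ^ r.norm.toReal := by
          rw [Real.mul_rpow hR0 hx0, mul_assoc, ← Real.rpow_add_of_nonneg hx0
              (sub_nonneg.2 hle) hppos.le, sub_add_cancel]

/-- The diagonal operator `D^{p,r} : (⊕ X_i)_{ℓ_p} → (⊕ Y_i)_{ℓ_r}`, `(x_i)_i ↦ (A_i x_i)_i`. -/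
def diagOp (hA : ∃ R, ∀ i, ‖A i‖ ≤ R) (h : Admissible p r) :
    directSum 𝕜 X p →L[𝕜] directSum 𝕜 Y r :=
  (diagLinear A hA h).mkContinuousOfExistsBound (norm_diagLinear_le A hA h)

end Sums

/-! ### The formulas for `ℙ_{ξ,n}` satisfy the recursion defining these coefficients -/

section Recursion

open Ordinal

/-- All members of `G` are nonempty sequences with entries below `ω^ξ`. -/
def BoundedBy (ξ : Ordinal.{u}) (G : Set (List Ordinal.{u})) : Prop := ∀ s ∈ G, s ≠ [] ∧ ∀ a ∈ s, a < ω ^ ξ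

theorem omega_opow_pos (ξ : Ordinal.{u}) : (0 : Ordinal.{u}) < ω ^ ξ := opow_pos _ omega0_pos

theorem stack_ok {ξ : Ordinal.{u}} {G} (hG : BoundedBy ξ G) (n : ℕ) : ∀ s ∈ stack ξ G (n+1),
    s ≠ [] ∧ (∀ a ∈ s, a < ω ^ ξ * ((n+1 : ℕ) : Ordinal)) ∧ ω ^ ξ * n ≤ s.headD 0 := by
  induction n with
  | zero =>
    intro s hs
    rcases hs with ⟨t, ht, rfl⟩ | ⟨t, ht, u, hu, rfl⟩
    · obtain ⟨h1, h2⟩ := hG t ht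
      refine ⟨by simpa [shift] using h1, ?_, by simp⟩
      intro a ha
      simp [shift] at ha
      simpa using h2 a ha
    · exact hu.elim
  | succ n ih =>
    have hsh : ∀ t ∈ G, shift (ω ^ ξ * (n+1 : ℕ)) t ≠ [] ∧ (∀ a ∈ shift (ω ^ ξ * (n+1 : ℕ)) t, a < ω ^ ξ * ((n+1+1 : ℕ) : Ordinal)) ∧ ω ^ ξ * (n+1 : ℕ) ≤ (shift (ω ^ ξ * (n+1 : ℕ)) t).headD 0 := by
      intro t ht
      obtain ⟨h1, h2⟩ := hG t ht
      refine ⟨by simpa [shift] using h1, ?_, ?_⟩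
      · intro a ha
        simp only [shift, List.mem_map] at ha
        obtain ⟨b, hb, rfl⟩ := ha
        rw [Nat.cast_succ (n+1), mul_add_one]
        exact (add_lt_add_iff_left _).2 (h2 b hb)
      · cases t with
        | nil => exact absurd rfl h1
        | cons a t => simp [shift]
    intro s hs
    rcases hs with ⟨t, ht, rfl⟩ | ⟨t, ht, u, hu, rfl⟩
    · exact hsh t ht
    · obtain ⟨a, b, c⟩ := hsh t ht.1
      obtain ⟨a', b', c'⟩ := ih u hu
      refine ⟨by simp [a'], ?_, ?_⟩
      · intro z hz
        rcases List.mem_append.1 hz with hz | hz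
        · exact b z hz
        · refine (b' z hz).trans_le ?_
          gcongr; simp
      · revert a c
        cases shift (ω ^ ξ * (n+1 : ℕ)) t with
        | nil => simp
        | cons x t => simp

theorem treeOne_ok (ξ : Ordinal.{u}) : BoundedBy ξ (treeOne ξ) := by
  induction ξ using Ordinal.limitRecOn with
  | zero => unfold treeOne; rw [limitRecOn_zero]; intro s hs; obtain rfl : s = [0] := hs; simp
  | add_one ζ ih =>
    unfold treeOne; rw [limitRecOn_add_one]; intro s hs
    obtain ⟨n, hn, hs⟩ := hs
    obtain ⟨n, rfl⟩ := Nat.exists_eq_add_of_le' hn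
    obtain ⟨a, b, c⟩ := stack_ok ih n s hs
    refine ⟨a, fun z hz => (b z hz).trans ?_⟩
    rw [opow_add, opow_one]
    exact (mul_lt_mul_iff_right₀ (omega_opow_pos ζ)).2 (natCast_lt_omega0 _)
  | limit ξ hξ ih =>
    unfold treeOne; rw [limitRecOn_limit _ _ _ _ hξ]; intro s hs
    obtain ⟨ζ, h, t, ht, rfl⟩ := hs
    obtain ⟨a, b⟩ := ih _ (hξ.succ_lt h) t ht
    refine ⟨by simpa [shift] using a, fun z hz => ?_⟩
    simp only [shift, List.mem_map] at hz
    obtain ⟨y, hy, rfl⟩ := hz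
    have h1 : ω ^ (Order.succ ζ) < ω ^ ξ := (opow_lt_opow_iff_right one_lt_omega0).2 (hξ.succ_lt h)
    exact isPrincipal_add_omega0_opow ξ ((opow_lt_opow_iff_right one_lt_omega0).2 h) ((b y hy).trans h1)

theorem lastBlock_shift {ξ : Ordinal.{u}} {t} (ht : t ∈ treeOne ξ) (c : Ordinal) :
    lastBlock ξ (shift (ω ^ ξ * c) t) = t := by
  obtain ⟨a, b⟩ := treeOne_ok ξ t ht
  have hd : ∀ x ∈ t, (ω ^ ξ * c + x) / ω ^ ξ = c := fun x hx => by
    rw [mul_add_div _ (omega_opow_pos ξ).ne', div_eq_zero_of_lt (b x hx), add_zero]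
  have hl : (shift (ω ^ ξ * c) t).getLastD 0 / ω ^ ξ = c := by
    obtain ⟨l, x, rfl⟩ := List.eq_nil_or_concat t |>.resolve_left a
    simp [shift]
    simpa using hd x (by simp)
  unfold lastBlock
  rw [hl, List.filter_eq_self.2]
  · conv_rhs => rw [← List.map_id t]
    simp only [shift, List.map_map]
    refine List.map_congr_left fun x hx => ?_
    simp [mul_add_mod_self, mod_eq_of_lt (b x hx)]
  · intro y hy
    simp only [shift, List.mem_map] at hy
    obtain ⟨x, hx, rfl⟩ := hy
    simpa using hd x hx

theorem lastBlock_append {ξ : Ordinal.{u}} {n : ℕ} {t s} (ht : t ∈ treeOne ξ) (hs : s ∈ tree ξ n) :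
    lastBlock ξ (shift (ω ^ ξ * n) t ++ s) = lastBlock ξ s := by
  cases n with
  | zero => exact hs.elim
  | succ n =>
  obtain ⟨a, b⟩ := treeOne_ok ξ t ht
  obtain ⟨a', b', -⟩ := stack_ok (treeOne_ok ξ) n s hs
  have hd : ∀ x ∈ t, (ω ^ ξ * (n+1 : ℕ) + x) / ω ^ ξ = (n+1 : ℕ) := fun x hx => by
    rw [mul_add_div _ (omega_opow_pos ξ).ne', div_eq_zero_of_lt (b x hx), add_zero]
  obtain ⟨l, x, rfl⟩ := List.eq_nil_or_concat s |>.resolve_left a'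
  have hx : x / ω ^ ξ < (n+1 : ℕ) := (lt_mul_iff_div_lt (omega_opow_pos ξ).ne').1 (b' x (by simp))
  have e : ∀ l' : List Ordinal.{u}, (l' ++ l.concat x).getLastD 0 = x := fun l' => by
    rw [List.getLastD_eq_getLast?]; simp
  have e' : (l.concat x).getLastD 0 = x := e []
  unfold lastBlock
  rw [e, e', List.filter_append, List.filter_eq_nil_iff.2]
  · simp
  · intro y hy
    simp only [shift, List.mem_map] at hy
    obtain ⟨z, hz, rfl⟩ := hy
    rw [hd z hz]
    simpa using hx.ne'

theorem coeff_shift {ξ : Ordinal.{u}} {t} (ht : t ∈ treeOne ξ) (c : Ordinal) :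
    coeff ξ (shift (ω ^ ξ * c) t) = coeffOne ξ t := by rw [coeff, lastBlock_shift ht]

theorem coeff_append {ξ : Ordinal.{u}} {n : ℕ} {t s} (ht : t ∈ treeOne ξ) (hs : s ∈ tree ξ n) :
    coeff ξ (shift (ω ^ ξ * n) t ++ s) = coeff ξ s := by rw [coeff, coeff, lastBlock_append ht hs]

theorem coeffOne_zero : coeffOne (0 : Ordinal.{u}) [0] = 1 := by
  unfold coeffOne; rw [limitRecOn_zero]

theorem coeffOne_succ {ξ : Ordinal.{u}} {n : ℕ} {s} (hs : s ∈ tree ξ n) :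
    coeffOne (ξ + 1) s = coeff ξ s / n := by
  cases n with
  | zero => exact hs.elim
  | succ n =>
  obtain ⟨a, b, c⟩ := stack_ok (treeOne_ok ξ) n s hs
  have : sInf {k : ℕ | s.headD 0 < ω ^ ξ * k} = n + 1 := by
    apply le_antisymm
    · refine Nat.sInf_le ?_
      cases s with
      | nil => exact absurd rfl a
      | cons x s => exact b _ (by simp)
    · refine le_csInf ⟨n+1, ?_⟩ fun k hk => ?_
      · cases s with
        | nil => exact absurd rfl a
        | cons x s => exact b _ (by simp)
      · have := c.trans_lt hk
        rw [mul_lt_mul_iff_right₀ (omega_opow_pos ξ)] at this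
        exact_mod_cast this
  unfold coeffOne; rw [limitRecOn_add_one, this]; rfl

theorem coeffOne_limit {ξ : Ordinal.{u}} (hξ : Order.IsSuccLimit ξ) {ζ} (h : ζ < ξ) {t}
    (ht : t ∈ treeOne (Order.succ ζ)) :
    coeffOne ξ (shift (ω ^ ζ) t) = coeffOne (Order.succ ζ) t := by
  obtain ⟨a, b⟩ := treeOne_ok _ t ht
  have hlog : log ω ((shift (ω ^ ζ) t).headD 0) = ζ := by
    cases t with
    | nil => exact absurd rfl a
    | cons x t =>
      have := b x (by simp)
      have hp : (shift (ω ^ ζ) (x :: t)).headD 0 = ω ^ ζ + x := by simp [shift]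
      rw [hp]
      have hlt : ω ^ ζ + x < ω ^ (Order.succ ζ) :=
        isPrincipal_add_omega0_opow _ ((opow_lt_opow_iff_right one_lt_omega0).2 (Order.lt_succ ζ)) this
      apply le_antisymm
      · rw [← Order.lt_succ_iff]; exact (lt_opow_iff_log_lt one_lt_omega0 (by simp )).1 hlt
      · exact (opow_le_iff_le_log one_lt_omega0 (by simp)).1 le_self_add
  have hm : (shift (ω ^ ζ) t).map (· - ω ^ ζ) = t := by simp [shift, Function.comp_def]
  conv_lhs => unfold coeffOne
  rw [limitRecOn_limit _ _ _ _ hξ]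
  simp only [hlog]
  rw [dif_pos (hξ.succ_lt h), hm]; rfl

end Recursion

end

end Szlenk

/-!
If `k ∈ A* B_{Y*}` survives `α` derivations at scale `ε`, then so does, at scale `ε / 4`, its image
`f / 2` under the affine map `g ↦ f / 2 - k / 4 + g / 4` of `A* B_{Y*}` into itself. If all orders
below `ω^ξ` occur here, then `2^{-n} A* B_{Y*}` survives `ω^ξ n` derivations at scale
`2^{-(n+1)} ε`, so the Szlenk index is at least `ω^(ξ+1)`. This is applied to the diagonal operator.

Conversely, let `ω^ζ m` derivations at scale `ε / 8` suffice for every `A_λ`, and take functionals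
on the direct sum whose `ℓ_q`-mass is concentrated on a finite set of coordinates, where `q` is
conjugate to `r`. They survive `ω^ζ` derivations at scale `ε` only if coordinates carrying a fixed
mass `c` are derived `ω^ζ` times: otherwise the derivations of the coordinates are counted by a
natural (Hessenberg) sum of finitely many ordinals below `ω^ζ`, which is again below `ω^ζ`. Each
coordinate affords this at most `m` times, so finitely many blocks of `ω^ζ` derivations reduce the
mass of the dual ball to `1 - c`, and repeating this makes its diameter at most `ε`.

For `θ_{ζ,n}`, on a suitable branch of a weakly null tree each of the `n` blocks with a large
average costs a functional `ω^ζ` derivations, so few blocks contribute. In the other direction,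
functionals chosen at decreasing stages below `ω^ζ n` give a weakly null tree such that along every
branch some functional is at least `ε / 5` on all vectors.
-/

namespace Szlenk

section Basics

variable {𝕜 : Type*} [RCLike 𝕜] {X : Type u} [NormedAddCommGroup X] [NormedSpace 𝕜 X]

theorem mem_deriv_iff {ε : ℝ} (hε : 0 ≤ ε) {K : Set (WeakDual 𝕜 X)} {f : WeakDual 𝕜 X} :
    f ∈ deriv ε K ↔ f ∈ K ∧ ∀ V ∈ 𝓝 f, ∃ g ∈ V ∩ K, ∃ h ∈ V ∩ K,
      ε < ‖WeakDual.toStrongDual (g - h)‖ := by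
  have lt_ediam_iff : ∀ S : Set (WeakDual 𝕜 X),
      ENNReal.ofReal ε < Metric.ediam (WeakDual.toStrongDual '' S) ↔
        ∃ g ∈ S, ∃ h ∈ S, ε < ‖WeakDual.toStrongDual (g - h)‖ := by
    intro S
    rw [← not_le, Metric.ediam_image_le_iff]
    push Not
    refine exists_congr fun g => and_congr_right fun _ => exists_congr fun h =>
      and_congr_right fun _ => ?_
    rw [edist_dist, ENNReal.ofReal_lt_ofReal_iff_of_nonneg hε, dist_eq_norm, map_sub]
  unfold deriv
  simp only [Set.mem_ofPred_eq, lt_ediam_iff]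

theorem exists_nhds_of_notMem_deriv {ε : ℝ} (hε : 0 ≤ ε) {K : Set (WeakDual 𝕜 X)}
    {f : WeakDual 𝕜 X} (hf : f ∈ K) (h : f ∉ deriv ε K) :
    ∃ V ∈ 𝓝 f, ∀ g ∈ V ∩ K, ∀ h ∈ V ∩ K, ‖WeakDual.toStrongDual (g - h)‖ ≤ ε := by
  rw [mem_deriv_iff hε] at h
  push Not at h
  exact h hf

theorem deriv_subset (ε : ℝ) (K : Set (WeakDual 𝕜 X)) : deriv ε K ⊆ K := fun _ h => h.1

theorem deriv_mono {ε ε' : ℝ} (h : ε' ≤ ε) {K L : Set (WeakDual 𝕜 X)} (hKL : K ⊆ L) :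
    deriv ε K ⊆ deriv ε' L := fun _ hf => ⟨hKL hf.1, fun V hV =>
  (ENNReal.ofReal_le_ofReal h).trans_lt ((hf.2 V hV).trans_le
    (Metric.ediam_mono (Set.image_mono (Set.inter_subset_inter_right _ hKL))))⟩

theorem isClosed_deriv (ε : ℝ) {K : Set (WeakDual 𝕜 X)} (hK : IsClosed K) :
    IsClosed (deriv ε K) := by
  rw [← isOpen_compl_iff, isOpen_iff_mem_nhds]
  intro f hf
  by_cases hfK : f ∈ K
  · have : ∃ V ∈ 𝓝 f, ¬ ENNReal.ofReal ε < Metric.ediam (WeakDual.toStrongDual '' (V ∩ K)) := by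
      by_contra! h
      exact hf ⟨hfK, h⟩
    obtain ⟨V, hV, hd⟩ := this
    filter_upwards [eventually_mem_nhds_iff.2 hV] with g hg hgd
    exact hd (hgd.2 V hg)
  · filter_upwards [hK.isOpen_compl.mem_nhds hfK] with g hg hgd
    exact hg hgd.1

@[simp]
theorem iterDeriv_zero (ε : ℝ) (K : Set (WeakDual 𝕜 X)) : iterDeriv ε K 0 = K :=
  Ordinal.limitRecOn_zero _ _ _

theorem iterDeriv_add_one (ε : ℝ) (K : Set (WeakDual 𝕜 X)) (α : Ordinal.{u}) :
    iterDeriv ε K (α + 1) = deriv ε (iterDeriv ε K α) :=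
  Ordinal.limitRecOn_add_one _ _ _ _

theorem iterDeriv_limit (ε : ℝ) (K : Set (WeakDual 𝕜 X)) {α : Ordinal.{u}}
    (hα : Order.IsSuccLimit α) : iterDeriv ε K α = ⋂ β < α, iterDeriv ε K β :=
  Ordinal.limitRecOn_limit _ _ _ _ hα

theorem iterDeriv_antitone (ε : ℝ) (K : Set (WeakDual 𝕜 X)) : Antitone (iterDeriv ε K) := by
  intro α β h
  induction β using Ordinal.limitRecOn with
  | zero => rw [nonpos_iff_eq_zero.1 h]
  | add_one β ih =>
    rcases h.eq_or_lt with rfl | h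
    · exact le_rfl
    · rw [iterDeriv_add_one]
      exact (deriv_subset _ _).trans (ih (Order.lt_add_one_iff.1 h))
  | limit β hβ ih =>
    rcases h.eq_or_lt with rfl | h
    · exact le_rfl
    · rw [iterDeriv_limit _ _ hβ]
      exact Set.iInter₂_subset α h

theorem iterDeriv_subset (ε : ℝ) (K : Set (WeakDual 𝕜 X)) (α : Ordinal.{u}) :
    iterDeriv ε K α ⊆ K := by
  simpa using iterDeriv_antitone ε K (zero_le (a := α))

theorem iterDeriv_mono {ε ε' : ℝ} (h : ε' ≤ ε) {K L : Set (WeakDual 𝕜 X)} (hKL : K ⊆ L)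
    (α : Ordinal.{u}) : iterDeriv ε K α ⊆ iterDeriv ε' L α := by
  induction α using Ordinal.limitRecOn with
  | zero => simpa using hKL
  | add_one β ih =>
    rw [iterDeriv_add_one, iterDeriv_add_one]
    exact deriv_mono h ih
  | limit β hβ ih =>
    rw [iterDeriv_limit _ _ hβ, iterDeriv_limit _ _ hβ]
    exact Set.iInter₂_mono ih

theorem isClosed_iterDeriv (ε : ℝ) {K : Set (WeakDual 𝕜 X)} (hK : IsClosed K) (α : Ordinal.{u}) :
    IsClosed (iterDeriv ε K α) := by
  induction α using Ordinal.limitRecOn with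
  | zero => simpa using hK
  | add_one β ih => rw [iterDeriv_add_one]; exact isClosed_deriv _ ih
  | limit β hβ ih => rw [iterDeriv_limit _ _ hβ]; exact isClosed_biInter ih

theorem iterDeriv_add (ε : ℝ) (K : Set (WeakDual 𝕜 X)) (α β : Ordinal.{u}) :
    iterDeriv ε K (α + β) = iterDeriv ε (iterDeriv ε K α) β := by
  induction β using Ordinal.limitRecOn with
  | zero => simp
  | add_one β ih => rw [← add_assoc, iterDeriv_add_one, iterDeriv_add_one, ih]
  | limit β hβ ih =>
    rw [iterDeriv_limit _ _ hβ, iterDeriv_limit _ _ (Ordinal.isSuccLimit_add α hβ)]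
    refine Set.Subset.antisymm (Set.subset_iInter₂ fun γ hγ => ?_)
      (Set.subset_iInter₂ fun γ hγ => ?_)
    · rw [← ih γ hγ]
      exact Set.iInter₂_subset (α + γ) (by gcongr)
    · rcases le_total γ α with h | h
      · refine (Set.iInter₂_subset 0 hβ.bot_lt).trans ?_
        rw [iterDeriv_zero]
        exact iterDeriv_antitone _ _ h
      · have hlt : γ - α < β := by
          rw [← Ordinal.add_sub_cancel_of_le h] at hγ
          simpa using hγ
        refine (Set.iInter₂_subset (γ - α) hlt).trans ?_
        rw [← ih _ hlt, Ordinal.add_sub_cancel_of_le h]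

theorem iterDeriv_mul_natCast_add_one (ε : ℝ) (K : Set (WeakDual 𝕜 X)) (α : Ordinal.{u}) (n : ℕ) :
    iterDeriv ε K (α * ((n + 1 : ℕ) : Ordinal.{u})) =
      iterDeriv ε (iterDeriv ε K (α * (n : Ordinal.{u}))) α := by
  rw [Nat.cast_succ, mul_add_one, iterDeriv_add]

theorem iterDeriv_inter_subset (ε : ℝ) (L : Set (WeakDual 𝕜 X)) {U : Set (WeakDual 𝕜 X)}
    (hU : IsOpen U) (α : Ordinal.{u}) :
    iterDeriv ε L α ∩ U ⊆ iterDeriv ε (L ∩ U) α := by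
  induction α using Ordinal.limitRecOn with
  | zero => simp
  | add_one β ih =>
    rw [iterDeriv_add_one, iterDeriv_add_one]
    rintro f ⟨hf, hfU⟩
    refine ⟨ih ⟨hf.1, hfU⟩, fun V hV => (hf.2 (V ∩ U) (inter_mem hV (hU.mem_nhds hfU))).trans_le
      (Metric.ediam_mono (Set.image_mono ?_))⟩
    rintro g ⟨⟨h1, h2⟩, h3⟩
    exact ⟨h1, ih ⟨h3, h2⟩⟩
  | limit β hβ ih =>
    rw [iterDeriv_limit _ _ hβ, iterDeriv_limit _ _ hβ]
    rintro f ⟨hf, hfU⟩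
    simp only [Set.mem_iInter] at hf ⊢
    exact fun γ hγ => ih γ hγ ⟨hf γ hγ, hfU⟩

theorem map_mem_iterDeriv {Z : Type u} [NormedAddCommGroup Z] [NormedSpace 𝕜 Z]
    {K : Set (WeakDual 𝕜 X)} {L : Set (WeakDual 𝕜 Z)} {T : WeakDual 𝕜 X → WeakDual 𝕜 Z}
    {c ε : ℝ} (hc : 0 < c) (hε : 0 ≤ ε) (hT : Continuous T) (hKL : Set.MapsTo T K L)
    (hd : ∀ f ∈ K, ∀ g ∈ K, c * ‖WeakDual.toStrongDual (f - g)‖ ≤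
      ‖WeakDual.toStrongDual (T f - T g)‖)
    (α : Ordinal.{u}) : Set.MapsTo T (iterDeriv ε K α) (iterDeriv (c * ε) L α) := by
  induction α using Ordinal.limitRecOn with
  | zero => simpa using hKL
  | add_one β ih =>
    rw [iterDeriv_add_one, iterDeriv_add_one]
    intro f hf
    rw [mem_deriv_iff hε] at hf
    rw [mem_deriv_iff (by positivity)]
    refine ⟨ih hf.1, fun V hV => ?_⟩
    obtain ⟨g, hg, h, hh, hlt⟩ := hf.2 _ (hT.continuousAt hV)
    exact ⟨T g, ⟨hg.1, ih hg.2⟩, T h, ⟨hh.1, ih hh.2⟩,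
      (mul_lt_mul_of_pos_left hlt hc).trans_le
        (hd g (iterDeriv_subset _ _ _ hg.2) h (iterDeriv_subset _ _ _ hh.2))⟩
  | limit β hβ ih =>
    rw [iterDeriv_limit _ _ hβ, iterDeriv_limit _ _ hβ]
    intro f hf
    simp only [Set.mem_iInter] at hf ⊢
    exact fun γ hγ => ih γ hγ (hf γ hγ)

theorem exists_iterDeriv_subset_of_limit {ε : ℝ} {K O : Set (WeakDual 𝕜 X)} (hK : IsCompact K)
    (hO : IsOpen O) {α : Ordinal.{u}} (hα : Order.IsSuccLimit α) (h : iterDeriv ε K α ⊆ O) :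
    ∃ β < α, iterDeriv ε K β ⊆ O := by
  replace h : ⋂ β : {β // β < α}, iterDeriv ε K β ⊆ O := by
    rwa [Set.iInter_subtype, ← iterDeriv_limit _ _ hα]
  have : Nonempty {β // β < α} := ⟨⟨0, hα.bot_lt⟩⟩
  obtain ⟨⟨β, hβ⟩, hb⟩ := exists_subset_nhds_of_isCompact'
    (V := fun β : {β // β < α} => iterDeriv ε K β)
    (fun β γ => ⟨max β γ, iterDeriv_antitone _ _ (le_max_left _ _),
      iterDeriv_antitone _ _ (le_max_right _ _)⟩)
    (fun β => hK.of_isClosed_subset (isClosed_iterDeriv _ hK.isClosed _) (iterDeriv_subset _ _ _))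
    (fun β => isClosed_iterDeriv _ hK.isClosed _)
    (U := O) (fun f hf => hO.mem_nhds (h hf))
  exact ⟨β, hβ, hb⟩

theorem indexEps_le_iff {K : Set (WeakDual 𝕜 X)} {ε : ℝ} {α : Ordinal.{u}} :
    indexEps K ε ≤ α ↔ iterDeriv ε K α = ∅ := by
  refine ⟨fun h => ?_, fun h => sInf_le ⟨α, h, rfl⟩⟩
  set S := {a : WithTop Ordinal.{u} | ∃ α : Ordinal.{u}, iterDeriv ε K α = ∅ ∧ a = α}
  have hS : indexEps K ε = sInf S := rfl
  have hne : S.Nonempty := by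
    by_contra hne
    rw [hS, Set.not_nonempty_iff_eq_empty.1 hne, sInf_empty] at h
    exact absurd (top_le_iff.1 h) WithTop.coe_ne_top
  obtain ⟨β, hβ, hb⟩ := csInf_mem hne
  rw [← hS] at hb
  rw [hb, WithTop.coe_le_coe] at h
  exact Set.subset_eq_empty (iterDeriv_antitone ε K h) hβ

theorem index_le_iff {K : Set (WeakDual 𝕜 X)} {α : Ordinal.{u}} :
    index K ≤ α ↔ ∀ ε : ℝ, 0 < ε → iterDeriv ε K α = ∅ := by
  simp only [index, iSup_le_iff, Subtype.forall, indexEps_le_iff]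

end Basics

/-! ### The sets `A* B_{Y*}` -/

section DualBall

variable {𝕜 : Type*} [RCLike 𝕜] {X : Type u} [NormedAddCommGroup X] [NormedSpace 𝕜 X]
  {Y : Type v} [NormedAddCommGroup Y] [NormedSpace 𝕜 Y]

theorem dualBallImage_eq_image (A : X →L[𝕜] Y) : dualBallImage A =
    (fun g : WeakDual 𝕜 Y => StrongDual.toWeakDual ((WeakDual.toStrongDual g).comp A)) ''
      (WeakDual.toStrongDual ⁻¹' Metric.closedBall 0 1) := by
  ext f
  constructor
  · rintro ⟨g, hg, rfl⟩
    exact ⟨StrongDual.toWeakDual g, by simpa using hg, rfl⟩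
  · rintro ⟨g, hg, rfl⟩
    exact ⟨WeakDual.toStrongDual g, by simpa using hg, rfl⟩

theorem continuous_toWeakDual_comp (A : X →L[𝕜] Y) : Continuous
    (fun g : WeakDual 𝕜 Y => StrongDual.toWeakDual ((WeakDual.toStrongDual g).comp A)) :=
  WeakDual.continuous_of_continuous_eval fun x => WeakDual.eval_continuous (A x)

theorem isCompact_dualBallImage (A : X →L[𝕜] Y) : IsCompact (dualBallImage A) := by
  rw [dualBallImage_eq_image]
  exact (WeakDual.isCompact_closedBall 0 1).image (continuous_toWeakDual_comp A)

theorem zero_mem_dualBallImage (A : X →L[𝕜] Y) : (0 : WeakDual 𝕜 X) ∈ dualBallImage A :=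
  ⟨0, by simp, by simp⟩

theorem norm_le_of_mem_dualBallImage {A : X →L[𝕜] Y} {f : WeakDual 𝕜 X}
    (hf : f ∈ dualBallImage A) : ‖WeakDual.toStrongDual f‖ ≤ ‖A‖ := by
  obtain ⟨g, hg, rfl⟩ := hf
  calc ‖g.comp A‖ ≤ ‖g‖ * ‖A‖ := g.opNorm_comp_le A
    _ ≤ 1 * ‖A‖ := by gcongr
    _ = ‖A‖ := one_mul _

theorem smul_add_smul_add_smul_mem_dualBallImage {A : X →L[𝕜] Y} {f g h : WeakDual 𝕜 X}
    (hf : f ∈ dualBallImage A) (hg : g ∈ dualBallImage A) (hh : h ∈ dualBallImage A) {a b c : 𝕜}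
    (habc : ‖a‖ + ‖b‖ + ‖c‖ ≤ 1) : a • f + b • g + c • h ∈ dualBallImage A := by
  obtain ⟨f', hf', rfl⟩ := hf
  obtain ⟨g', hg', rfl⟩ := hg
  obtain ⟨h', hh', rfl⟩ := hh
  refine ⟨a • f' + b • g' + c • h', ?_, rfl⟩
  calc ‖a • f' + b • g' + c • h'‖ ≤ ‖a • f'‖ + ‖b • g'‖ + ‖c • h'‖ := norm_add₃_le
    _ = ‖a‖ * ‖f'‖ + ‖b‖ * ‖g'‖ + ‖c‖ * ‖h'‖ := by rw [norm_smul, norm_smul, norm_smul]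
    _ ≤ ‖a‖ * 1 + ‖b‖ * 1 + ‖c‖ * 1 := by gcongr
    _ ≤ 1 := by simpa using habc

theorem mem_dualBallImage_smul_iff {A : X →L[𝕜] Y} {t : ℝ} (ht : 0 < t) {f : WeakDual 𝕜 X} :
    f ∈ dualBallImage ((t : 𝕜) • A) ↔
      ∃ g : StrongDual 𝕜 Y, ‖g‖ ≤ t ∧ f = StrongDual.toWeakDual (g.comp A) := by
  have ht0 : (t : 𝕜) ≠ 0 := by exact_mod_cast ht.ne'
  constructor
  · rintro ⟨g, hg, rfl⟩
    refine ⟨(t : 𝕜) • g, ?_, by rw [ContinuousLinearMap.comp_smul, ContinuousLinearMap.smul_comp]⟩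
    rw [norm_smul, RCLike.norm_of_nonneg ht.le]
    exact mul_le_of_le_one_right ht.le hg
  · rintro ⟨g, hg, rfl⟩
    refine ⟨(t : 𝕜)⁻¹ • g, ?_, ?_⟩
    · rwa [norm_smul, norm_inv, RCLike.norm_of_nonneg ht.le, inv_mul_le_one₀ ht]
    · rw [ContinuousLinearMap.comp_smul, ContinuousLinearMap.smul_comp, smul_inv_smul₀ ht0]

theorem iterDeriv_dualBallImage_smul_eq_empty {A : X →L[𝕜] Y} {ε t : ℝ} (hε : 0 ≤ ε) (ht : 0 < t)
    {α : Ordinal.{u}} (h : iterDeriv ε (dualBallImage A) α = ∅) :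
    iterDeriv (t * ε) (dualBallImage ((t : 𝕜) • A)) α = ∅ := by
  have htn : ‖(t : 𝕜)⁻¹‖ = t⁻¹ := by rw [norm_inv, RCLike.norm_of_nonneg ht.le]
  have hmaps : Set.MapsTo (fun f : WeakDual 𝕜 X => (t : 𝕜)⁻¹ • f)
      (dualBallImage ((t : 𝕜) • A)) (dualBallImage A) := by
    intro f hf
    obtain ⟨g, hg, rfl⟩ := (mem_dualBallImage_smul_iff ht).1 hf
    refine ⟨(t : 𝕜)⁻¹ • g, ?_, rfl⟩
    rwa [norm_smul, htn, inv_mul_le_one₀ ht]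
  refine Set.eq_empty_of_forall_notMem fun f hf => ?_
  have := map_mem_iterDeriv (inv_pos.2 ht) (by positivity) (continuous_const_smul _) hmaps
    (fun f _ g _ => by rw [← smul_sub, map_smul, norm_smul, htn]) α hf
  rw [inv_mul_cancel_left₀ ht.ne', h] at this
  exact this

theorem exists_minimal_norm_comp_eq (A : X →L[𝕜] Y) (g₀ : StrongDual 𝕜 Y) :
    ∃ g : StrongDual 𝕜 Y, g.comp A = g₀.comp A ∧
      ∀ g' : StrongDual 𝕜 Y, g'.comp A = g₀.comp A → ‖g‖ ≤ ‖g'‖ := by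
  have hlsc : LowerSemicontinuous fun g : WeakDual 𝕜 Y => ‖WeakDual.toStrongDual g‖ := by
    rw [lowerSemicontinuous_iff_isClosed_preimage]
    intro t
    convert! WeakDual.isClosed_closedBall (𝕜 := 𝕜) (E := Y) 0 t using 1
    ext g
    simp
  set S : Set (WeakDual 𝕜 Y) := (WeakDual.toStrongDual ⁻¹' Metric.closedBall 0 ‖g₀‖) ∩
    (fun g : WeakDual 𝕜 Y => StrongDual.toWeakDual ((WeakDual.toStrongDual g).comp A)) ⁻¹'
      {StrongDual.toWeakDual (g₀.comp A)}
  have hS : IsCompact S := (WeakDual.isCompact_closedBall 0 ‖g₀‖).inter_right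
    (isClosed_singleton.preimage (continuous_toWeakDual_comp A))
  have hne : S.Nonempty := ⟨StrongDual.toWeakDual g₀, by simp [S]⟩
  obtain ⟨g, hg, hmin⟩ := (hlsc.lowerSemicontinuousOn S).exists_isMinOn hne hS
  have hg1 : ‖WeakDual.toStrongDual g‖ ≤ ‖g₀‖ := by simpa using hg.1
  refine ⟨WeakDual.toStrongDual g, StrongDual.toWeakDual.injective hg.2, fun g' hg' => ?_⟩
  rcases le_total ‖g₀‖ ‖g'‖ with h | h
  · exact hg1.trans h
  · exact hmin (a := StrongDual.toWeakDual g') ⟨by simpa using h, by simp [hg']⟩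

end DualBall

/-! ### Natural sums of ordinals -/

section NaturalSum

open Ordinal

variable {ι : Type*}

/-- The natural (Hessenberg) sum of a finite family of ordinals: the least ordinal-valued function
which is strictly monotone for the pointwise order on families. -/
noncomputable def naturalSum [Finite ι] (a : ι → Ordinal.{u}) : Ordinal.{u} :=
  ⨆ b : Set.Iio a, Order.succ (naturalSum b.1)
termination_by wellFounded_lt.wrap a
decreasing_by exact b.2

instance small_Iio_pi [Finite ι] (a : ι → Ordinal.{u}) : Small.{u} (Set.Iio a) :=
  small_of_injective (β := ∀ i, Set.Iic (a i)) (f := fun b i => ⟨b.1 i, (Set.mem_Iio.1 b.2).le i⟩)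
    fun _ _ h => Subtype.ext (funext fun i => congrArg Subtype.val (congrFun h i))

theorem naturalSum_strictMono [Finite ι] :
    StrictMono (naturalSum : (ι → Ordinal.{u}) → Ordinal.{u}) := by
  intro b a h
  rw [← Order.succ_le_iff]
  conv_rhs => rw [naturalSum]
  exact le_ciSup (f := fun c : Set.Iio a => Order.succ (naturalSum c.1)) bddAbove_of_small ⟨b, h⟩

theorem naturalSum_le [Finite ι] {a : ι → Ordinal.{u}} {c : Ordinal.{u}}
    (h : ∀ b < a, naturalSum b < c) : naturalSum a ≤ c := by
  rw [naturalSum]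
  exact Ordinal.iSup_le fun b => Order.succ_le_iff.2 (h b.1 b.2)

theorem exists_natCast_mul_add {ζ a : Ordinal.{u}} (h : a < ω ^ (ζ + 1)) :
    ∃ (n : ℕ) (x : Ordinal.{u}), x < ω ^ ζ ∧ a = ω ^ ζ * n + x := by
  rw [opow_add, opow_one] at h
  obtain ⟨n, hn⟩ := lt_omega0.1 ((lt_mul_iff_div_lt (omega_opow_pos ζ).ne').1 h)
  exact ⟨n, a % ω ^ ζ, mod_lt _ (omega_opow_pos ζ).ne', by rw [← hn, div_add_mod]⟩

theorem opow_mul_natCast_add_lt {ζ x : Ordinal.{u}} (hx : x < ω ^ ζ) {m n : ℕ} (h : m < n) :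
    ω ^ ζ * m + x < ω ^ ζ * n :=
  calc ω ^ ζ * m + x < ω ^ ζ * m + ω ^ ζ := by gcongr
    _ = ω ^ ζ * ((m + 1 : ℕ) : Ordinal.{u}) := by rw [Nat.cast_succ, mul_add_one]
    _ ≤ ω ^ ζ * n := by gcongr; exact h

theorem opow_mul_natCast_add_lt_opow_add_one {ζ x : Ordinal.{u}} (hx : x < ω ^ ζ) (m : ℕ) :
    ω ^ ζ * m + x < ω ^ (ζ + 1) := by
  refine (opow_mul_natCast_add_lt hx m.lt_succ_self).trans ?_
  rw [opow_add, opow_one]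
  exact (mul_lt_mul_iff_right₀ (omega_opow_pos ζ)).2 (natCast_lt_omega0 _)

theorem naturalSum_mul_add_le [Fintype ι] {ζ : Ordinal.{u}}
    (ih : ∀ y : ι → Ordinal.{u}, (∀ i, y i < ω ^ ζ) → naturalSum y < ω ^ ζ)
    (n : ι → ℕ) (x : ι → Ordinal.{u}) (hx : ∀ i, x i < ω ^ ζ) :
    naturalSum (fun i => ω ^ ζ * n i + x i) ≤
      ω ^ ζ * ((∑ i, n i : ℕ) : Ordinal.{u}) + naturalSum x := by
  obtain ⟨a, ha⟩ : ∃ a : ι → Ordinal.{u}, a = fun i => ω ^ ζ * n i + x i := ⟨_, rfl⟩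
  rw [← ha]
  induction a using WellFoundedLT.induction generalizing n x with
  | ind a iha =>
  refine naturalSum_le fun b hb => ?_
  have hba : ∀ i, b i ≤ ω ^ ζ * n i + x i := fun i => (hb.le i).trans_eq (congrFun ha i)
  have hdecomp : ∀ i, ∃ (m : ℕ) (y : Ordinal.{u}), y < ω ^ ζ ∧ b i = ω ^ ζ * m + y := fun i =>
    exists_natCast_mul_add ((hba i).trans_lt (opow_mul_natCast_add_lt_opow_add_one (hx i) (n i)))
  choose m y hy hbm using hdecomp
  have hmn : ∀ i, m i ≤ n i := fun i => by
    by_contra! hlt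
    exact (hba i).not_gt ((opow_mul_natCast_add_lt (hx i) hlt).trans_le
      (le_self_add.trans_eq (hbm i).symm))
  refine (iha b hb m y hy (funext hbm)).trans_lt ?_
  rcases (Finset.sum_le_sum fun i (_ : i ∈ Finset.univ) => hmn i).lt_or_eq with hlt | heq
  · exact (opow_mul_natCast_add_lt (ih y hy) hlt).trans_le le_self_add
  · obtain rfl : m = n :=
      funext fun i => (Finset.sum_eq_sum_iff_of_le fun i _ => hmn i).1 heq i (Finset.mem_univ i)
    have hyx : y < x := by
      refine lt_of_le_of_ne (fun i => ?_) fun h => hb.ne ?_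
      · simpa [hbm] using hba i
      · rw [ha, ← h]
        exact funext hbm
    gcongr
    exact naturalSum_strictMono hyx

theorem naturalSum_lt_omega0_opow [Finite ι] {ζ : Ordinal.{u}} {a : ι → Ordinal.{u}}
    (ha : ∀ i, a i < ω ^ ζ) : naturalSum a < ω ^ ζ := by
  have := Fintype.ofFinite ι
  induction ζ using Ordinal.limitRecOn generalizing a with
  | zero =>
    simp only [opow_zero, Order.lt_one_iff] at ha ⊢
    exact nonpos_iff_eq_zero.1 (naturalSum_le fun b hb =>
      absurd (fun i => (ha i).trans_le zero_le) hb.not_ge)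
  | add_one ζ ih =>
    choose n x hx hax using fun i => exists_natCast_mul_add (ha i)
    rw [funext hax]
    exact (naturalSum_mul_add_le (fun y hy => ih hy) n x hx).trans_lt
      (opow_mul_natCast_add_lt_opow_add_one (ih hx) _)
  | limit ζ hζ ih =>
    choose η hη haη using fun i => (lt_opow_of_isSuccLimit omega0_ne_zero hζ).1 (ha i)
    have : Nonempty (Set.Iio ζ) := ⟨⟨0, hζ.bot_lt⟩⟩
    obtain ⟨⟨θ, hθ⟩, hle⟩ := Finite.exists_le fun i => (⟨η i, hη i⟩ : Set.Iio ζ)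
    exact (ih θ hθ fun i => (haη i).trans_le (opow_le_opow_right omega0_pos (hle i))).trans
      ((opow_lt_opow_iff_right one_lt_omega0).2 hθ)

end NaturalSum

/-! ### Derived sets and finitely many coordinates -/

section DerivRank

open Ordinal

variable {𝕜 : Type*} [RCLike 𝕜] {X : Type u} [NormedAddCommGroup X] [NormedSpace 𝕜 X]

/-- The stage at which `f` disappears from the derived sets of `S`: the least `β` such that
`f ∉ s_ε^{β+1}(S)`. It is `0` if `f ∉ S`, and the junk value `0` if `f` never disappears. -/
noncomputable def derivRank (ε : ℝ) (S : Set (WeakDual 𝕜 X)) (f : WeakDual 𝕜 X) : Ordinal.{u} :=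
  sInf {β | f ∉ iterDeriv ε S (β + 1)}

variable {ε : ℝ} {S : Set (WeakDual 𝕜 X)} {f : WeakDual 𝕜 X}

theorem derivRank_le {β : Ordinal.{u}} (h : f ∉ iterDeriv ε S (β + 1)) : derivRank ε S f ≤ β :=
  csInf_le' h

theorem exists_lt_notMem_iterDeriv_add_one {α : Ordinal.{u}} (hα : 0 < α)
    (h : f ∉ iterDeriv ε S α) : ∃ β < α, f ∉ iterDeriv ε S (β + 1) := by
  induction α using Ordinal.limitRecOn with
  | zero => exact absurd hα (lt_irrefl _)
  | add_one β => exact ⟨β, Order.lt_add_one_iff.2 le_rfl, h⟩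
  | limit α hlim =>
    rw [iterDeriv_limit _ _ hlim] at h
    simp only [Set.mem_iInter, not_forall] at h
    obtain ⟨β, hβ, hf⟩ := h
    exact ⟨β, hβ, fun hf' => hf (iterDeriv_antitone _ _ le_self_add hf')⟩

theorem derivRank_lt {α : Ordinal.{u}} (hα : 0 < α) (h : f ∉ iterDeriv ε S α) :
    derivRank ε S f < α := by
  obtain ⟨β, hβ, hf⟩ := exists_lt_notMem_iterDeriv_add_one hα h
  exact (derivRank_le hf).trans_lt hβ

theorem notMem_iterDeriv_derivRank_add_one {α : Ordinal.{u}} (h : f ∉ iterDeriv ε S α) :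
    f ∉ iterDeriv ε S (derivRank ε S f + 1) :=
  csInf_mem (s := {β | f ∉ iterDeriv ε S (β + 1)})
    ⟨α, fun hf => h (iterDeriv_antitone _ _ le_self_add hf)⟩

theorem mem_iterDeriv_derivRank (hf : f ∈ S) : f ∈ iterDeriv ε S (derivRank ε S f) := by
  by_contra h
  rcases eq_zero_or_pos (derivRank ε S f) with h0 | hpos
  · rw [h0, iterDeriv_zero] at h
    exact h hf
  · obtain ⟨β, hβ, hfβ⟩ := exists_lt_notMem_iterDeriv_add_one hpos h
    exact (derivRank_le hfβ).not_gt hβ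

theorem eventually_derivRank_le (hε : 0 ≤ ε) (hS : IsClosed S) {α : Ordinal.{u}}
    (hf : f ∉ iterDeriv ε S α) :
    ∀ᶠ g in 𝓝 f, derivRank ε S g ≤ derivRank ε S f ∧
      (derivRank ε S g = derivRank ε S f → f ∈ S → g ∈ S →
        ‖WeakDual.toStrongDual (g - f)‖ ≤ ε) := by
  have hn := notMem_iterDeriv_derivRank_add_one hf
  have hle : ∀ᶠ g in 𝓝 f, derivRank ε S g ≤ derivRank ε S f := by
    filter_upwards [(isClosed_iterDeriv ε hS _).isOpen_compl.mem_nhds hn] with g hg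
    exact derivRank_le hg
  by_cases hfS : f ∈ S
  · have hfr := mem_iterDeriv_derivRank (ε := ε) hfS
    rw [iterDeriv_add_one] at hn
    obtain ⟨V, hV, hdiam⟩ := exists_nhds_of_notMem_deriv hε hfr hn
    filter_upwards [hle, hV] with g hg hgV
    exact ⟨hg, fun heq _ hgS =>
      hdiam g ⟨hgV, heq ▸ mem_iterDeriv_derivRank hgS⟩ f ⟨mem_of_mem_nhds hV, hfr⟩⟩
  · filter_upwards [hle] with g hg
    exact ⟨hg, fun _ h => absurd h hfS⟩

variable {ι : Type*} [Finite ι] {Z : ι → Type u} [∀ i, NormedAddCommGroup (Z i)]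
  [∀ i, NormedSpace 𝕜 (Z i)] {π : ∀ i, WeakDual 𝕜 X → WeakDual 𝕜 (Z i)}
  {T : ∀ i, Set (WeakDual 𝕜 (Z i))} {δ : ι → ℝ} {ζ : Ordinal.{u}} {L : Set (WeakDual 𝕜 X)}

theorem le_naturalSum_derivRank (hπ : ∀ i, Continuous (π i)) (hT : ∀ i, IsClosed (T i))
    (hδ : ∀ i, 0 ≤ δ i) (hε : 0 ≤ ε)
    (hL : ∀ h ∈ L, ∀ i, π i h ∉ iterDeriv (δ i) (T i) (ω ^ ζ))
    (hdist : ∀ h ∈ L, ∀ h' ∈ L,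
      (∀ i, π i h ∈ T i → π i h' ∈ T i → ‖WeakDual.toStrongDual (π i h - π i h')‖ ≤ δ i) →
      ‖WeakDual.toStrongDual (h - h')‖ ≤ ε / 2)
    {α : Ordinal.{u}} {h : WeakDual 𝕜 X} (hh : h ∈ iterDeriv ε L α) :
    α ≤ naturalSum fun i => derivRank (δ i) (T i) (π i h) := by
  induction α using Ordinal.limitRecOn generalizing h with
  | zero => exact zero_le
  | limit α hα ih =>
    rw [iterDeriv_limit _ _ hα] at hh
    simp only [Set.mem_iInter] at hh
    exact hα.le_iff_forall_le.2 fun β hβ => ih β hβ (hh β hβ)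
  | add_one α ih =>
    by_contra hlt
    rw [Order.add_one_le_iff, not_lt] at hlt
    rw [iterDeriv_add_one] at hh
    have hhL : h ∈ L := iterDeriv_subset _ _ _ hh.1
    have hclose : ∀ᶠ g in 𝓝 h, g ∈ iterDeriv ε L α → ‖WeakDual.toStrongDual (g - h)‖ ≤ ε / 2 := by
      filter_upwards [eventually_all.2 fun i => (hπ i).continuousAt.eventually
        (eventually_derivRank_le (hδ i) (hT i) (hL h hhL i))] with g hg hgα
      -- the ranks of `g` cannot drop, since their natural sum is still at least `α`
      have hrank := eq_of_le_of_not_lt (fun i => (hg i).1) fun hlt' =>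
        (ih hgα).not_gt ((naturalSum_strictMono hlt').trans_le hlt)
      exact hdist g (iterDeriv_subset _ _ _ hgα) h hhL fun i hgi hhi =>
        (hg i).2 (congrFun hrank i) hhi hgi
    obtain ⟨g, hg, g', hg', hgg'⟩ := ((mem_deriv_iff hε).1 hh).2 _ hclose
    refine hgg'.not_ge ?_
    calc ‖WeakDual.toStrongDual (g - g')‖
        = ‖WeakDual.toStrongDual (g - h) - WeakDual.toStrongDual (g' - h)‖ := by
          rw [← map_sub, sub_sub_sub_cancel_right]
      _ ≤ ε / 2 + ε / 2 := (norm_sub_le _ _).trans (add_le_add (hg.1 hg.2) (hg'.1 hg'.2))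
      _ = ε := add_halves ε

theorem iterDeriv_omega0_opow_eq_empty (hπ : ∀ i, Continuous (π i)) (hT : ∀ i, IsClosed (T i))
    (hδ : ∀ i, 0 ≤ δ i) (hε : 0 ≤ ε)
    (hL : ∀ h ∈ L, ∀ i, π i h ∉ iterDeriv (δ i) (T i) (ω ^ ζ))
    (hdist : ∀ h ∈ L, ∀ h' ∈ L,
      (∀ i, π i h ∈ T i → π i h' ∈ T i → ‖WeakDual.toStrongDual (π i h - π i h')‖ ≤ δ i) →
      ‖WeakDual.toStrongDual (h - h')‖ ≤ ε / 2) :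
    iterDeriv ε L (ω ^ ζ) = ∅ :=
  Set.eq_empty_of_forall_notMem fun _ hh =>
    (le_naturalSum_derivRank hπ hT hδ hε hL hdist hh).not_gt (naturalSum_lt_omega0_opow fun i =>
      derivRank_lt (omega_opow_pos ζ) (hL _ (iterDeriv_subset _ _ _ hh) i))

end DerivRank

section SumSet

open Ordinal

variable {𝕜 : Type*} [RCLike 𝕜] {Λ : Type*}
  {X : Λ → Type u} [∀ l, NormedAddCommGroup (X l)] [∀ l, NormedSpace 𝕜 (X l)]
  {Y : Λ → Type v} [∀ l, NormedAddCommGroup (Y l)] [∀ l, NormedSpace 𝕜 (Y l)]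
  {E : Type u} [NormedAddCommGroup E] [NormedSpace 𝕜 E]

/-- The coordinate of a functional on a direct sum with embeddings `e l`. -/
noncomputable def coord (e : ∀ l, X l →L[𝕜] E) (l : Λ) (f : WeakDual 𝕜 E) : WeakDual 𝕜 (X l) :=
  StrongDual.toWeakDual ((WeakDual.toStrongDual f).comp (e l))

theorem continuous_coord (e : ∀ l, X l →L[𝕜] E) (l : Λ) : Continuous (coord e l) :=
  continuous_toWeakDual_comp (e l)

/-- The functionals whose coordinates are of the form `A_l* g_l` with `∑ ‖g_l‖^q ≤ C`. -/
def sumSet (e : ∀ l, X l →L[𝕜] E) (A : ∀ l, X l →L[𝕜] Y l) (q C : ℝ) : Set (WeakDual 𝕜 E) :=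
  {f | ∃ g : ∀ l, StrongDual 𝕜 (Y l),
    (∀ l, coord e l f = StrongDual.toWeakDual ((g l).comp (A l))) ∧
    ∀ F : Finset Λ, ∑ l ∈ F, ‖g l‖ ^ q ≤ C}

/-- The upper `q`-estimate, with constant `1`, for functionals on a direct sum with embeddings
`e l`: the norm of a functional is at most the `ℓ_q`-norm of the norms of its coordinates. -/
def UpperEstimate (e : ∀ l, X l →L[𝕜] E) (q : ℝ) : Prop :=
  ∀ (f : WeakDual 𝕜 E) (C : ℝ), 0 ≤ C →
    (∀ F : Finset Λ, ∑ l ∈ F, ‖WeakDual.toStrongDual (coord e l f)‖ ^ q ≤ C ^ q) →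
    ‖WeakDual.toStrongDual f‖ ≤ C

variable {e : ∀ l, X l →L[𝕜] E} {A : ∀ l, X l →L[𝕜] Y l} {q : ℝ}

theorem coord_sub (l : Λ) (f g : WeakDual 𝕜 E) : coord e l (f - g) = coord e l f - coord e l g :=
  rfl

theorem coord_smul (l : Λ) (c : 𝕜) (f : WeakDual 𝕜 E) : coord e l (c • f) = c • coord e l f :=
  rfl

theorem add_rpow_le_two_rpow_mul {x y q : ℝ} (hx : 0 ≤ x) (hy : 0 ≤ y) (hq : 0 ≤ q) :
    (x + y) ^ q ≤ 2 ^ q * (x ^ q + y ^ q) := by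
  calc (x + y) ^ q ≤ (2 * max x y) ^ q := by
        apply Real.rpow_le_rpow (by positivity) _ hq
        linarith [le_max_left x y, le_max_right x y]
    _ = 2 ^ q * max x y ^ q := Real.mul_rpow (by norm_num) (by positivity)
    _ ≤ 2 ^ q * (x ^ q + y ^ q) := by
        gcongr
        rcases max_choice x y with h | h <;> rw [h]
        · linarith [Real.rpow_nonneg hy q]
        · linarith [Real.rpow_nonneg hx q]

theorem norm_coord_sub_rpow_le {R : ℝ} (hR : ∀ l, ‖A l‖ ≤ R) (hq : 0 ≤ q) {l : Λ}
    {f f' : WeakDual 𝕜 E} {g g' : StrongDual 𝕜 (Y l)}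
    (hg : coord e l f = StrongDual.toWeakDual (g.comp (A l)))
    (hg' : coord e l f' = StrongDual.toWeakDual (g'.comp (A l))) :
    ‖WeakDual.toStrongDual (coord e l (f - f'))‖ ^ q ≤ (2 * R) ^ q * (‖g‖ ^ q + ‖g'‖ ^ q) := by
  have hR0 : 0 ≤ R := (norm_nonneg _).trans (hR l)
  have h : ‖WeakDual.toStrongDual (coord e l (f - f'))‖ ≤ R * (‖g‖ + ‖g'‖) := by
    rw [coord_sub, hg, hg', map_sub]
    refine (norm_sub_le _ _).trans ?_
    have h1 : ‖g.comp (A l)‖ ≤ R * ‖g‖ := by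
      rw [mul_comm]; exact (g.opNorm_comp_le (A l)).trans (by gcongr; exact hR l)
    have h2 : ‖g'.comp (A l)‖ ≤ R * ‖g'‖ := by
      rw [mul_comm]; exact (g'.opNorm_comp_le (A l)).trans (by gcongr; exact hR l)
    rw [mul_add]
    exact add_le_add h1 h2
  calc _ ≤ (R * (‖g‖ + ‖g'‖)) ^ q := Real.rpow_le_rpow (norm_nonneg _) h hq
    _ = R ^ q * (‖g‖ + ‖g'‖) ^ q := Real.mul_rpow hR0 (by positivity)
    _ ≤ R ^ q * (2 ^ q * (‖g‖ ^ q + ‖g'‖ ^ q)) := by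
        gcongr
        exact add_rpow_le_two_rpow_mul (norm_nonneg _) (norm_nonneg _) hq
    _ = _ := by rw [Real.mul_rpow (by norm_num) hR0]; ring
theorem sum_norm_coord_sub_rpow_le {R C : ℝ} (hR0 : 0 ≤ R) (hR : ∀ l, ‖A l‖ ≤ R) (hq : 0 ≤ q)
    {f f' : WeakDual 𝕜 E} {g g' : ∀ l, StrongDual 𝕜 (Y l)}
    (hg : ∀ l, coord e l f = StrongDual.toWeakDual ((g l).comp (A l)))
    (hg' : ∀ l, coord e l f' = StrongDual.toWeakDual ((g' l).comp (A l))) {O : Finset Λ}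
    (hC : ∑ l ∈ O, ‖g l‖ ^ q ≤ C) (hC' : ∑ l ∈ O, ‖g' l‖ ^ q ≤ C) :
    ∑ l ∈ O, ‖WeakDual.toStrongDual (coord e l (f - f'))‖ ^ q ≤ (2 * R) ^ q * (2 * C) :=
  calc ∑ l ∈ O, ‖WeakDual.toStrongDual (coord e l (f - f'))‖ ^ q
      ≤ ∑ l ∈ O, (2 * R) ^ q * (‖g l‖ ^ q + ‖g' l‖ ^ q) :=
        Finset.sum_le_sum fun l _ => norm_coord_sub_rpow_le hR hq (hg l) (hg' l)
    _ = (2 * R) ^ q * (∑ l ∈ O, ‖g l‖ ^ q + ∑ l ∈ O, ‖g' l‖ ^ q) := by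
        rw [← Finset.mul_sum, Finset.sum_add_distrib]
    _ ≤ (2 * R) ^ q * (2 * C) := by
        gcongr
        linarith

theorem smul_mem_sumSet {C t : ℝ} (ht : 0 ≤ t) {f : WeakDual 𝕜 E}
    (hf : f ∈ sumSet e A q C) : ((t : ℝ) : 𝕜) • f ∈ sumSet e A q (t ^ q * C) := by
  obtain ⟨g, hg, hg1⟩ := hf
  refine ⟨fun l => ((t : ℝ) : 𝕜) • g l, fun l => ?_, fun F => ?_⟩
  · rw [coord_smul, hg]
    rfl
  · simp_rw [norm_smul, RCLike.norm_ofReal, abs_of_nonneg ht, Real.mul_rpow ht (norm_nonneg _),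
      ← Finset.mul_sum]
    gcongr
    exact hg1 F
theorem exists_lt_sum_rpow_eq {b : ℝ} (hq : 0 < q) (hb : 0 < b) {F : Finset Λ} {n : Λ → ℝ}
    (hn : ∀ l, 0 ≤ n l) (h : b < ∑ l ∈ F, n l ^ q) :
    ∃ (G : Finset Λ) (a : Λ → ℝ), (∀ l ∈ G, 0 < a l ∧ a l < n l) ∧ ∑ l ∈ G, a l ^ q = b := by
  classical
  set S := ∑ l ∈ F, n l ^ q
  have hS : 0 < S := hb.trans h
  have hr : 0 < b / S := by positivity
  set θ := (b / S) ^ q⁻¹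
  have hθ : 0 < θ := by positivity
  have hθ1 : θ < 1 := Real.rpow_lt_one hr.le ((div_lt_one hS).2 h) (by positivity)
  refine ⟨F.filter (fun l => 0 < n l), fun l => θ * n l, fun l hl => ?_, ?_⟩
  · have hnl := (Finset.mem_filter.1 hl).2
    exact ⟨by positivity, mul_lt_of_lt_one_left hnl hθ1⟩
  · rw [Finset.sum_filter_of_ne]
    · simp_rw [Real.mul_rpow hθ.le (hn _), θ, ← Real.rpow_mul hr.le, inv_mul_cancel₀ hq.ne',
        Real.rpow_one, ← Finset.mul_sum]
      exact div_mul_cancel₀ _ hS.ne'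
    · intro l _ hne
      refine (hn l).lt_of_ne fun h0 => hne ?_
      simp only [← h0, mul_zero, Real.zero_rpow hq.ne']

/-- The functionals whose coordinates in `F` stay outside the sets `a_l A_l* B_{Y_l*}`: a
weak*-open set on which the coordinates in `F` cannot be too small. -/
def coordsOutside (e : ∀ l, X l →L[𝕜] E) (A : ∀ l, X l →L[𝕜] Y l) (F : Finset Λ) (a : Λ → ℝ) :
    Set (WeakDual 𝕜 E) :=
  {f | ∀ l ∈ F, coord e l f ∉ dualBallImage ((a l : 𝕜) • A l)}

theorem isOpen_setOf_forall_coord_notMem {S : ∀ l, Set (WeakDual 𝕜 (X l))}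
    (hS : ∀ l, IsClosed (S l)) (F : Finset Λ) :
    IsOpen {f : WeakDual 𝕜 E | ∀ l ∈ F, coord e l f ∉ S l} := by
  have : {f : WeakDual 𝕜 E | ∀ l ∈ F, coord e l f ∉ S l} = ⋂ l ∈ F, coord e l ⁻¹' (S l)ᶜ := by
    ext
    simp
  rw [this]
  exact isOpen_biInter_finset fun l _ => (hS l).isOpen_compl.preimage (continuous_coord e l)

theorem isOpen_coordsOutside (F : Finset Λ) (a : Λ → ℝ) : IsOpen (coordsOutside e A F a) :=
  isOpen_setOf_forall_coord_notMem (fun _ => (isCompact_dualBallImage _).isClosed) F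

theorem exists_mem_coordsOutside (hq : 0 < q) {b C : ℝ} (hb : 0 < b) {f : WeakDual 𝕜 E}
    (hf : f ∈ sumSet e A q C) (hf' : f ∉ sumSet e A q b) :
    ∃ (F : Finset Λ) (a : Λ → ℝ), (∀ l ∈ F, 0 < a l) ∧ ∑ l ∈ F, a l ^ q = b ∧
      f ∈ coordsOutside e A F a := by
  obtain ⟨g₀, hg₀, -⟩ := hf
  choose g hg hmin using fun l => exists_minimal_norm_comp_eq (A l) (g₀ l)
  obtain ⟨F, hF⟩ : ∃ F : Finset Λ, b < ∑ l ∈ F, ‖g l‖ ^ q := by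
    by_contra! h
    exact hf' ⟨g, fun l => by rw [hg, hg₀], h⟩
  obtain ⟨G, a, ha, hsum⟩ := exists_lt_sum_rpow_eq hq hb (fun l => norm_nonneg (g l)) hF
  refine ⟨G, a, fun l hl => (ha l hl).1, hsum, fun l hl hmem => ?_⟩
  obtain ⟨g', hg', heq⟩ := (mem_dualBallImage_smul_iff (ha l hl).1).1 hmem
  rw [hg₀] at heq
  have hle := hmin l g' (StrongDual.toWeakDual.injective heq).symm
  exact (hle.trans hg').not_gt (ha l hl).2

theorem exists_le_norm_of_mem_coordsOutside {C : ℝ} {F : Finset Λ} {a : Λ → ℝ}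
    (ha : ∀ l ∈ F, 0 < a l) {f : WeakDual 𝕜 E}
    (hf : f ∈ sumSet e A q C ∩ coordsOutside e A F a) :
    ∃ g : ∀ l, StrongDual 𝕜 (Y l),
      (∀ l, coord e l f = StrongDual.toWeakDual ((g l).comp (A l))) ∧
      (∀ G : Finset Λ, ∑ l ∈ G, ‖g l‖ ^ q ≤ C) ∧ ∀ l ∈ F, a l ≤ ‖g l‖ := by
  obtain ⟨⟨g, hg, hgC⟩, hout⟩ := hf
  refine ⟨g, hg, hgC, fun l hl => ?_⟩
  by_contra! hlt
  exact hout l hl ((mem_dualBallImage_smul_iff (ha l hl)).2 ⟨g l, hlt.le, hg l⟩)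

section Weights

variable {c : ℝ} {F : Finset Λ} {a n w : Λ → ℝ}

theorem sum_rpow_le_add [DecidableEq Λ] (hq : 0 ≤ q) (ha : ∀ l ∈ F, 0 < a l)
    (hsum : ∑ l ∈ F, a l ^ q = 1 - c) (hn : ∀ l ∈ F, a l ≤ n l)
    (hn1 : ∀ G : Finset Λ, ∑ l ∈ G, n l ^ q ≤ 1) (O : Finset Λ) :
    ∑ l ∈ O, n l ^ q ≤ c + ∑ l ∈ F ∩ O, a l ^ q := by
  have htotal := hn1 (O ∪ F)
  rw [← Finset.union_sdiff_self_eq_union, Finset.sum_union Finset.disjoint_sdiff] at htotal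
  have houtside : ∑ l ∈ F \ O, a l ^ q ≤ ∑ l ∈ F \ O, n l ^ q :=
    Finset.sum_le_sum fun l hl => Real.rpow_le_rpow (ha l (Finset.sdiff_subset hl)).le
      (hn l (Finset.sdiff_subset hl)) hq
  have hsplit := Finset.sum_inter_add_sum_sdiff F O (fun l => a l ^ q)
  linarith

theorem sum_rpow_le_of_two_mul_le (hq : 1 ≤ q) (ha : ∀ l ∈ F, 0 < a l)
    (hsum : ∑ l ∈ F, a l ^ q = 1 - c) (hn : ∀ l ∈ F, a l ≤ n l)
    (hn1 : ∀ G : Finset Λ, ∑ l ∈ G, n l ^ q ≤ 1) {G : Finset Λ} (hGF : G ⊆ F)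
    (hG : ∀ l ∈ G, 2 * a l ≤ n l) : ∑ l ∈ G, a l ^ q ≤ c := by
  classical
  have hadd := sum_rpow_le_add (by linarith) ha hsum hn hn1 G
  rw [Finset.inter_eq_right.2 hGF] at hadd
  have hdouble : ∑ l ∈ G, 2 * a l ^ q ≤ ∑ l ∈ G, n l ^ q := by
    refine Finset.sum_le_sum fun l hl => ?_
    have hal := (ha l (hGF hl)).le
    calc 2 * a l ^ q ≤ 2 ^ q * a l ^ q := by
          gcongr
          simpa using Real.rpow_le_rpow_of_exponent_le (x := 2) (by norm_num) hq
      _ = (2 * a l) ^ q := (Real.mul_rpow (by norm_num) hal).symm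
      _ ≤ n l ^ q := Real.rpow_le_rpow (by positivity) (hG l hl) (by linarith)
  rw [← Finset.mul_sum] at hdouble
  linarith

theorem sum_filter_or_le {p p' : Λ → Prop} [DecidablePred p] [DecidablePred p']
    (hw : ∀ l ∈ F, 0 ≤ w l) :
    ∑ l ∈ F with p l ∨ p' l, w l ≤ ∑ l ∈ F with p l, w l + ∑ l ∈ F with p' l, w l := by
  simp only [Finset.sum_filter, ← Finset.sum_add_distrib]
  refine Finset.sum_le_sum fun l hl => ?_
  have := hw l hl
  by_cases hp : p l <;> by_cases hp' : p' l <;> simp [hp, hp', this]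

theorem sum_filter_lt_le_sum_mul_sub (hw : ∀ l ∈ F, 0 ≤ w l) {k k' : Λ → ℕ}
    (hk : ∀ l ∈ F, k l ≤ k' l) :
    ∑ l ∈ F with k l < k' l, w l ≤ ∑ l ∈ F, w l * k' l - ∑ l ∈ F, w l * k l := by
  rw [← Finset.sum_sub_distrib, Finset.sum_filter]
  refine Finset.sum_le_sum fun l hl => ?_
  rw [← mul_sub (w l)]
  split_ifs with hlt
  · refine le_mul_of_one_le_right (hw l hl) (le_sub_iff_add_le'.2 ?_)
    exact_mod_cast hlt
  · refine mul_nonneg (hw l hl) (sub_nonneg.2 ?_)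
    exact_mod_cast hk l hl

theorem sum_two_mul_mul_div_eight_rpow_le {ε : ℝ} (hq : 1 ≤ q) (hε : 0 ≤ ε)
    (ha : ∀ l ∈ F, 0 < a l) (hsum : ∑ l ∈ F, a l ^ q ≤ 1) :
    ∑ l ∈ F, (2 * a l * (ε / 8)) ^ q ≤ (ε / 2) ^ q / 2 :=
  calc ∑ l ∈ F, (2 * a l * (ε / 8)) ^ q = ∑ l ∈ F, a l ^ q * (ε / 4) ^ q := by
        refine Finset.sum_congr rfl fun l hl => ?_
        rw [← Real.mul_rpow (ha l hl).le (by positivity)]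
        ring_nf
    _ ≤ 1 * (ε / 4) ^ q := by
        rw [← Finset.sum_mul]
        gcongr
    _ = (ε / 2) ^ q / 2 ^ q := by
        rw [one_mul, ← Real.div_rpow (by positivity) (by norm_num)]
        ring_nf
    _ ≤ (ε / 2) ^ q / 2 := by
        gcongr
        simpa using Real.rpow_le_rpow_of_exponent_le (x := 2) (by norm_num) hq

end Weights

section Potential

variable {R ε c : ℝ} {F : Finset Λ} {a : Λ → ℝ} {ζ : Ordinal.{u}}

theorem norm_sub_le_of_forall_sdiff [DecidableEq Λ] (hq : 1 ≤ q) (he : UpperEstimate e q)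
    (hR0 : 0 ≤ R) (hR : ∀ l, ‖A l‖ ≤ R) (hε : 0 ≤ ε) (hc : 0 ≤ c)
    (hcε : (2 * R) ^ q * (8 * c) ≤ (ε / 2) ^ q / 2) (ha : ∀ l ∈ F, 0 < a l)
    (hsum : ∑ l ∈ F, a l ^ q = 1 - c) {f f' : WeakDual 𝕜 E}
    (hf : f ∈ sumSet e A q 1 ∩ coordsOutside e A F a)
    (hf' : f' ∈ sumSet e A q 1 ∩ coordsOutside e A F a) {B : Finset Λ} (hBF : B ⊆ F)
    (hB : ∑ l ∈ B, a l ^ q ≤ 3 * c)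
    (hclose : ∀ l ∈ F \ B, ‖WeakDual.toStrongDual (coord e l (f - f'))‖ ≤ 2 * a l * (ε / 8)) :
    ‖WeakDual.toStrongDual (f - f')‖ ≤ ε / 2 := by
  have hq0 : 0 ≤ q := by linarith
  obtain ⟨g, hg, hg1, hga⟩ := exists_le_norm_of_mem_coordsOutside ha hf
  obtain ⟨g', hg', hg1', hga'⟩ := exists_le_norm_of_mem_coordsOutside ha hf'
  refine he _ _ (by positivity) fun G => ?_
  rw [← Finset.sum_inter_add_sum_sdiff G (F \ B)]
  have hgood : ∑ l ∈ G ∩ (F \ B), ‖WeakDual.toStrongDual (coord e l (f - f'))‖ ^ q ≤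
      (ε / 2) ^ q / 2 :=
    calc _ ≤ ∑ l ∈ G ∩ (F \ B), (2 * a l * (ε / 8)) ^ q :=
          Finset.sum_le_sum fun l hl => Real.rpow_le_rpow (norm_nonneg _)
            (hclose l (Finset.mem_inter.1 hl).2) hq0
      _ ≤ ∑ l ∈ F, (2 * a l * (ε / 8)) ^ q := by
          refine Finset.sum_le_sum_of_subset_of_nonneg
            (Finset.inter_subset_right.trans Finset.sdiff_subset) fun l hl _ => ?_
          have := ha l hl
          positivity
      _ ≤ (ε / 2) ^ q / 2 := sum_two_mul_mul_div_eight_rpow_le hq hε ha (by linarith)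
  have hFO : ∑ l ∈ F ∩ (G \ (F \ B)), a l ^ q ≤ 3 * c := by
    refine (Finset.sum_le_sum_of_subset_of_nonneg (fun l hl => ?_) fun l hl _ => ?_).trans hB
    · simp only [Finset.mem_inter, Finset.mem_sdiff] at hl
      tauto
    · exact Real.rpow_nonneg (ha l (hBF hl)).le _
  have hbad : ∑ l ∈ G \ (F \ B), ‖WeakDual.toStrongDual (coord e l (f - f'))‖ ^ q ≤
      (2 * R) ^ q * (2 * (4 * c)) :=
    sum_norm_coord_sub_rpow_le hR0 hR hq0 hg hg'
      ((sum_rpow_le_add hq0 ha hsum hga hg1 _).trans (by linarith))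
      ((sum_rpow_le_add hq0 ha hsum hga' hg1' _).trans (by linarith))
  rw [← mul_assoc 2, show (2 : ℝ) * 4 = 8 by norm_num] at hbad
  linarith

theorem sum_rpow_filter_notMem_le (hq : 1 ≤ q) (ha : ∀ l ∈ F, 0 < a l)
    (hsum : ∑ l ∈ F, a l ^ q = 1 - c) {f : WeakDual 𝕜 E}
    (hf : f ∈ sumSet e A q 1 ∩ coordsOutside e A F a) {G : Finset Λ} (hGF : G ⊆ F)
    (hG : ∀ l ∈ G, coord e l f ∉ dualBallImage (((2 * a l : ℝ) : 𝕜) • A l)) :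
    ∑ l ∈ G, a l ^ q ≤ c := by
  obtain ⟨g, hg, hg1, hga⟩ := exists_le_norm_of_mem_coordsOutside ha hf
  refine sum_rpow_le_of_two_mul_le hq ha hsum hga hg1 hGF fun l hl => ?_
  by_contra! hlt
  have hal : 0 < 2 * a l := mul_pos two_pos (ha l (hGF hl))
  exact hG l hl ((mem_dualBallImage_smul_iff hal).2 ⟨g l, hlt.le, hg l⟩)

/-- The number of blocks of `ω^ζ` derivations which the coordinate `coord e l f` survives in
`t A_l* B_{Y_l*}`, with `tδ` as the size of the derivations (the junk value `0` if it survives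
all of them). -/
noncomputable def coordRank (e : ∀ l, X l →L[𝕜] E) (A : ∀ l, X l →L[𝕜] Y l) (δ : ℝ)
    (ζ : Ordinal.{u}) (t : Λ → ℝ) (f : WeakDual 𝕜 E) (l : Λ) : ℕ :=
  sInf {j : ℕ | coord e l f ∉ iterDeriv (t l * δ) (dualBallImage ((t l : 𝕜) • A l)) (ω ^ ζ * j)}

theorem coordRank_le {δ : ℝ} {t : Λ → ℝ} {f : WeakDual 𝕜 E} {l : Λ} {j : ℕ}
    (h : coord e l f ∉ iterDeriv (t l * δ) (dualBallImage ((t l : 𝕜) • A l)) (ω ^ ζ * j)) :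
    coordRank e A δ ζ t f l ≤ j :=
  Nat.sInf_le h

theorem coordRank_spec {δ : ℝ} (hδ : 0 ≤ δ) {t : Λ → ℝ} {l : Λ} (ht : 0 < t l) {m : ℕ}
    (hm : iterDeriv δ (dualBallImage (A l)) (ω ^ ζ * m) = ∅) (f : WeakDual 𝕜 E) :
    coordRank e A δ ζ t f l ≤ m ∧ coord e l f ∉
      iterDeriv (t l * δ) (dualBallImage ((t l : 𝕜) • A l)) (ω ^ ζ * coordRank e A δ ζ t f l) := by
  have hempty := iterDeriv_dualBallImage_smul_eq_empty (𝕜 := 𝕜) hδ ht hm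
  have hmem : m ∈ {j : ℕ | coord e l f ∉
      iterDeriv (t l * δ) (dualBallImage ((t l : 𝕜) • A l)) (ω ^ ζ * j)} := by
    change _ ∉ _
    rw [hempty]
    exact Set.notMem_empty _
  exact ⟨Nat.sInf_le hmem, Nat.sInf_mem ⟨m, hmem⟩⟩

theorem sum_rpow_filter_coordRank_le (hq : 1 ≤ q) (hε : 0 ≤ ε) (ha : ∀ l ∈ F, 0 < a l)
    (hsum : ∑ l ∈ F, a l ^ q = 1 - c) {m : ℕ}
    (hm : ∀ l, iterDeriv (ε / 8) (dualBallImage (A l)) (ω ^ ζ * m) = ∅) {f f' f₀ : WeakDual 𝕜 E}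
    (hf₀ : f₀ ∈ sumSet e A q 1 ∩ coordsOutside e A F a) {k : WeakDual 𝕜 E → Λ → ℕ}
    (hk : k = coordRank e A (ε / 8) ζ fun l => 2 * a l)
    (hle : ∀ l ∈ F, k f l ≤ k f₀ l) (hle' : ∀ l ∈ F, k f' l ≤ k f₀ l)
    (hdrop : ∑ l ∈ F, a l ^ q * k f₀ l ≤ ∑ l ∈ F, a l ^ q * k f l + c)
    (hdrop' : ∑ l ∈ F, a l ^ q * k f₀ l ≤ ∑ l ∈ F, a l ^ q * k f' l + c) :
    ∑ l ∈ F with k f₀ l = 0 ∨ k f l < k f₀ l ∨ k f' l < k f₀ l, a l ^ q ≤ 3 * c := by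
  have hw : ∀ l ∈ F, 0 ≤ a l ^ q := fun l hl => Real.rpow_nonneg (ha l hl).le _
  have hzero : ∑ l ∈ F with k f₀ l = 0, a l ^ q ≤ c := by
    refine sum_rpow_filter_notMem_le hq ha hsum hf₀ (Finset.filter_subset _ _) fun l hl => ?_
    obtain ⟨hlF, hl0⟩ := Finset.mem_filter.1 hl
    have h2a : 0 < 2 * a l := mul_pos two_pos (ha l hlF)
    have hnot := (coordRank_spec (e := e) (t := fun l => 2 * a l) (by positivity) h2a (hm l) f₀).2
    rw [hk] at hl0
    simpa [hl0] using hnot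
  have hlt := sum_filter_lt_le_sum_mul_sub hw hle
  have hlt' := sum_filter_lt_le_sum_mul_sub hw hle'
  refine (sum_filter_or_le hw).trans ?_
  linarith [sum_filter_or_le (p := fun l => k f l < k f₀ l) (p' := fun l => k f' l < k f₀ l) hw]

theorem add_le_sum_mul_coordRank (hq : 1 ≤ q) (he : UpperEstimate e q) (hR0 : 0 ≤ R)
    (hR : ∀ l, ‖A l‖ ≤ R) (hε : 0 ≤ ε) (hc : 0 ≤ c)
    (hcε : (2 * R) ^ q * (8 * c) ≤ (ε / 2) ^ q / 2) (ha : ∀ l ∈ F, 0 < a l)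
    (hsum : ∑ l ∈ F, a l ^ q = 1 - c) {m : ℕ}
    (hm : ∀ l, iterDeriv (ε / 8) (dualBallImage (A l)) (ω ^ ζ * m) = ∅) {L : Set (WeakDual 𝕜 E)}
    (hL : L ⊆ sumSet e A q 1 ∩ coordsOutside e A F a) {k : WeakDual 𝕜 E → Λ → ℕ}
    (hk : k = coordRank e A (ε / 8) ζ fun l => 2 * a l) {t : ℝ}
    (ht : ∀ f ∈ L, t ≤ ∑ l ∈ F, a l ^ q * k f l) {f₀ : WeakDual 𝕜 E}
    (hf₀ : f₀ ∈ iterDeriv ε L (ω ^ ζ)) : t + c ≤ ∑ l ∈ F, a l ^ q * k f₀ l := by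
  classical
  by_contra! hlt
  set S : ∀ l, ℕ → Set (WeakDual 𝕜 (X l)) := fun l j =>
    iterDeriv (2 * a l * (ε / 8)) (dualBallImage (((2 * a l : ℝ) : 𝕜) • A l)) (ω ^ ζ * j)
  have hS : ∀ l j, IsClosed (S l j) := fun l j =>
    isClosed_iterDeriv _ (isCompact_dualBallImage _).isClosed _
  set U : Set (WeakDual 𝕜 E) := {f | ∀ l ∈ F, coord e l f ∉ S l (k f₀ l)}
  have hU : ∀ f ∈ U, ∀ l ∈ F, k f l ≤ k f₀ l := fun f hf l hl => hk ▸ coordRank_le (hk ▸ hf l hl)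
  have hf₀U : f₀ ∈ U := fun l hl => hk ▸ (coordRank_spec (t := fun l => 2 * a l)
    (by positivity) (mul_pos two_pos (ha l hl)) (hm l) f₀).2
  have hmem := iterDeriv_inter_subset ε L
    (isOpen_setOf_forall_coord_notMem (fun l => hS l (k f₀ l)) F) (ω ^ ζ) ⟨hf₀, hf₀U⟩
  have hempty : iterDeriv ε (L ∩ U) (ω ^ ζ) = ∅ := by
    refine iterDeriv_omega0_opow_eq_empty (ι := {l : F // 0 < k f₀ l})
      (π := fun i => coord e i.1.1) (T := fun i => S i.1.1 (k f₀ i.1.1 - 1))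
      (δ := fun i => 2 * a i.1.1 * (ε / 8)) (fun i => continuous_coord e i.1.1) (fun i => hS _ _)
      (fun i => ?_) hε (fun f hf i => ?_) fun f hf f' hf' hclose => ?_
    · have := ha i.1.1 i.1.2
      positivity
    · have hnot := hf.2 i.1.1 i.1.2
      rw [← Nat.sub_add_cancel i.2] at hnot
      exact fun hmem => hnot ((iterDeriv_mul_natCast_add_one _ _ _ _).superset hmem)
    · refine norm_sub_le_of_forall_sdiff hq he hR0 hR hε hc hcε ha hsum (hL hf.1) (hL hf'.1)
        (Finset.filter_subset _ _) (sum_rpow_filter_coordRank_le hq hε ha hsum hm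
          (hL (iterDeriv_subset _ _ _ hf₀)) hk (hU f hf.2) (hU f' hf'.2)
          (by linarith [ht f hf.1]) (by linarith [ht f' hf'.1])) fun l hl => ?_
      simp only [Finset.mem_sdiff, Finset.mem_filter, not_and, not_or, not_lt] at hl
      obtain ⟨hlF, hl⟩ := hl
      obtain ⟨hl0, hlf, hlf'⟩ := hl hlF
      have hsurvive : ∀ g, k f₀ l ≤ k g l → coord e l g ∈ S l (k f₀ l - 1) := fun g hg => by
        by_contra hn
        have : k g l ≤ k f₀ l - 1 := hk ▸ coordRank_le (hk ▸ hn)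
        omega
      exact hclose ⟨⟨l, hlF⟩, Nat.pos_of_ne_zero hl0⟩ (hsurvive f hlf) (hsurvive f' hlf')
  rw [hempty] at hmem
  exact hmem

theorem iterDeriv_sumSet_inter_eq_empty (hq : 1 ≤ q) (he : UpperEstimate e q) (hR0 : 0 ≤ R)
    (hR : ∀ l, ‖A l‖ ≤ R) (hε : 0 ≤ ε) (hc : 0 ≤ c)
    (hcε : (2 * R) ^ q * (8 * c) ≤ (ε / 2) ^ q / 2) (ha : ∀ l ∈ F, 0 < a l)
    (hsum : ∑ l ∈ F, a l ^ q = 1 - c) {m : ℕ}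
    (hm : ∀ l, iterDeriv (ε / 8) (dualBallImage (A l)) (ω ^ ζ * m) = ∅) {M : ℕ} (hM : m < M * c) :
    iterDeriv ε (sumSet e A q 1 ∩ coordsOutside e A F a) (ω ^ ζ * M) = ∅ := by
  obtain ⟨k, hk⟩ : ∃ k, k = coordRank e A (ε / 8) ζ fun l => 2 * a l := ⟨_, rfl⟩
  have hw : ∀ l ∈ F, 0 ≤ a l ^ q := fun l hl => Real.rpow_nonneg (ha l hl).le _
  have hgrow : ∀ j : ℕ, ∀ f ∈ iterDeriv ε (sumSet e A q 1 ∩ coordsOutside e A F a) (ω ^ ζ * j),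
      j * c ≤ ∑ l ∈ F, a l ^ q * k f l := by
    intro j
    induction j with
    | zero =>
      intro f _
      rw [Nat.cast_zero, zero_mul]
      exact Finset.sum_nonneg fun l hl => mul_nonneg (hw l hl) (Nat.cast_nonneg _)
    | succ j ih =>
      intro f hf
      rw [iterDeriv_mul_natCast_add_one] at hf
      rw [Nat.cast_succ, add_one_mul]
      exact add_le_sum_mul_coordRank hq he hR0 hR hε hc hcε ha hsum hm (iterDeriv_subset _ _ _) hk
        ih hf
  refine Set.eq_empty_of_forall_notMem fun f hf => (hgrow M f hf).not_gt (hM.trans_le' ?_)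
  calc ∑ l ∈ F, a l ^ q * k f l ≤ ∑ l ∈ F, a l ^ q * m := by
        refine Finset.sum_le_sum fun l hl => mul_le_mul_of_nonneg_left ?_ (hw l hl)
        exact_mod_cast hk ▸ (coordRank_spec (t := fun l => 2 * a l) (by positivity)
          (mul_pos two_pos (ha l hl)) (hm l) f).1
    _ = (1 - c) * m := by rw [← Finset.sum_mul, hsum]
    _ ≤ m := mul_le_of_le_one_left m.cast_nonneg (by linarith)

theorem iterDeriv_sumSet_subset (hq : 1 ≤ q) (he : UpperEstimate e q) (hR0 : 0 ≤ R)
    (hR : ∀ l, ‖A l‖ ≤ R) (hε : 0 ≤ ε) (hc : 0 ≤ c) (hc1 : c < 1)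
    (hcε : (2 * R) ^ q * (8 * c) ≤ (ε / 2) ^ q / 2) {m : ℕ}
    (hm : ∀ l, iterDeriv (ε / 8) (dualBallImage (A l)) (ω ^ ζ * m) = ∅) {M : ℕ} (hM : m < M * c) :
    iterDeriv ε (sumSet e A q 1) (ω ^ ζ * M) ⊆ sumSet e A q (1 - c) := by
  intro f hf
  by_contra hf'
  obtain ⟨F, a, ha, hsum, hout⟩ := exists_mem_coordsOutside (by linarith) (sub_pos.2 hc1)
    (iterDeriv_subset _ _ _ hf) hf'
  have hmem := iterDeriv_inter_subset ε _ (isOpen_coordsOutside F a) _ ⟨hf, hout⟩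
  rw [iterDeriv_sumSet_inter_eq_empty hq he hR0 hR hε hc hcε ha hsum hm hM] at hmem
  exact hmem

theorem iterDeriv_sumSet_rpow_subset {α : Ordinal.{u}} {b s : ℝ} (hε : 0 ≤ ε)
    (h : iterDeriv ε (sumSet e A q 1) α ⊆ sumSet e A q b) (hs : 0 < s) (hs1 : s ≤ 1) :
    iterDeriv ε (sumSet e A q (s ^ q)) α ⊆ sumSet e A q (s ^ q * b) := by
  intro f hf
  have hsn : ‖((s⁻¹ : ℝ) : 𝕜)‖ = s⁻¹ := RCLike.norm_of_nonneg (inv_nonneg.2 hs.le)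
  have hmaps : Set.MapsTo (fun f : WeakDual 𝕜 E => ((s⁻¹ : ℝ) : 𝕜) • f)
      (sumSet e A q (s ^ q)) (sumSet e A q 1) := by
    intro g hg
    have := smul_mem_sumSet (inv_pos.2 hs).le hg
    rwa [Real.inv_rpow hs.le, inv_mul_cancel₀ (Real.rpow_pos_of_pos hs q).ne'] at this
  have hscaled := map_mem_iterDeriv (inv_pos.2 hs) hε (continuous_const_smul _) hmaps
    (fun f _ g _ => by rw [← smul_sub, map_smul, norm_smul, hsn]) α hf
  have hback := smul_mem_sumSet hs.le (h (iterDeriv_mono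
    (le_mul_of_one_le_left hε ((one_le_inv₀ hs).2 hs1)) subset_rfl _ hscaled))
  rwa [smul_smul, ← RCLike.ofReal_mul, mul_inv_cancel₀ hs.ne', RCLike.ofReal_one, one_smul]
    at hback

theorem iterDeriv_sumSet_mul_natCast_subset {α : Ordinal.{u}} {b : ℝ} (hq : 0 < q) (hε : 0 ≤ ε)
    (hb : 0 < b) (hb1 : b ≤ 1) (h : iterDeriv ε (sumSet e A q 1) α ⊆ sumSet e A q b) (j : ℕ) :
    iterDeriv ε (sumSet e A q 1) (α * j) ⊆ sumSet e A q (b ^ j) := by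
  induction j with
  | zero => simp
  | succ j ih =>
    have hbq : ((b ^ j) ^ q⁻¹) ^ q = b ^ j := by
      rw [← Real.rpow_mul (by positivity), inv_mul_cancel₀ hq.ne', Real.rpow_one]
    rw [iterDeriv_mul_natCast_add_one, pow_succ, ← hbq]
    rw [← hbq] at ih
    exact (iterDeriv_mono le_rfl ih _).trans (iterDeriv_sumSet_rpow_subset hε h (by positivity)
      (Real.rpow_le_one (by positivity) (pow_le_one₀ hb.le hb1) (by positivity)))

theorem deriv_sumSet_eq_empty (hq : 0 ≤ q) (he : UpperEstimate e q) (hR0 : 0 ≤ R)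
    (hR : ∀ l, ‖A l‖ ≤ R) (hε : 0 ≤ ε) {C : ℝ} (hC : (2 * R) ^ q * (2 * C) ≤ ε ^ q) :
    deriv ε (sumSet e A q C) = ∅ := by
  refine Set.eq_empty_of_forall_notMem fun f hf => ?_
  obtain ⟨g, hg, g', hg', hlt⟩ := ((mem_deriv_iff hε).1 hf).2 Set.univ univ_mem
  obtain ⟨u, hu, huC⟩ := hg.2
  obtain ⟨u', hu', huC'⟩ := hg'.2
  exact hlt.not_ge (he _ _ hε fun F =>
    (sum_norm_coord_sub_rpow_le hR0 hR hq hu hu' (huC F) (huC' F)).trans hC)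

theorem exists_pos_lt_one_mul_le {K B : ℝ} (hK : 0 ≤ K) (hB : 0 < B) :
    ∃ c : ℝ, 0 < c ∧ c < 1 ∧ K * c ≤ B := by
  refine ⟨min (1 / 2) (B / (K + 1)), by positivity, (min_le_left _ _).trans_lt (by norm_num), ?_⟩
  calc K * min (1 / 2) (B / (K + 1)) ≤ (K + 1) * (B / (K + 1)) := by
        gcongr
        · linarith
        · exact min_le_right _ _
    _ = B := by field_simp

theorem exists_iterDeriv_sumSet_eq_empty (hq : 1 ≤ q) (he : UpperEstimate e q) (hR0 : 0 ≤ R)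
    (hR : ∀ l, ‖A l‖ ≤ R) (hε : 0 < ε) {m : ℕ}
    (hm : ∀ l, iterDeriv (ε / 8) (dualBallImage (A l)) (ω ^ ζ * m) = ∅) :
    ∃ M : ℕ, iterDeriv ε (sumSet e A q 1) (ω ^ ζ * M) = ∅ := by
  have hq0 : 0 < q := by linarith
  obtain ⟨c, hc, hc1, hcε⟩ := exists_pos_lt_one_mul_le (K := (2 * R) ^ q * 8)
    (B := (ε / 2) ^ q / 2) (by positivity) (by positivity)
  rw [mul_assoc] at hcε
  obtain ⟨M, hM⟩ := exists_nat_gt ((m : ℝ) / c)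
  have hstep := iterDeriv_sumSet_subset hq he hR0 hR hε.le hc.le hc1 hcε hm ((div_lt_iff₀ hc).1 hM)
  have h1c : 0 < 1 - c := by linarith
  obtain ⟨j, hj⟩ : ∃ j : ℕ, (2 * R) ^ q * (2 * (1 - c) ^ j) ≤ ε ^ q := by
    have htend : Tendsto (fun j : ℕ => (2 * R) ^ q * (2 * (1 - c) ^ j)) atTop
        (𝓝 ((2 * R) ^ q * (2 * 0))) :=
      ((tendsto_pow_atTop_nhds_zero_of_lt_one h1c.le (by linarith)).const_mul _).const_mul _
    rw [mul_zero, mul_zero] at htend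
    exact (htend.eventually_le_const (by positivity)).exists
  have hiter := iterDeriv_sumSet_mul_natCast_subset hq0 hε.le h1c (by linarith) hstep j
  rw [mul_assoc, ← Ordinal.natCast_mul] at hiter
  refine ⟨M * j + 1, Set.subset_empty_iff.1 ?_⟩
  calc iterDeriv ε (sumSet e A q 1) (ω ^ ζ * ((M * j + 1 : ℕ) : Ordinal.{u}))
      ⊆ iterDeriv ε (sumSet e A q 1) (ω ^ ζ * ((M * j : ℕ) : Ordinal.{u}) + 1) := by
        rw [Nat.cast_succ, mul_add_one]
        exact iterDeriv_antitone _ _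
          (add_le_add_right (Order.one_le_iff_pos.2 (omega_opow_pos ζ)) _)
    _ ⊆ deriv ε (sumSet e A q ((1 - c) ^ j)) := by
        rw [iterDeriv_add_one]
        exact deriv_mono le_rfl hiter
    _ = ∅ := deriv_sumSet_eq_empty hq0.le he hR0 hR hε.le hj

end Potential

end SumSet

/-! ### Direct sums -/

section DualNorm

variable {𝕜 : Type*} [RCLike 𝕜] {X : Type*} [NormedAddCommGroup X] [NormedSpace 𝕜 X]

theorem exists_lt_re_apply_of_lt_norm (f : StrongDual 𝕜 X) {t : ℝ} (ht : t < ‖f‖) :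
    ∃ x : X, ‖x‖ ≤ 1 ∧ t < RCLike.re (f x) := by
  obtain ⟨x, hx, hlt⟩ := f.exists_lt_apply_of_lt_opNorm ht
  obtain ⟨c, hc, hcx⟩ := RCLike.exists_norm_eq_mul_self (f x)
  refine ⟨c • x, by rw [norm_smul, hc, one_mul]; exact hx.le, ?_⟩
  rw [map_smul, smul_eq_mul, ← hcx, RCLike.ofReal_re]
  exact hlt

end DualNorm

section Embedding

variable (𝕜 : Type*) [RCLike 𝕜] {ι : Type u} (X : ι → Type v) [∀ i, NormedAddCommGroup (X i)]
  [∀ i, NormedSpace 𝕜 (X i)] (p : Exponent)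

open Classical in
/-- The isometric embedding of the summand `X i` into the direct sum. -/
noncomputable def incl (i : ι) : X i →L[𝕜] directSum 𝕜 X p :=
  (lp.singleContinuousLinearMap 𝕜 X p.norm i).codRestrict (directSum 𝕜 X p) fun x _ => by
    refine tendsto_const_nhds.congr' ?_
    filter_upwards [(Set.finite_singleton i).compl_mem_cofinite] with j hj
    have hj' : j ≠ i := hj
    simp [hj']

/-- The projection of the direct sum onto the summand `X i`. -/
noncomputable def proj (i : ι) : directSum 𝕜 X p →L[𝕜] X i :=
  (lp.evalCLM 𝕜 X p.norm i).comp (directSum 𝕜 X p).subtypeL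

variable {𝕜 X p}

theorem Exponent.norm_pos (p : Exponent) : 0 < p.norm := zero_lt_one.trans_le Fact.out

open Classical in
theorem coe_incl (i : ι) (x : X i) : (incl 𝕜 X p i x).1 = lp.single p.norm i x := rfl

theorem norm_incl (i : ι) (x : X i) : ‖incl 𝕜 X p i x‖ = ‖x‖ := by
  classical
  exact lp.norm_single p.norm_pos i x

theorem proj_apply (i : ι) (x : directSum 𝕜 X p) : proj 𝕜 X p i x = x.1 i := rfl

theorem norm_proj_apply_le (i : ι) (x : directSum 𝕜 X p) : ‖proj 𝕜 X p i x‖ ≤ ‖x‖ :=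
  lp.norm_apply_le_norm p.norm_pos.ne' x.1 i

theorem proj_incl (i : ι) (x : X i) : proj 𝕜 X p i (incl 𝕜 X p i x) = x := by
  classical
  rw [proj_apply, coe_incl, lp.single_apply_self]

open Classical in
theorem coe_sum_incl (F : Finset ι) (x : ∀ i, X i) :
    (∑ i ∈ F, incl 𝕜 X p i (x i)).1 = ∑ i ∈ F, lp.single p.norm i (x i) := by
  rw [← Submodule.subtype_apply, map_sum]
  rfl

open Classical in
theorem coe_sum_incl_apply (F : Finset ι) (x : ∀ i, X i) (j : ι) :
    (∑ i ∈ F, incl 𝕜 X p i (x i)).1 j = if j ∈ F then x j else 0 := by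
  rw [coe_sum_incl, lp.coeFn_sum, Finset.sum_apply]
  simp only [lp.coeFn_single, Finset.sum_pi_single]

theorem norm_le_of_norm_eq_top (hp : p.norm = ∞) {x : directSum 𝕜 X p} {C : ℝ} (hC : 0 ≤ C)
    (h : ∀ i, ‖x.1 i‖ ≤ C) : ‖x‖ ≤ C := by
  change ‖x.1‖ ≤ C
  generalize x.1 = y at h ⊢
  generalize p.norm = q at y hp h
  subst hp
  exact lp.norm_le_of_forall_le hC h

theorem hasSum_incl {X : ι → Type u} [∀ i, NormedAddCommGroup (X i)] [∀ i, NormedSpace 𝕜 (X i)]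
    (hp : p.1 < ∞) (x : directSum 𝕜 X p) :
    HasSum (fun i => incl 𝕜 X p i (x.1 i)) x := by
  classical
  by_cases h0 : p.1 = 0
  · have hpt : p.norm = ∞ := by simp [Exponent.norm, h0]
    rw [HasSum, SummationFilter.unconditional_filter, Metric.tendsto_atTop]
    intro η hη
    have hfin : {i | ¬ ‖x.1 i‖ < η / 2}.Finite :=
      (tendsto_norm_zero hp x).eventually_lt_const (half_pos hη)
    refine ⟨hfin.toFinset, fun F hF => lt_of_le_of_lt ?_ (half_lt_self hη)⟩
    rw [dist_eq_norm]
    refine norm_le_of_norm_eq_top hpt (half_pos hη).le fun j => ?_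
    change ‖(∑ i ∈ F, incl 𝕜 X p i (x.1 i)).1 j - x.1 j‖ ≤ _
    rw [coe_sum_incl_apply]
    split_ifs with hj
    · simpa using (half_pos hη).le
    · rw [zero_sub, norm_neg]
      by_contra! hlt
      exact hj (hF (hfin.mem_toFinset.2 (not_lt.2 hlt.le)))
  · have hpt : p.norm ≠ ∞ := by simpa [Exponent.norm, h0] using hp.ne
    have hind : Topology.IsInducing (directSum 𝕜 X p).subtype := Topology.IsInducing.subtypeVal
    rw [← hind.hasSum_iff]
    exact lp.hasSum_single hpt x.1

theorem sum_rpow_le_norm_rpow_of_exponent_le {r : Exponent} (hr : r.norm ≠ ∞)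
    (hpr : p.norm ≤ r.norm) (x : directSum 𝕜 X p) (F : Finset ι) :
    ∑ i ∈ F, ‖x.1 i‖ ^ r.norm.toReal ≤ ‖x‖ ^ r.norm.toReal := by
  have hpt : p.norm ≠ ∞ := ne_top_of_le_ne_top hr hpr
  have hp0 : 0 < p.norm.toReal := ENNReal.toReal_pos p.norm_pos.ne' hpt
  have hle : p.norm.toReal ≤ r.norm.toReal := ENNReal.toReal_mono hr hpr
  calc ∑ i ∈ F, ‖x.1 i‖ ^ r.norm.toReal
      ≤ ∑ i ∈ F, ‖x.1‖ ^ (r.norm.toReal - p.norm.toReal) * ‖x.1 i‖ ^ p.norm.toReal := by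
        refine Finset.sum_le_sum fun i _ => ?_
        calc ‖x.1 i‖ ^ r.norm.toReal
            = ‖x.1 i‖ ^ (r.norm.toReal - p.norm.toReal) * ‖x.1 i‖ ^ p.norm.toReal := by
              rw [← Real.rpow_add_of_nonneg (norm_nonneg _) (sub_nonneg.2 hle) hp0.le,
                sub_add_cancel]
          _ ≤ _ := by
              gcongr
              exact lp.norm_apply_le_norm p.norm_pos.ne' x.1 i
    _ = ‖x.1‖ ^ (r.norm.toReal - p.norm.toReal) * ∑ i ∈ F, ‖x.1 i‖ ^ p.norm.toReal := by
        rw [Finset.mul_sum]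
    _ ≤ ‖x.1‖ ^ (r.norm.toReal - p.norm.toReal) * ‖x.1‖ ^ p.norm.toReal := by
        gcongr
        exact lp.sum_rpow_le_norm_rpow hp0 x.1 F
    _ = ‖x.1‖ ^ r.norm.toReal := by
        rw [← Real.rpow_add_of_nonneg (norm_nonneg _) (sub_nonneg.2 hle) hp0.le, sub_add_cancel]

/-- The exponent conjugate to `r`; the conjugate of both `ℓ_0 = c₀` and `ℓ_∞` is `1`. -/
noncomputable def Exponent.conj (r : Exponent) : ℝ :=
  if r.norm = ∞ then 1 else r.norm.toReal.conjExponent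

theorem Exponent.conj_of_top {r : Exponent} (h : r.norm = ∞) : r.conj = 1 := if_pos h

theorem Exponent.holderConjugate {r : Exponent} (h : r.norm ≠ ∞) (h1 : 1 < r.norm) :
    r.norm.toReal.HolderConjugate r.conj := by
  rw [Exponent.conj, if_neg h]
  refine Real.HolderConjugate.conjExponent ?_
  rw [← ENNReal.toReal_one]
  exact (ENNReal.toReal_lt_toReal (by simp) h).2 h1

theorem Exponent.one_le_conj {r : Exponent} (h1 : 1 < r.norm) : 1 ≤ r.conj := by
  by_cases h : r.norm = ∞
  · rw [conj_of_top h]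
  · exact (Exponent.holderConjugate h h1).symm.lt.le

theorem Admissible.exponent_lt_top {p r : Exponent} (h : Admissible p r) : p.1 < ∞ := by
  rcases h with h | h <;> tauto

theorem Admissible.one_lt_norm {p r : Exponent} (h : Admissible p r) : 1 < r.norm := by
  rcases h with ⟨h, -⟩ | ⟨h1, h2, h3, -⟩
  · simp [Exponent.norm, h]
  · have h0 : r.1 ≠ 0 := (zero_lt_one.trans_le (h1.trans h2)).ne'
    simpa [Exponent.norm, h0] using h3

theorem Admissible.norm_le_norm {p r : Exponent} (h : Admissible p r) : p.norm ≤ r.norm := by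
  rcases h with ⟨hr, -⟩ | ⟨hp, hpr, -, -⟩
  · simp [Exponent.norm, hr]
  · have h0 : p.1 ≠ 0 := (zero_lt_one.trans_le hp).ne'
    have h0' : r.1 ≠ 0 := (zero_lt_one.trans_le (hp.trans hpr)).ne'
    simpa [Exponent.norm, h0, h0'] using hpr

end Embedding

section DiagOp

variable {𝕜 : Type*} [RCLike 𝕜] {Λ : Type u}
  {X : Λ → Type u} [∀ l, NormedAddCommGroup (X l)] [∀ l, NormedSpace 𝕜 (X l)]
  {Y : Λ → Type v} [∀ l, NormedAddCommGroup (Y l)] [∀ l, NormedSpace 𝕜 (Y l)]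
  {p r : Exponent}

theorem sum_mul_norm_apply_le (h : Admissible p r) {φ : Λ → ℝ} (hφ : ∀ l, 0 ≤ φ l) {C : ℝ}
    (hC : 0 ≤ C) {F : Finset Λ} (hF : ∑ l ∈ F, φ l ^ r.conj ≤ C ^ r.conj)
    (x : directSum 𝕜 X p) : ∑ l ∈ F, φ l * ‖x.1 l‖ ≤ C * ‖x‖ := by
  by_cases hr : r.norm = ∞
  · simp only [Exponent.conj_of_top hr, Real.rpow_one] at hF
    calc ∑ l ∈ F, φ l * ‖x.1 l‖ ≤ ∑ l ∈ F, φ l * ‖x‖ :=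
          Finset.sum_le_sum fun l _ =>
            mul_le_mul_of_nonneg_left (norm_proj_apply_le l x) (hφ l)
      _ = (∑ l ∈ F, φ l) * ‖x‖ := by rw [Finset.sum_mul]
      _ ≤ C * ‖x‖ := by gcongr
  · have hconj := (Exponent.holderConjugate hr h.one_lt_norm).symm
    have hφC : (∑ l ∈ F, φ l ^ r.conj) ^ (1 / r.conj) ≤ C := by
      rwa [one_div, Real.rpow_inv_le_iff_of_pos
        (Finset.sum_nonneg fun l _ => Real.rpow_nonneg (hφ l) _) hC hconj.pos]
    have hx : (∑ l ∈ F, ‖x.1 l‖ ^ r.norm.toReal) ^ (1 / r.norm.toReal) ≤ ‖x‖ := by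
      rw [one_div, Real.rpow_inv_le_iff_of_pos (Finset.sum_nonneg fun l _ =>
        Real.rpow_nonneg (norm_nonneg _) _) (norm_nonneg _) hconj.symm.pos]
      exact sum_rpow_le_norm_rpow_of_exponent_le hr h.norm_le_norm x F
    calc ∑ l ∈ F, φ l * ‖x.1 l‖
        ≤ (∑ l ∈ F, φ l ^ r.conj) ^ (1 / r.conj) *
            (∑ l ∈ F, ‖x.1 l‖ ^ r.norm.toReal) ^ (1 / r.norm.toReal) :=
          Real.inner_le_Lp_mul_Lq_of_nonneg F hconj (fun l _ => hφ l) fun l _ => norm_nonneg _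
      _ ≤ C * ‖x‖ := by gcongr

theorem upperEstimate_incl (h : Admissible p r) :
    UpperEstimate (fun l => incl 𝕜 X p l) r.conj := by
  intro f C hC hF
  refine (WeakDual.toStrongDual f).opNorm_le_bound hC fun x => ?_
  have hlim := ((hasSum_incl h.exponent_lt_top x).mapL (WeakDual.toStrongDual f)).norm
  refine le_of_tendsto hlim (Eventually.of_forall fun F => ?_)
  calc ‖∑ l ∈ F, WeakDual.toStrongDual f (incl 𝕜 X p l (x.1 l))‖
      ≤ ∑ l ∈ F, ‖WeakDual.toStrongDual (coord (fun l => incl 𝕜 X p l) l f)‖ * ‖x.1 l‖ :=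
        norm_sum_le_of_le _ fun l _ =>
          (WeakDual.toStrongDual (coord (fun l => incl 𝕜 X p l) l f)).le_opNorm (x.1 l)
    _ ≤ C * ‖x‖ := sum_mul_norm_apply_le h (fun _ => norm_nonneg _) hC (hF F) x

theorem sum_mul_norm_comp_incl_le {g : StrongDual 𝕜 (directSum 𝕜 Y r)} (hg : ‖g‖ ≤ 1)
    {c : Λ → ℝ} (hc : ∀ l, 0 ≤ c l) {F : Finset Λ} {B : ℝ}
    (hB : ∀ y : ∀ l, Y l, (∀ l, ‖y l‖ ≤ c l) → ‖∑ l ∈ F, incl 𝕜 Y r l (y l)‖ ≤ B) :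
    ∑ l ∈ F, c l * ‖g.comp (incl 𝕜 Y r l)‖ ≤ B := by
  have hη_le : ∀ η > 0, ∑ l ∈ F, c l * (‖g.comp (incl 𝕜 Y r l)‖ - η) ≤ B := by
    intro η hη
    choose y hy hlt using fun l => exists_lt_re_apply_of_lt_norm (g.comp (incl 𝕜 Y r l))
      (sub_lt_self _ hη)
    have hcn : ∀ l, ‖((c l : ℝ) : 𝕜)‖ = c l := fun l => by
      rw [RCLike.norm_ofReal, abs_of_nonneg (hc l)]
    have h1 := hB (fun l => ((c l : ℝ) : 𝕜) • y l) fun l => by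
      rw [norm_smul, hcn]
      exact mul_le_of_le_one_right (hc l) (hy l)
    calc ∑ l ∈ F, c l * (‖g.comp (incl 𝕜 Y r l)‖ - η)
        ≤ ∑ l ∈ F, c l * RCLike.re (g.comp (incl 𝕜 Y r l) (y l)) := by
          refine Finset.sum_le_sum fun l _ => ?_
          exact mul_le_mul_of_nonneg_left (hlt l).le (hc l)
      _ = RCLike.re (g (∑ l ∈ F, incl 𝕜 Y r l (((c l : ℝ) : 𝕜) • y l))) := by
          simp only [map_sum, map_smul, smul_eq_mul, RCLike.re_ofReal_mul]
          rfl
      _ ≤ ‖g (∑ l ∈ F, incl 𝕜 Y r l (((c l : ℝ) : 𝕜) • y l))‖ := RCLike.re_le_norm _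
      _ ≤ 1 * ‖∑ l ∈ F, incl 𝕜 Y r l (((c l : ℝ) : 𝕜) • y l)‖ := g.le_of_opNorm_le hg _
      _ ≤ B := by rwa [one_mul]
  have hlim : Tendsto (fun η : ℝ => ∑ l ∈ F, c l * (‖g.comp (incl 𝕜 Y r l)‖ - η)) (𝓝[>] 0)
      (𝓝 (∑ l ∈ F, c l * (‖g.comp (incl 𝕜 Y r l)‖ - 0))) := by
    refine Tendsto.mono_left ?_ nhdsWithin_le_nhds
    exact (by fun_prop : Continuous fun η : ℝ =>
      ∑ l ∈ F, c l * (‖g.comp (incl 𝕜 Y r l)‖ - η)).tendsto 0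
  simp only [sub_zero] at hlim
  exact le_of_tendsto hlim (eventually_mem_nhdsWithin.mono fun η hη => hη_le η hη)

theorem le_one_of_le_rpow_inv {s t : ℝ} (hs : 1 < s) (h : t ≤ t ^ s⁻¹) : t ≤ 1 := by
  by_contra! ht
  have hlt : t ^ s⁻¹ < t ^ (1 : ℝ) := Real.rpow_lt_rpow_of_exponent_lt ht (inv_lt_one_of_one_lt₀ hs)
  rw [Real.rpow_one] at hlt
  exact hlt.not_ge h

theorem sum_norm_comp_incl_le_one (hr : r.norm = ∞) {g : StrongDual 𝕜 (directSum 𝕜 Y r)}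
    (hg : ‖g‖ ≤ 1) (F : Finset Λ) : ∑ l ∈ F, ‖g.comp (incl 𝕜 Y r l)‖ ≤ 1 := by
  classical
  have := sum_mul_norm_comp_incl_le hg (c := fun _ => 1) (fun _ => zero_le_one) (F := F) (B := 1)
    fun y hy => norm_le_of_norm_eq_top hr zero_le_one fun j => by
      rw [coe_sum_incl_apply]
      split_ifs
      · exact hy j
      · simp
  simpa only [one_mul] using this

theorem sum_norm_comp_incl_rpow_le_of_ne_top (hr : r.norm ≠ ∞) (hr1 : 1 < r.norm)
    {g : StrongDual 𝕜 (directSum 𝕜 Y r)} (hg : ‖g‖ ≤ 1) (F : Finset Λ) :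
    ∑ l ∈ F, ‖g.comp (incl 𝕜 Y r l)‖ ^ r.conj ≤ 1 := by
  classical
  have hconj := Exponent.holderConjugate hr hr1
  -- The extremal sequence `‖g_l‖ ^ (r' - 1)` in Hölder's inequality.
  set c : Λ → ℝ := fun l => ‖g.comp (incl 𝕜 Y r l)‖ ^ (r.conj - 1) with hc
  have hc_rpow : ∀ l, c l ^ r.norm.toReal = ‖g.comp (incl 𝕜 Y r l)‖ ^ r.conj := fun l => by
    rw [hc, ← Real.rpow_mul (norm_nonneg _), hconj.symm.sub_one_mul_conj]
  have hc_mul : ∀ l, c l * ‖g.comp (incl 𝕜 Y r l)‖ = ‖g.comp (incl 𝕜 Y r l)‖ ^ r.conj :=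
    fun l => by
      have := Real.rpow_add_of_nonneg (norm_nonneg (g.comp (incl 𝕜 Y r l)))
        (sub_nonneg.2 hconj.symm.lt.le) zero_le_one
      rw [Real.rpow_one, sub_add_cancel] at this
      exact this.symm
  have hsum := sum_mul_norm_comp_incl_le hg (fun l => Real.rpow_nonneg (norm_nonneg _) _)
    (c := c) (F := F) (B := (∑ l ∈ F, ‖g.comp (incl 𝕜 Y r l)‖ ^ r.conj) ^ r.norm.toReal⁻¹)
    fun y hy => by
      rw [Real.le_rpow_inv_iff_of_pos (norm_nonneg _)
        (Finset.sum_nonneg fun l _ => Real.rpow_nonneg (norm_nonneg _) _) hconj.pos]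
      change ‖(∑ l ∈ F, incl 𝕜 Y r l (y l)).1‖ ^ _ ≤ _
      rw [coe_sum_incl, lp.norm_sum_single hconj.pos]
      refine Finset.sum_le_sum fun l _ => ?_
      rw [← hc_rpow]
      exact Real.rpow_le_rpow (norm_nonneg _) (hy l) hconj.nonneg
  simp only [hc_mul] at hsum
  exact le_one_of_le_rpow_inv hconj.lt hsum

theorem sum_norm_comp_incl_rpow_le (hr1 : 1 < r.norm) {g : StrongDual 𝕜 (directSum 𝕜 Y r)}
    (hg : ‖g‖ ≤ 1) (F : Finset Λ) : ∑ l ∈ F, ‖g.comp (incl 𝕜 Y r l)‖ ^ r.conj ≤ 1 := by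
  by_cases hr : r.norm = ∞
  · simpa only [Exponent.conj_of_top hr, Real.rpow_one] using sum_norm_comp_incl_le_one hr hg F
  · exact sum_norm_comp_incl_rpow_le_of_ne_top hr hr1 hg F

variable (A : ∀ l, X l →L[𝕜] Y l) (hA : ∃ R, ∀ l, ‖A l‖ ≤ R) (h : Admissible p r)

theorem diagOp_incl (l : Λ) (x : X l) :
    diagOp A hA h (incl 𝕜 X p l x) = incl 𝕜 Y r l (A l x) := by
  classical
  ext j
  change A j ((incl 𝕜 X p l x).1 j) = (incl 𝕜 Y r l (A l x)).1 j
  rw [coe_incl, coe_incl, lp.coeFn_single, lp.coeFn_single]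
  by_cases hj : j = l
  · subst hj
    simp
  · simp [hj]

theorem dualBallImage_diagOp_subset :
    dualBallImage (diagOp A hA h) ⊆ sumSet (fun l => incl 𝕜 X p l) A r.conj 1 := by
  rintro f ⟨g, hg, rfl⟩
  refine ⟨fun l => g.comp (incl 𝕜 Y r l), fun l => ?_,
    fun F => sum_norm_comp_incl_rpow_le h.one_lt_norm hg F⟩
  refine DFunLike.ext _ _ fun x => ?_
  exact congrArg g (diagOp_incl A hA h l x)

theorem comp_proj_mem_dualBallImage_diagOp {l : Λ} {f : WeakDual 𝕜 (X l)}
    (hf : f ∈ dualBallImage (A l)) :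
    StrongDual.toWeakDual ((WeakDual.toStrongDual f).comp (proj 𝕜 X p l)) ∈
      dualBallImage (diagOp A hA h) := by
  obtain ⟨g, hg, rfl⟩ := hf
  refine ⟨g.comp (proj 𝕜 Y r l), ?_, rfl⟩
  refine ContinuousLinearMap.opNorm_le_bound _ zero_le_one fun y => ?_
  exact (g.le_of_opNorm_le hg _).trans (by gcongr; exact norm_proj_apply_le l y)

theorem norm_le_norm_comp_proj {l : Λ} (f : StrongDual 𝕜 (X l)) :
    ‖f‖ ≤ ‖f.comp (proj 𝕜 X p l)‖ := by
  refine f.opNorm_le_bound (ContinuousLinearMap.opNorm_nonneg _) fun x => ?_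
  have := (f.comp (proj 𝕜 X p l)).le_opNorm (incl 𝕜 X p l x)
  rwa [ContinuousLinearMap.comp_apply, proj_incl, norm_incl] at this

theorem iterDeriv_eq_empty_of_diagOp {ε : ℝ} (hε : 0 ≤ ε) {α : Ordinal.{u}}
    (hα : iterDeriv ε (dualBallImage (diagOp A hA h)) α = ∅) (l : Λ) :
    iterDeriv ε (dualBallImage (A l)) α = ∅ := by
  refine Set.eq_empty_of_forall_notMem fun f hf => ?_
  have hmem := map_mem_iterDeriv (L := dualBallImage (diagOp A hA h)) (c := 1)
    (T := fun f => StrongDual.toWeakDual ((WeakDual.toStrongDual f).comp (proj 𝕜 X p l)))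
    zero_lt_one hε (continuous_toWeakDual_comp _)
    (fun _ hf => comp_proj_mem_dualBallImage_diagOp A hA h hf)
    (fun f _ g _ => by
      rw [one_mul]
      exact norm_le_norm_comp_proj (WeakDual.toStrongDual (f - g))) α hf
  rwa [one_mul, hα] at hmem

open Ordinal in
theorem exists_iterDeriv_diagOp_eq_empty {ε : ℝ} (hε : 0 < ε) {ζ : Ordinal.{u}} {m : ℕ}
    (hm : ∀ l, iterDeriv (ε / 8) (dualBallImage (A l)) (ω ^ ζ * m) = ∅) :
    ∃ M : ℕ, iterDeriv ε (dualBallImage (diagOp A hA h)) (ω ^ ζ * M) = ∅ := by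
  obtain ⟨R, hR⟩ := id hA
  obtain ⟨M, hM⟩ := exists_iterDeriv_sumSet_eq_empty (Exponent.one_le_conj h.one_lt_norm)
    (upperEstimate_incl (𝕜 := 𝕜) (X := X) h) (le_max_right R 0)
    (fun l => (hR l).trans (le_max_left R 0)) hε hm
  exact ⟨M, Set.subset_eq_empty (iterDeriv_mono le_rfl (dualBallImage_diagOp_subset A hA h) _) hM⟩

end DiagOp

/-! ### The lower bound for a single operator -/

section LowerBound

open Ordinal

variable {𝕜 : Type*} [RCLike 𝕜] {X : Type u} [NormedAddCommGroup X] [NormedSpace 𝕜 X]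
  {Y : Type v} [NormedAddCommGroup Y] [NormedSpace 𝕜 Y]

theorem smul_mem_iterDeriv_dualBallImage_add {A : X →L[𝕜] Y} {ε ε' s : ℝ} (hε : 0 ≤ ε)
    (hs : 0 < s) (hε' : ε' ≤ s / 4 * ε) {α β : Ordinal.{u}}
    (hmem : ∀ g ∈ dualBallImage A, (s : 𝕜) • g ∈ iterDeriv ε' (dualBallImage A) β)
    (hne : (iterDeriv ε (dualBallImage A) α).Nonempty) {f : WeakDual 𝕜 X}
    (hf : f ∈ dualBallImage A) :
    ((s / 2 : ℝ) : 𝕜) • f ∈ iterDeriv ε' (dualBallImage A) (β + α) := by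
  obtain ⟨k, hk⟩ := hne
  -- `T` is an affine image of the identity with `T k = (s / 2) • f`.
  set T : WeakDual 𝕜 X → WeakDual 𝕜 X := fun g => (s : 𝕜) •
    (((1 / 2 : ℝ) : 𝕜) • f + ((-(1 / 4) : ℝ) : 𝕜) • k + ((1 / 4 : ℝ) : 𝕜) • g) with hT
  have hTk : T k = ((s / 2 : ℝ) : 𝕜) • f := by
    simp only [hT]
    push_cast
    module
  have hTcont : Continuous T :=
    (continuous_const_smul _).comp (continuous_const.add (continuous_const_smul _))
  have hmaps : Set.MapsTo T (dualBallImage A) (iterDeriv ε' (dualBallImage A) β) := by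
    refine fun g hg => hmem _ (smul_add_smul_add_smul_mem_dualBallImage hf
      (iterDeriv_subset _ _ _ hk) hg ?_)
    rw [RCLike.norm_ofReal, RCLike.norm_ofReal, RCLike.norm_ofReal]
    norm_num [abs_of_pos]
  have hdist : ∀ g ∈ dualBallImage A, ∀ g' ∈ dualBallImage A,
      s / 4 * ‖WeakDual.toStrongDual (g - g')‖ ≤ ‖WeakDual.toStrongDual (T g - T g')‖ := by
    intro g _ g' _
    have hsub : T g - T g' = ((s / 4 : ℝ) : 𝕜) • (g - g') := by
      simp only [hT]
      push_cast
      module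
    rw [hsub, map_smul, norm_smul, RCLike.norm_of_nonneg (by positivity)]
  have hTmem := map_mem_iterDeriv (by positivity) hε hTcont hmaps hdist α hk
  rw [hTk] at hTmem
  rw [iterDeriv_add]
  exact iterDeriv_mono hε' subset_rfl α hTmem

theorem smul_mem_iterDeriv_dualBallImage {A : X →L[𝕜] Y} {ε : ℝ} (hε : 0 ≤ ε) {ξ : Ordinal.{u}}
    (hξ : Order.IsSuccLimit (ω ^ ξ))
    (hne : ∀ α < ω ^ ξ, (iterDeriv ε (dualBallImage A) α).Nonempty) (n : ℕ) :
    ∀ f ∈ dualBallImage A, (((1 / 2) ^ n : ℝ) : 𝕜) • f ∈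
      iterDeriv ((1 / 2) ^ (n + 1) * ε) (dualBallImage A) (ω ^ ξ * n) := by
  induction n with
  | zero => simp
  | succ n ih =>
    intro f hf
    have hpow : (1 / 2 : ℝ) ^ (n + 1) = (1 / 2) ^ n / 2 := by ring
    have hscale : (1 / 2 : ℝ) ^ (n + 1 + 1) * ε = (1 / 2) ^ n / 4 * ε := by ring
    have hle : (1 / 2 : ℝ) ^ (n + 1 + 1) * ε ≤ (1 / 2) ^ (n + 1) * ε :=
      mul_le_mul_of_nonneg_right (pow_le_pow_of_le_one (by norm_num) (by norm_num) (by omega)) hε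
    rw [iterDeriv_mul_natCast_add_one, iterDeriv_limit _ _ hξ]
    refine Set.mem_iInter₂.2 fun α hα => ?_
    rw [← iterDeriv_add, congrArg (RCLike.ofReal (K := 𝕜)) hpow]
    exact smul_mem_iterDeriv_dualBallImage_add hε (by positivity) hscale.le
      (fun g hg => iterDeriv_mono hle subset_rfl _ (ih g hg)) (hne α hα) hf

theorem omega0_opow_add_one_le_opIndex {A : X →L[𝕜] Y} {ε : ℝ} (hε : 0 < ε) {ξ : Ordinal.{u}}
    (hξ : Order.IsSuccLimit (ω ^ ξ))
    (hne : ∀ α < ω ^ ξ, (iterDeriv ε (dualBallImage A) α).Nonempty) :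
    ((ω ^ (ξ + 1) : Ordinal.{u}) : WithTop Ordinal.{u}) ≤ opIndex A := by
  by_contra! hlt
  obtain ⟨β, hβ, hβlt⟩ := WithTop.lt_iff_exists_coe.1 hlt
  rw [WithTop.coe_lt_coe, opow_add, opow_one, lt_mul_iff_of_isSuccLimit isSuccLimit_omega0] at hβlt
  obtain ⟨c, hc, hβc⟩ := hβlt
  obtain ⟨n, rfl⟩ := lt_omega0.1 hc
  have hempty := index_le_iff.1 hβ.le ((1 / 2) ^ (n + 1) * ε) (by positivity)
  have hmem := smul_mem_iterDeriv_dualBallImage hε.le hξ hne n 0 (zero_mem_dualBallImage A)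
  have hmem' := iterDeriv_antitone _ _ hβc.le hmem
  rw [hempty] at hmem'
  exact hmem'

end LowerBound

/-! ### Structure of the trees -/

section Trees

open Ordinal

theorem treeOne_zero : treeOne (0 : Ordinal.{u}) = {[0]} := by
  unfold treeOne; rw [limitRecOn_zero]

theorem mem_treeOne_add_one {ζ : Ordinal.{u}} {l : List Ordinal.{u}} :
    l ∈ treeOne (ζ + 1) ↔ ∃ n : ℕ, l ∈ tree ζ (n + 1) := by
  have : treeOne (ζ + 1) = {l | ∃ n : ℕ, 1 ≤ n ∧ l ∈ stack ζ (treeOne ζ) n} := by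
    conv_lhs => unfold treeOne
    rw [limitRecOn_add_one]
    rfl
  rw [this]
  constructor
  · rintro ⟨n, hn, hl⟩
    obtain ⟨n, rfl⟩ := Nat.exists_eq_add_of_le' hn
    exact ⟨n, hl⟩
  · rintro ⟨n, hl⟩
    exact ⟨n + 1, by omega, hl⟩

theorem mem_treeOne_limit {ξ : Ordinal.{u}} (hξ : Order.IsSuccLimit ξ) {l : List Ordinal.{u}} :
    l ∈ treeOne ξ ↔ ∃ ζ < ξ, ∃ t ∈ treeOne (ζ + 1), l = shift (ω ^ ζ) t := by
  conv_lhs => unfold treeOne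
  rw [limitRecOn_limit _ _ _ _ hξ]
  simp only [← Order.succ_eq_add_one]
  constructor
  · rintro ⟨ζ, hζ, t, ht, rfl⟩
    exact ⟨ζ, hζ, t, ht, rfl⟩
  · rintro ⟨ζ, hζ, t, ht, rfl⟩
    exact ⟨ζ, hζ, t, ht, rfl⟩

theorem mem_tree_succ {ζ : Ordinal.{u}} {n : ℕ} {l : List Ordinal.{u}} :
    l ∈ tree ζ (n + 1) ↔ (∃ t ∈ treeOne ζ, l = shift (ω ^ ζ * n) t) ∨
      ∃ t ∈ maxNodes (treeOne ζ), ∃ s ∈ tree ζ n, l = shift (ω ^ ζ * n) t ++ s := Iff.rfl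

theorem treeOne_nonempty (ζ : Ordinal.{u}) : (treeOne ζ).Nonempty := by
  induction ζ using Ordinal.limitRecOn with
  | zero => exact ⟨[0], by simp [treeOne_zero]⟩
  | add_one ζ ih =>
    obtain ⟨t, ht⟩ := ih
    exact ⟨_, mem_treeOne_add_one.2 ⟨0, mem_tree_succ.2 (Or.inl ⟨t, ht, rfl⟩)⟩⟩
  | limit ξ hξ ih =>
    obtain ⟨t, ht⟩ := ih (0 + 1) (by simpa using one_lt_of_isSuccLimit hξ)
    exact ⟨_, (mem_treeOne_limit hξ).2 ⟨0, hξ.bot_lt, t, ht, rfl⟩⟩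

theorem shift_injective (β : Ordinal.{u}) : Function.Injective (shift β) :=
  List.map_injective_iff.2 fun a b h => by simpa using h

theorem shift_prefix_shift_iff {β : Ordinal.{u}} {s t : List Ordinal.{u}} :
    shift β s <+: shift β t ↔ s <+: t := by
  constructor
  · intro h
    obtain ⟨r, hr, he⟩ := List.prefix_map_iff.1 h
    rwa [shift_injective β he]
  · exact fun h => h.map _

theorem prefix_of_prefix_shift {β : Ordinal.{u}} {s t : List Ordinal.{u}} (h : s <+: shift β t) :
    ∃ r, r <+: t ∧ s = shift β r := List.prefix_map_iff.1 h

/-- The maximal members of `Γ_{ζ,n}` for `n ≥ 1`, described recursively; for `n = 0` only the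
empty sequence. -/
def branches (ζ : Ordinal.{u}) : ℕ → Set (List Ordinal.{u})
  | 0 => {[]}
  | n + 1 => {l | ∃ t ∈ maxNodes (treeOne ζ), ∃ s ∈ branches ζ n, l = shift (ω ^ ζ * n) t ++ s}

theorem tree_one (ζ : Ordinal.{u}) : tree ζ 1 = treeOne ζ := by
  ext l
  have hshift : ∀ t : List Ordinal.{u}, shift (ω ^ ζ * ((0 : ℕ) : Ordinal.{u})) t = t := fun _ => by
    simp [shift]
  rw [mem_tree_succ]
  simp only [hshift]
  exact ⟨fun h => h.elim (fun ⟨_, ht, hl⟩ => hl ▸ ht) fun ⟨_, _, _, hs, _⟩ => hs.elim,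
    fun h => Or.inl ⟨l, h, rfl⟩⟩

theorem append_mem_maxNodes_tree {ζ : Ordinal.{u}} {n : ℕ} {t s : List Ordinal.{u}}
    (ht : t ∈ maxNodes (treeOne ζ)) (hs : s ∈ maxNodes (tree ζ n)) :
    shift (ω ^ ζ * n) t ++ s ∈ maxNodes (tree ζ (n + 1)) := by
  refine ⟨Or.inr ⟨t, ht, s, hs.1, rfl⟩, ?_⟩
  rintro v (⟨t', ht', rfl⟩ | ⟨t', ht', s', hs', rfl⟩) hv
  · obtain rfl := ht.2 t' ht' (shift_prefix_shift_iff.1 ((List.prefix_append _ _).trans hv))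
    exact (hv.eq_of_length_le (by simp)).symm
  · have htt : t = t' := by
      rcases List.prefix_or_prefix_of_prefix ((List.prefix_append _ _).trans hv)
        (List.prefix_append (shift (ω ^ ζ * (n : Ordinal.{u})) t') s') with h | h
      · exact (ht.2 t' ht'.1 (shift_prefix_shift_iff.1 h)).symm
      · exact ht'.2 t ht.1 (shift_prefix_shift_iff.1 h)
    subst htt
    rw [hs.2 s' hs' ((List.prefix_append_right_inj _).1 hv)]

theorem exists_eq_append_of_mem_maxNodes_tree {ζ : Ordinal.{u}} {n : ℕ} {l : List Ordinal.{u}}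
    (hl : l ∈ maxNodes (tree ζ (n + 2))) : ∃ t ∈ maxNodes (treeOne ζ),
      ∃ s ∈ maxNodes (tree ζ (n + 1)), l = shift (ω ^ ζ * ((n + 1 : ℕ) : Ordinal.{u})) t ++ s := by
  obtain ⟨⟨t, ht, rfl⟩ | ⟨t, ht, s, hs, rfl⟩, hmax⟩ := hl
  · exfalso
    have htmax : t ∈ maxNodes (treeOne ζ) := ⟨ht, fun t' ht' hp => shift_injective _
      (hmax _ (Or.inl ⟨t', ht', rfl⟩) (shift_prefix_shift_iff.2 hp))⟩
    obtain ⟨u, hu⟩ := treeOne_nonempty ζ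
    have hext := hmax _ (Or.inr ⟨t, htmax, _, mem_tree_succ.2 (Or.inl ⟨u, hu, rfl⟩), rfl⟩)
      (List.prefix_append _ _)
    simp [shift, (treeOne_ok ζ u hu).1] at hext
  · exact ⟨t, ht, s, ⟨hs, fun s' hs' hp => List.append_cancel_left
      (hmax _ (Or.inr ⟨t, ht, s', hs', rfl⟩) ((List.prefix_append_right_inj _).2 hp))⟩, rfl⟩

theorem branches_add_one_eq (ζ : Ordinal.{u}) (n : ℕ) :
    branches ζ (n + 1) = maxNodes (tree ζ (n + 1)) := by
  induction n with
  | zero =>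
    rw [zero_add, tree_one]
    ext l
    simp [branches, shift]
  | succ n ih =>
    ext l
    constructor
    · rintro ⟨t, ht, s, hs, rfl⟩
      exact append_mem_maxNodes_tree ht (ih ▸ hs)
    · intro hl
      obtain ⟨t, ht, s, hs, rfl⟩ := exists_eq_append_of_mem_maxNodes_tree hl
      exact ⟨t, ht, s, ih ▸ hs, rfl⟩

theorem headD_eq_of_prefix {s t : List Ordinal.{u}} (hs : s ≠ []) (h : s <+: t) :
    s.headD 0 = t.headD 0 := by
  obtain ⟨r, rfl⟩ := h
  cases s with
  | nil => exact absurd rfl hs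
  | cons a s => rfl

theorem eq_of_mem_tree_of_headD_eq {ζ : Ordinal.{u}} {n m : ℕ} {s t : List Ordinal.{u}}
    (hs : s ∈ tree ζ (n + 1)) (ht : t ∈ tree ζ (m + 1)) (h : s.headD 0 = t.headD 0) : n = m := by
  have length_le : ∀ {n m : ℕ} {s t : List Ordinal.{u}}, s ∈ tree ζ (n + 1) → t ∈ tree ζ (m + 1) →
      s.headD 0 = t.headD 0 → n ≤ m := by
    intro n m s t hs ht h
    have h1 := (stack_ok (treeOne_ok ζ) n s hs).2.2
    obtain ⟨h2, h3, -⟩ := stack_ok (treeOne_ok ζ) m t ht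
    have h4 : t.headD 0 < ω ^ ζ * ((m + 1 : ℕ) : Ordinal.{u}) := by
      cases t with
      | nil => exact absurd rfl h2
      | cons a t => exact h3 a (by simp)
    rw [h] at h1
    have h5 := h1.trans_lt h4
    rw [mul_lt_mul_iff_right₀ (omega_opow_pos ζ)] at h5
    exact Nat.lt_succ_iff.1 (by exact_mod_cast h5)
  exact le_antisymm (length_le hs ht h) (length_le ht hs h.symm)

theorem log_headD_shift_opow {ζ : Ordinal.{u}} {t : List Ordinal.{u}} (ht : t ∈ treeOne (ζ + 1)) :
    log ω ((shift (ω ^ ζ) t).headD 0) = ζ := by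
  obtain ⟨a, b⟩ := treeOne_ok _ t ht
  cases t with
  | nil => exact absurd rfl a
  | cons x t =>
    have := b x (by simp)
    have hp : (shift (ω ^ ζ) (x :: t)).headD 0 = ω ^ ζ + x := by simp [shift]
    rw [hp]
    have hlt : ω ^ ζ + x < ω ^ (ζ + 1) := isPrincipal_add_omega0_opow _
      ((opow_lt_opow_iff_right one_lt_omega0).2 (Order.lt_add_one_iff.2 le_rfl)) this
    apply le_antisymm
    · rw [← Order.lt_add_one_iff]
      exact (lt_opow_iff_log_lt one_lt_omega0 (by simp)).1 hlt
    · exact (opow_le_iff_le_log one_lt_omega0 (by simp)).1 le_self_add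

theorem mem_maxNodes_treeOne_add_one {ζ : Ordinal.{u}} {t : List Ordinal.{u}} :
    t ∈ maxNodes (treeOne (ζ + 1)) ↔ ∃ n, t ∈ branches ζ (n + 1) := by
  simp only [branches_add_one_eq]
  constructor
  · rintro ⟨ht, hmax⟩
    obtain ⟨n, hn⟩ := mem_treeOne_add_one.1 ht
    exact ⟨n, hn, fun s hs => hmax s (mem_treeOne_add_one.2 ⟨n, hs⟩)⟩
  · rintro ⟨n, hn, hmax⟩
    refine ⟨mem_treeOne_add_one.2 ⟨n, hn⟩, fun s hs hp => hmax s ?_ hp⟩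
    obtain ⟨m, hm⟩ := mem_treeOne_add_one.1 hs
    rwa [eq_of_mem_tree_of_headD_eq hn hm
      (headD_eq_of_prefix (stack_ok (treeOne_ok ζ) n t hn).1 hp)]

theorem mem_maxNodes_treeOne_limit {ξ : Ordinal.{u}} (hξ : Order.IsSuccLimit ξ)
    {l : List Ordinal.{u}} : l ∈ maxNodes (treeOne ξ) ↔
      ∃ ζ < ξ, ∃ t ∈ maxNodes (treeOne (ζ + 1)), l = shift (ω ^ ζ) t := by
  constructor
  · rintro ⟨hl, hmax⟩
    obtain ⟨ζ, hζ, t, ht, rfl⟩ := (mem_treeOne_limit hξ).1 hl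
    refine ⟨ζ, hζ, t, ⟨ht, fun s hs hp => ?_⟩, rfl⟩
    exact shift_injective _ (hmax _ ((mem_treeOne_limit hξ).2 ⟨ζ, hζ, s, hs, rfl⟩)
      (shift_prefix_shift_iff.2 hp))
  · rintro ⟨ζ, hζ, t, ht, rfl⟩
    refine ⟨(mem_treeOne_limit hξ).2 ⟨ζ, hζ, t, ht.1, rfl⟩, fun s hs hp => ?_⟩
    obtain ⟨ζ', -, t', ht', rfl⟩ := (mem_treeOne_limit hξ).1 hs
    have hne : shift (ω ^ ζ) t ≠ [] := by simpa [shift] using (treeOne_ok _ t ht.1).1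
    have h1 := log_headD_shift_opow ht.1
    rw [headD_eq_of_prefix hne hp, log_headD_shift_opow ht'] at h1
    subst h1
    rw [ht.2 t' ht' (shift_prefix_shift_iff.1 hp)]

theorem mem_tree_of_prefix_of {ζ : Ordinal.{u}}
    (h : ∀ s ∈ treeOne ζ, ∀ r, r ≠ [] → r <+: s → r ∈ treeOne ζ) (n : ℕ) :
    ∀ s ∈ tree ζ n, ∀ r, r ≠ [] → r <+: s → r ∈ tree ζ n := by
  induction n with
  | zero => exact fun s hs => hs.elim
  | succ n ih =>
    rintro s (⟨t, ht, rfl⟩ | ⟨t, ht, u, hu, rfl⟩) r hr hrs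
    · obtain ⟨r, hr', rfl⟩ := prefix_of_prefix_shift hrs
      exact Or.inl ⟨r, h t ht r (by simpa [shift] using hr) hr', rfl⟩
    · rcases List.prefix_or_prefix_of_prefix hrs (List.prefix_append _ _) with h1 | ⟨w, rfl⟩
      · obtain ⟨r, hr', rfl⟩ := prefix_of_prefix_shift h1
        exact Or.inl ⟨r, h t ht.1 r (by simpa [shift] using hr) hr', rfl⟩
      · by_cases hw : w = []
        · subst hw
          rw [List.append_nil]
          exact Or.inl ⟨t, ht.1, rfl⟩
        · exact Or.inr ⟨t, ht, w, ih u hu w hw ((List.prefix_append_right_inj _).1 hrs), rfl⟩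

theorem mem_treeOne_of_prefix (ζ : Ordinal.{u}) :
    ∀ s ∈ treeOne ζ, ∀ r, r ≠ [] → r <+: s → r ∈ treeOne ζ := by
  induction ζ using Ordinal.limitRecOn with
  | zero =>
    intro s hs r hr hp
    rw [treeOne_zero] at hs ⊢
    obtain rfl : s = [0] := hs
    refine hp.eq_of_length_le ?_
    exact Nat.succ_le_of_lt (List.length_pos_iff.2 hr)
  | add_one ζ ih =>
    intro s hs r hr hp
    obtain ⟨n, hn⟩ := mem_treeOne_add_one.1 hs
    exact mem_treeOne_add_one.2 ⟨n, mem_tree_of_prefix_of ih _ s hn r hr hp⟩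
  | limit ξ hξ ih =>
    intro s hs r hr hp
    obtain ⟨ζ, hζ, t, ht, rfl⟩ := (mem_treeOne_limit hξ).1 hs
    obtain ⟨r, hr', rfl⟩ := prefix_of_prefix_shift hp
    exact (mem_treeOne_limit hξ).2 ⟨ζ, hζ, r,
      ih _ (hξ.add_one_lt hζ) t ht r (by simpa [shift] using hr) hr', rfl⟩

theorem mem_tree_of_prefix {ζ : Ordinal.{u}} {n : ℕ} {s r : List Ordinal.{u}} (hs : s ∈ tree ζ n)
    (hr : r ≠ []) (h : r <+: s) : r ∈ tree ζ n :=
  mem_tree_of_prefix_of (mem_treeOne_of_prefix ζ) n s hs r hr h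

theorem mem_tree_of_prefix_of_mem_branches {ζ : Ordinal.{u}} {n : ℕ} {s r : List Ordinal.{u}}
    (hs : s ∈ branches ζ n) (hr : r ≠ []) (h : r <+: s) : r ∈ tree ζ n := by
  cases n with
  | zero =>
    obtain rfl : s = [] := hs
    exact absurd (List.prefix_nil.1 h) hr
  | succ n =>
    rw [branches_add_one_eq] at hs
    exact mem_tree_of_prefix hs.1 hr h

theorem pairwise_shift {β : Ordinal.{u}} {t : List Ordinal.{u}} (h : t.Pairwise (· > ·)) :
    (shift β t).Pairwise (· > ·) :=
  h.map _ fun a b hab => by simpa using hab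

theorem pairwise_of_mem_tree_of {ζ : Ordinal.{u}} (h : ∀ s ∈ treeOne ζ, s.Pairwise (· > ·))
    (n : ℕ) : ∀ s ∈ tree ζ n, s.Pairwise (· > ·) := by
  induction n with
  | zero => exact fun s hs => hs.elim
  | succ n ih =>
    rintro s (⟨t, ht, rfl⟩ | ⟨t, ht, u, hu, rfl⟩)
    · exact pairwise_shift (h t ht)
    · refine List.pairwise_append.2 ⟨pairwise_shift (h t ht.1), ih u hu, fun a ha b hb => ?_⟩
      obtain ⟨a, -, rfl⟩ := List.mem_map.1 ha
      cases n with
      | zero => exact hu.elim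
      | succ n => exact ((stack_ok (treeOne_ok ζ) n u hu).2.1 b hb).trans_le le_self_add

theorem pairwise_of_mem_treeOne (ζ : Ordinal.{u}) : ∀ s ∈ treeOne ζ, s.Pairwise (· > ·) := by
  induction ζ using Ordinal.limitRecOn with
  | zero =>
    intro s hs
    rw [treeOne_zero] at hs
    obtain rfl : s = [0] := hs
    simp
  | add_one ζ ih =>
    intro s hs
    obtain ⟨n, hn⟩ := mem_treeOne_add_one.1 hs
    exact pairwise_of_mem_tree_of ih _ s hn
  | limit ξ hξ ih =>
    intro s hs
    obtain ⟨ζ, hζ, t, ht, rfl⟩ := (mem_treeOne_limit hξ).1 hs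
    exact pairwise_shift (ih _ (hξ.add_one_lt hζ) t ht)

/-- The sum `∑_{∅ < s ≤ l} w(s)` over the nonempty initial segments of `l`. -/
noncomputable def prefixSum (w : List Ordinal.{u} → ℝ) (l : List Ordinal.{u}) : ℝ :=
  ∑ k ∈ Finset.range l.length, w (l.take (k + 1))

theorem prefixSum_congr {w w' : List Ordinal.{u} → ℝ} {l : List Ordinal.{u}}
    (h : ∀ s, s ≠ [] → s <+: l → w s = w' s) : prefixSum w l = prefixSum w' l := by
  refine Finset.sum_congr rfl fun k hk => h _ ?_ (List.take_prefix _ _)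
  rw [Finset.mem_range] at hk
  intro h0
  simp only [List.take_eq_nil_iff, Nat.succ_ne_zero, false_or] at h0
  simp [h0] at hk

theorem prefixSum_append (w : List Ordinal.{u} → ℝ) (a b : List Ordinal.{u}) :
    prefixSum w (a ++ b) = prefixSum w a + prefixSum (fun s => w (a ++ s)) b := by
  unfold prefixSum
  rw [List.length_append, Finset.sum_range_add]
  congr 1
  · refine Finset.sum_congr rfl fun k hk => ?_
    rw [List.take_append_of_le_length (by simpa using Finset.mem_range.1 hk)]
  · refine Finset.sum_congr rfl fun k _ => ?_
    rw [add_assoc, List.take_length_add_append]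

theorem prefixSum_shift (w : List Ordinal.{u} → ℝ) (β : Ordinal.{u}) (l : List Ordinal.{u}) :
    prefixSum w (shift β l) = prefixSum (fun s => w (shift β s)) l := by
  simp [prefixSum, shift, List.map_take]

theorem prefixSum_coeff_of {ζ : Ordinal.{u}}
    (h : ∀ t ∈ maxNodes (treeOne ζ), prefixSum (coeffOne ζ) t = 1) (n : ℕ) :
    ∀ l ∈ branches ζ n, prefixSum (coeff ζ) l = n := by
  induction n with
  | zero =>
    intro l hl
    obtain rfl : l = [] := hl
    simp [prefixSum]
  | succ n ih =>
    rintro l ⟨t, ht, s, hs, rfl⟩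
    rw [prefixSum_append, prefixSum_shift, prefixSum_congr (w' := coeffOne ζ), h t ht,
      prefixSum_congr (w' := coeff ζ), ih s hs]
    · push_cast
      ring
    · exact fun r hr hp => coeff_append ht.1 (mem_tree_of_prefix_of_mem_branches hs hr hp)
    · intro r hr hp
      exact coeff_shift (mem_treeOne_of_prefix ζ t ht.1 r hr hp) _

theorem prefixSum_coeffOne (ζ : Ordinal.{u}) :
    ∀ t ∈ maxNodes (treeOne ζ), prefixSum (coeffOne ζ) t = 1 := by
  induction ζ using Ordinal.limitRecOn with
  | zero =>
    intro t ht
    have := ht.1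
    rw [treeOne_zero] at this
    obtain rfl : t = [0] := this
    simp [prefixSum, coeffOne_zero]
  | add_one ζ ih =>
    intro t ht
    obtain ⟨n, hn⟩ := mem_maxNodes_treeOne_add_one.1 ht
    rw [prefixSum_congr (w' := fun s => coeff ζ s / ((n + 1 : ℕ) : ℝ))]
    · have := prefixSum_coeff_of ih (n + 1) t hn
      unfold prefixSum at this ⊢
      rw [← Finset.sum_div, this, _root_.div_self]
      exact_mod_cast Nat.succ_ne_zero n
    · exact fun s hs hp => coeffOne_succ (mem_tree_of_prefix_of_mem_branches hn hs hp)
  | limit ξ hξ ih =>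
    intro l hl
    obtain ⟨ζ, hζ, t, ht, rfl⟩ := (mem_maxNodes_treeOne_limit hξ).1 hl
    rw [prefixSum_shift, prefixSum_congr (w' := coeffOne (ζ + 1)), ih _ (hξ.add_one_lt hζ) t ht]
    exact fun s hs hp => coeffOne_limit hξ hζ (mem_treeOne_of_prefix _ t ht.1 s hs hp)

theorem prefixSum_coeff {ζ : Ordinal.{u}} {n : ℕ} {l : List Ordinal.{u}} (hl : l ∈ branches ζ n) :
    prefixSum (coeff ζ) l = n := prefixSum_coeff_of (prefixSum_coeffOne ζ) n l hl

theorem coeffOne_nonneg (ζ : Ordinal.{u}) (s : List Ordinal.{u}) : 0 ≤ coeffOne ζ s := by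
  induction ζ using Ordinal.limitRecOn generalizing s with
  | zero => unfold coeffOne; rw [limitRecOn_zero]; exact zero_le_one
  | add_one ζ ih =>
    unfold coeffOne
    rw [limitRecOn_add_one]
    exact div_nonneg (ih _) (Nat.cast_nonneg _)
  | limit ξ hξ ih =>
    unfold coeffOne
    rw [limitRecOn_limit _ _ _ _ hξ]
    split_ifs with h
    · exact ih _ h _
    · exact le_rfl

theorem coeff_nonneg (ζ : Ordinal.{u}) (s : List Ordinal.{u}) : 0 ≤ coeff ζ s :=
  coeffOne_nonneg _ _

end Trees

/-! ### Upper estimates for `θ_{ζ,n}` -/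

section WeightedSums

variable {𝕜 : Type*} [RCLike 𝕜] {X : Type u} [NormedAddCommGroup X] [NormedSpace 𝕜 X] {D : Type u}

/-- `β + t` for sequences of pairs. -/
def shiftPairs (β : Ordinal.{u}) (t : List (Ordinal.{u} × D)) : List (Ordinal.{u} × D) :=
  t.map fun a => (β + a.1, a.2)

@[simp]
theorem map_fst_shiftPairs (β : Ordinal.{u}) (t : List (Ordinal.{u} × D)) :
    (shiftPairs β t).map Prod.fst = shift β (t.map Prod.fst) := by
  simp [shiftPairs, shift]

theorem shiftPairs_append (β : Ordinal.{u}) (s t : List (Ordinal.{u} × D)) :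
    shiftPairs β (s ++ t) = shiftPairs β s ++ shiftPairs β t := List.map_append

variable (𝕜) in
/-- `∑_{∅ < s ≤ t} w(s) x_s`, where `w` only depends on the first coordinates. -/
noncomputable def weightedSum (w : List Ordinal.{u} → ℝ) (x : List (Ordinal.{u} × D) → X)
    (t : List (Ordinal.{u} × D)) : X :=
  ∑ k ∈ Finset.range t.length, ((w ((t.take (k + 1)).map Prod.fst) : ℝ) : 𝕜) • x (t.take (k + 1))

theorem take_ne_nil {α : Type*} {t : List α} {k : ℕ} (hk : k ∈ Finset.range t.length) :
    t.take (k + 1) ≠ [] := by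
  intro h0
  simp only [List.take_eq_nil_iff, Nat.succ_ne_zero, false_or] at h0
  simp [h0] at hk

theorem weightedSum_congr {w w' : List Ordinal.{u} → ℝ} (x : List (Ordinal.{u} × D) → X)
    {t : List (Ordinal.{u} × D)} (h : ∀ s, s ≠ [] → s <+: t.map Prod.fst → w s = w' s) :
    weightedSum 𝕜 w x t = weightedSum 𝕜 w' x t := by
  refine Finset.sum_congr rfl fun k hk => ?_
  rw [h _ (by simpa using take_ne_nil hk) ((List.take_prefix _ _).map _)]

theorem weightedSum_append (w : List Ordinal.{u} → ℝ) (x : List (Ordinal.{u} × D) → X)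
    (a b : List (Ordinal.{u} × D)) :
    weightedSum 𝕜 w x (a ++ b) = weightedSum 𝕜 w x a +
      weightedSum 𝕜 (fun s => w (a.map Prod.fst ++ s)) (fun s => x (a ++ s)) b := by
  unfold weightedSum
  rw [List.length_append, Finset.sum_range_add]
  congr 1
  · refine Finset.sum_congr rfl fun k hk => ?_
    rw [List.take_append_of_le_length (by simpa using Finset.mem_range.1 hk)]
  · refine Finset.sum_congr rfl fun k _ => ?_
    rw [add_assoc, List.take_length_add_append, List.map_append]

theorem weightedSum_shiftPairs (w : List Ordinal.{u} → ℝ) (x : List (Ordinal.{u} × D) → X)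
    (β : Ordinal.{u}) (t : List (Ordinal.{u} × D)) :
    weightedSum 𝕜 w x (shiftPairs β t) =
      weightedSum 𝕜 (fun s => w (shift β s)) (fun s => x (shiftPairs β s)) t := by
  simp [weightedSum, shiftPairs, shift, List.map_take, Function.comp_def]

theorem weightedSum_coeff_append {ζ : Ordinal.{u}} {n : ℕ} (x : List (Ordinal.{u} × D) → X)
    {t s : List (Ordinal.{u} × D)} (ht : t.map Prod.fst ∈ maxNodes (treeOne ζ))
    (hs : s.map Prod.fst ∈ branches ζ n) :
    weightedSum 𝕜 (coeff ζ) x (shiftPairs (ω ^ ζ * n) t ++ s) =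
      weightedSum 𝕜 (coeffOne ζ) (fun r => x (shiftPairs (ω ^ ζ * n) r)) t +
        weightedSum 𝕜 (coeff ζ) (fun r => x (shiftPairs (ω ^ ζ * n) t ++ r)) s := by
  rw [weightedSum_append, weightedSum_shiftPairs]
  congr 1
  · exact weightedSum_congr _ fun r hr hp =>
      coeff_shift (mem_treeOne_of_prefix ζ _ ht.1 r hr hp) _
  · refine weightedSum_congr _ fun r hr hp => ?_
    rw [map_fst_shiftPairs]
    exact coeff_append ht.1 (mem_tree_of_prefix_of_mem_branches hs hr hp)

theorem weightedSum_div (w : List Ordinal.{u} → ℝ) (c : ℝ) (x : List (Ordinal.{u} × D) → X)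
    (t : List (Ordinal.{u} × D)) :
    weightedSum 𝕜 (fun s => w s / c) x t = ((c⁻¹ : ℝ) : 𝕜) • weightedSum 𝕜 w x t := by
  simp only [weightedSum, Finset.smul_sum, smul_smul, div_eq_inv_mul, RCLike.ofReal_mul]

theorem weightedSum_coeffOne_add_one {ζ : Ordinal.{u}} {n : ℕ} (x : List (Ordinal.{u} × D) → X)
    {t : List (Ordinal.{u} × D)} (ht : t.map Prod.fst ∈ branches ζ n) :
    weightedSum 𝕜 (coeffOne (ζ + 1)) x t =
      (((n : ℝ)⁻¹ : ℝ) : 𝕜) • weightedSum 𝕜 (coeff ζ) x t := by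
  rw [← weightedSum_div]
  exact weightedSum_congr x fun s hs hp =>
    coeffOne_succ (mem_tree_of_prefix_of_mem_branches ht hs hp)

theorem weightedSum_coeffOne_limit {ξ ζ : Ordinal.{u}} (hξ : Order.IsSuccLimit ξ) (hζ : ζ < ξ)
    (x : List (Ordinal.{u} × D) → X) {t : List (Ordinal.{u} × D)}
    (ht : t.map Prod.fst ∈ treeOne (ζ + 1)) :
    weightedSum 𝕜 (coeffOne ξ) x (shiftPairs (ω ^ ζ) t) =
      weightedSum 𝕜 (coeffOne (ζ + 1)) (fun s => x (shiftPairs (ω ^ ζ) s)) t := by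
  rw [weightedSum_shiftPairs]
  exact weightedSum_congr _ fun s hs hp =>
    coeffOne_limit hξ hζ (mem_treeOne_of_prefix _ _ ht s hs hp)

theorem prefixSum_map_fst (w : List Ordinal.{u} → ℝ) (t : List (Ordinal.{u} × D)) :
    prefixSum w (t.map Prod.fst) =
      ∑ k ∈ Finset.range t.length, w ((t.take (k + 1)).map Prod.fst) := by
  simp [prefixSum, List.map_take]

theorem norm_weightedSum_le {w : List Ordinal.{u} → ℝ} (hw : ∀ s, 0 ≤ w s)
    {x : List (Ordinal.{u} × D) → X} {t : List (Ordinal.{u} × D)}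
    (hx : ∀ s, s ≠ [] → s <+: t → ‖x s‖ ≤ 1) :
    ‖weightedSum 𝕜 w x t‖ ≤ prefixSum w (t.map Prod.fst) := by
  rw [prefixSum_map_fst]
  refine norm_sum_le_of_le _ fun k hk => ?_
  rw [norm_smul, RCLike.norm_ofReal, abs_of_nonneg (hw _)]
  exact mul_le_of_le_one_right (hw _) (hx _ (take_ne_nil hk) (List.take_prefix _ _))

theorem le_re_apply_weightedSum {w : List Ordinal.{u} → ℝ} (hw : ∀ s, 0 ≤ w s)
    {x : List (Ordinal.{u} × D) → X} {t : List (Ordinal.{u} × D)} {f : WeakDual 𝕜 X} {c : ℝ}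
    (hx : ∀ s, s ≠ [] → s <+: t → c ≤ RCLike.re (f (x s))) :
    prefixSum w (t.map Prod.fst) * c ≤ RCLike.re (f (weightedSum 𝕜 w x t)) := by
  rw [prefixSum_map_fst, weightedSum, map_sum, map_sum, Finset.sum_mul]
  refine Finset.sum_le_sum fun k hk => ?_
  rw [map_smul, smul_eq_mul, RCLike.re_ofReal_mul]
  exact mul_le_mul_of_nonneg_left (hx _ (take_ne_nil hk) (List.take_prefix _ _)) (hw _)

theorem re_apply_le {R : ℝ} {f : WeakDual 𝕜 X} (hf : ‖WeakDual.toStrongDual f‖ ≤ R) (z : X) :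
    RCLike.re (f z) ≤ R * ‖z‖ :=
  (RCLike.re_le_norm _).trans ((WeakDual.toStrongDual f).le_of_opNorm_le hf z)

end WeightedSums

section UpperTheta

open Ordinal

variable {𝕜 : Type*} [RCLike 𝕜] {X : Type u} [NormedAddCommGroup X] [NormedSpace 𝕜 X]
  {D : Type u} [Preorder D]

variable (𝕜) in
/-- A weakly null family in the unit ball, indexed by sequences of pairs whose first coordinates
form a sequence in `T`. -/
structure NullFamily (T : Set (List Ordinal.{u})) (x : List (Ordinal.{u} × D) → X) : Prop where
  tendsto : ∀ (t : List (Ordinal.{u} × D)) (ζ : Ordinal.{u}), t.map Prod.fst ++ [ζ] ∈ T →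
    ∀ f : StrongDual 𝕜 X, Tendsto (fun a : D => f (x (t ++ [(ζ, a)]))) atTop (𝓝 0)
  norm_le : ∀ t : List (Ordinal.{u} × D), t.map Prod.fst ∈ T → ‖x t‖ ≤ 1

theorem NullFamily.comp_shiftPairs {T T' : Set (List Ordinal.{u})}
    {x : List (Ordinal.{u} × D) → X} (hx : NullFamily 𝕜 T x) {β : Ordinal.{u}}
    (h : ∀ t ∈ T', shift β t ∈ T) : NullFamily 𝕜 T' fun s => x (shiftPairs β s) where
  tendsto t ζ ht f := by
    simp only [shiftPairs_append]
    refine hx.tendsto (shiftPairs β t) (β + ζ) ?_ f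
    simpa [shift] using h _ ht
  norm_le t ht := hx.norm_le _ (by simpa using h _ ht)

theorem NullFamily.comp_append {T T' : Set (List Ordinal.{u})}
    {x : List (Ordinal.{u} × D) → X} (hx : NullFamily 𝕜 T x) {l : List (Ordinal.{u} × D)}
    (h : ∀ t ∈ T', l.map Prod.fst ++ t ∈ T) : NullFamily 𝕜 T' fun s => x (l ++ s) where
  tendsto t ζ ht f := by
    simp only [← List.append_assoc]
    refine hx.tendsto (l ++ t) ζ ?_ f
    simpa using h _ ht
  norm_le t ht := hx.norm_le _ (by simpa using h _ ht)

theorem NullFamily.norm_weightedSum_coeffOne_le {ζ : Ordinal.{u}}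
    {x : List (Ordinal.{u} × D) → X} (hx : NullFamily 𝕜 (treeOne ζ) x)
    {t : List (Ordinal.{u} × D)} (ht : t.map Prod.fst ∈ maxNodes (treeOne ζ)) :
    ‖weightedSum 𝕜 (coeffOne ζ) x t‖ ≤ 1 := by
  rw [← prefixSum_coeffOne ζ _ ht]
  exact norm_weightedSum_le (coeffOne_nonneg ζ) fun s hs hp =>
    hx.norm_le _ (mem_treeOne_of_prefix ζ _ ht.1 _ (by simpa using hs) (hp.map _))

theorem NullFamily.mono {T T' : Set (List Ordinal.{u})}
    {x : List (Ordinal.{u} × D) → X} (hx : NullFamily 𝕜 T x) (h : T' ⊆ T) : NullFamily 𝕜 T' x :=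
  ⟨fun t ζ ht => hx.tendsto t ζ (h ht), fun t ht => hx.norm_le t (h ht)⟩

theorem isSuccLimit_omega0_opow {ξ : Ordinal.{u}} (hξ : ξ ≠ 0) : Order.IsSuccLimit (ω ^ ξ) :=
  isSuccLimit_opow_left isSuccLimit_omega0 hξ

/-- `L` is weak*-compact with `L ⊆ R • B_{X*}`, and the open set `O` contains the derived set
`s_{δ₀}^α(L)`. -/
structure Absorbed (δ₀ R : ℝ) (α : Ordinal.{u}) (L O : Set (WeakDual 𝕜 X)) : Prop where
  isCompact : IsCompact L
  isOpen : IsOpen O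
  norm_le : ∀ f ∈ L, ‖WeakDual.toStrongDual f‖ ≤ R
  iterDeriv_subset : iterDeriv δ₀ L α ⊆ O

namespace Absorbed

variable {δ₀ R : ℝ} {α β : Ordinal.{u}} {L O : Set (WeakDual 𝕜 X)}

theorem mono (h : Absorbed δ₀ R α L O) (hαβ : α ≤ β) : Absorbed δ₀ R β L O :=
  { h with iterDeriv_subset := (iterDeriv_antitone _ _ hαβ).trans h.iterDeriv_subset }

theorem exists_lt_of_isSuccLimit (h : Absorbed δ₀ R α L O) (hα : Order.IsSuccLimit α) :
    ∃ β < α, Absorbed δ₀ R β L O := by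
  obtain ⟨β, hβ, hsub⟩ :=
    exists_iterDeriv_subset_of_limit h.isCompact h.isOpen hα h.iterDeriv_subset
  exact ⟨β, hβ, { h with iterDeriv_subset := hsub }⟩

theorem iterDeriv_left (h : Absorbed δ₀ R (α + β) L O) :
    Absorbed δ₀ R β (iterDeriv δ₀ L α) O where
  isCompact := h.isCompact.of_isClosed_subset (isClosed_iterDeriv _ h.isCompact.isClosed _)
    (Szlenk.iterDeriv_subset _ _ _)
  isOpen := h.isOpen
  norm_le f hf := h.norm_le f (Szlenk.iterDeriv_subset _ _ _ hf)
  iterDeriv_subset := (iterDeriv_add δ₀ L α β).symm.trans_subset h.iterDeriv_subset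

theorem union (h : Absorbed δ₀ R β L O) {U : Set (WeakDual 𝕜 X)} (hU : IsOpen U)
    (hsub : ∀ f ∈ iterDeriv δ₀ L α, f ∉ O → f ∈ U) : Absorbed δ₀ R α L (O ∪ U) where
  isCompact := h.isCompact
  isOpen := h.isOpen.union hU
  norm_le := h.norm_le
  iterDeriv_subset f hf := or_iff_not_imp_left.2 (hsub f hf)

theorem ne_zero_of_notMem (h : Absorbed δ₀ R α L O) {f : WeakDual 𝕜 X} (hf : f ∈ L)
    (hfO : f ∉ O) : α ≠ 0 := by
  rintro rfl
  exact hfO (h.iterDeriv_subset (by rwa [iterDeriv_zero]))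

theorem exists_mul_natCast {ζ : Ordinal.{u}} (h : Absorbed δ₀ R (ω ^ (ζ + 1)) L O) :
    ∃ j : ℕ, Absorbed δ₀ R (ω ^ ζ * j) L O := by
  obtain ⟨β, hβ, hb⟩ := h.exists_lt_of_isSuccLimit (isSuccLimit_omega0_opow (by simp))
  rw [opow_add, opow_one, lt_mul_iff_of_isSuccLimit isSuccLimit_omega0] at hβ
  obtain ⟨c, hc, hβc⟩ := hβ
  obtain ⟨j, rfl⟩ := lt_omega0.1 hc
  exact ⟨j, hb.mono hβc.le⟩

theorem exists_opow_lt {ξ : Ordinal.{u}} (hξ : Order.IsSuccLimit ξ)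
    (h : Absorbed δ₀ R (ω ^ ξ) L O) : ∃ ζ < ξ, Absorbed δ₀ R (ω ^ ζ) L O := by
  obtain ⟨β, hβ, hb⟩ := h.exists_lt_of_isSuccLimit (isSuccLimit_omega0_opow hξ.ne_bot)
  obtain ⟨ζ, hζ, hβζ⟩ := (lt_opow_of_isSuccLimit omega0_ne_zero hξ).1 hβ
  exact ⟨ζ, hζ, hb.mono hβζ.le⟩

end Absorbed

variable (𝕜 X D) in
/-- Given finitely many sets `L_i` absorbed by `O_i` after `ω^ζ` derivations, every weakly null
family on `Γ_{ζ,1}.D` has a maximal branch whose weighted sum is almost dominated by `δ₀` on all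
the sets `L_i \ O_i`. -/
def BlockProperty (δ₀ R : ℝ) (ζ : Ordinal.{u}) : Prop :=
  ∀ δ > δ₀, ∀ (ι : Type) [Finite ι] (L O : ι → Set (WeakDual 𝕜 X)),
    (∀ i, Absorbed δ₀ R (ω ^ ζ) (L i) (O i)) →
    ∀ x : List (Ordinal.{u} × D) → X, NullFamily 𝕜 (treeOne ζ) x →
      ∃ t : List (Ordinal.{u} × D), t.map Prod.fst ∈ maxNodes (treeOne ζ) ∧
        ∀ i, ∀ f ∈ L i, f ∉ O i → RCLike.re (f (weightedSum 𝕜 (coeffOne ζ) x t)) < δ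

theorem BlockProperty.exists_absorbed {δ₀ R : ℝ} {ζ : Ordinal.{u}}
    (h : BlockProperty 𝕜 X D δ₀ R ζ) {δ : ℝ} (hδ : δ₀ < δ) {ι : Type} [Finite ι]
    {L O : ι → Set (WeakDual 𝕜 X)} {J : ι → ℕ}
    (hLO : ∀ i, Absorbed δ₀ R (ω ^ ζ * J i) (L i) (O i))
    {x : List (Ordinal.{u} × D) → X} (hx : NullFamily 𝕜 (treeOne ζ) x) :
    ∃ t : List (Ordinal.{u} × D), t.map Prod.fst ∈ maxNodes (treeOne ζ) ∧
      ∀ i, Absorbed δ₀ R (ω ^ ζ * ((J i - 1 : ℕ) : Ordinal.{u})) (L i)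
        (O i ∪ {f | RCLike.re (f (weightedSum 𝕜 (coeffOne ζ) x t)) < δ}) := by
  obtain ⟨t, ht, htδ⟩ := h δ hδ ι
    (fun i => iterDeriv δ₀ (L i) (ω ^ ζ * ((J i - 1 : ℕ) : Ordinal.{u}))) O
    (fun i => ((hLO i).mono (by
      rw [← mul_add_one, ← Nat.cast_succ]
      gcongr
      omega)).iterDeriv_left) x hx
  have hopen : IsOpen {f : WeakDual 𝕜 X | RCLike.re (f (weightedSum 𝕜 (coeffOne ζ) x t)) < δ} :=
    isOpen_lt (RCLike.continuous_re.comp (WeakDual.eval_continuous _)) continuous_const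
  exact ⟨t, ht, fun i => (hLO i).union hopen (htδ i)⟩

/- Each block of a branch lowers the derivation order of the sets on which its weighted sum is at
least `δ`; so only `J i` of the `n` blocks can contribute more than `δ`, and these contribute at
most `R` each. -/
theorem BlockProperty.exists_branch {δ₀ R : ℝ} (hδ₀ : 0 ≤ δ₀) {ζ : Ordinal.{u}}
    (h : BlockProperty 𝕜 X D δ₀ R ζ) {δ : ℝ} (hδ : δ₀ < δ) (n : ℕ) :
    ∀ (ι : Type) [Finite ι] (L O : ι → Set (WeakDual 𝕜 X)) (J : ι → ℕ),
      (∀ i, Absorbed δ₀ R (ω ^ ζ * J i) (L i) (O i)) →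
      ∀ x : List (Ordinal.{u} × D) → X, NullFamily 𝕜 (tree ζ n) x →
        ∃ t : List (Ordinal.{u} × D), t.map Prod.fst ∈ branches ζ n ∧
          ∀ i, ∀ f ∈ L i, f ∉ O i →
            RCLike.re (f (weightedSum 𝕜 (coeff ζ) x t)) ≤ J i * R + n * δ := by
  induction n with
  | zero =>
    intro ι _ L O J hLO x _
    refine ⟨[], rfl, fun i f hf _ => ?_⟩
    have hR : 0 ≤ R := (norm_nonneg _).trans ((hLO i).norm_le f hf)
    simpa [weightedSum] using mul_nonneg (Nat.cast_nonneg _) hR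
  | succ n ih =>
    intro ι _ L O J hLO x hx
    have hfirst : NullFamily 𝕜 (treeOne ζ) fun s => x (shiftPairs (ω ^ ζ * n) s) :=
      hx.comp_shiftPairs fun s hs => mem_tree_succ.2 (Or.inl ⟨s, hs, rfl⟩)
    obtain ⟨t, ht, htO⟩ := h.exists_absorbed hδ hLO hfirst
    set z := weightedSum 𝕜 (coeffOne ζ) (fun s => x (shiftPairs (ω ^ ζ * n) s)) t with hz
    obtain ⟨s, hs, hsδ⟩ := ih (ι ⊕ ι) (Sum.elim L L)
      (Sum.elim O fun i => O i ∪ {f | RCLike.re (f z) < δ}) (Sum.elim J fun i => J i - 1)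
      (Sum.rec hLO htO) (fun s => x (shiftPairs (ω ^ ζ * n) t ++ s))
      (hx.comp_append fun s hs => mem_tree_succ.2 (Or.inr ⟨_, ht, s, hs, by simp⟩))
    refine ⟨shiftPairs (ω ^ ζ * n) t ++ s, ⟨_, ht, _, hs, by simp⟩, fun i f hf hfO => ?_⟩
    rw [weightedSum_coeff_append x ht hs, map_add, map_add, ← hz, Nat.cast_succ]
    rcases lt_or_ge (RCLike.re (f z)) δ with hfz | hfz
    · have hrest := hsδ (Sum.inl i) f hf hfO
      simp only [Sum.elim_inl] at hrest
      linarith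
    · have hrest := hsδ (Sum.inr i) f hf fun h => h.elim hfO hfz.not_gt
      simp only [Sum.elim_inr] at hrest
      have hJ : 1 ≤ J i := Nat.one_le_iff_ne_zero.2 fun h0 =>
        (hLO i).ne_zero_of_notMem hf hfO (by rw [h0, Nat.cast_zero, mul_zero])
      rw [Nat.cast_sub hJ, Nat.cast_one] at hrest
      have hfR := (hLO i).norm_le f hf
      have hfz' : RCLike.re (f z) ≤ R := (re_apply_le hfR z).trans
        (mul_le_of_le_one_right ((norm_nonneg _).trans hfR)
          (hfirst.norm_weightedSum_coeffOne_le ht))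
      linarith

theorem eventually_forall_re_apply_lt {δ₀ δ : ℝ} (hδ₀ : 0 ≤ δ₀) (hδ : δ₀ < δ)
    {K L : Set (WeakDual 𝕜 X)} (hK : IsCompact K) (hKL : K ⊆ L)
    (hd : ∀ f ∈ K, f ∉ deriv δ₀ L) {α : Type*} {l : Filter α} {x : α → X}
    (hx : ∀ f : StrongDual 𝕜 X, Tendsto (fun a => f (x a)) l (𝓝 0)) (hx1 : ∀ a, ‖x a‖ ≤ 1) :
    ∀ᶠ a in l, ∀ f ∈ K, RCLike.re (f (x a)) < δ := by
  suffices h : ∀ᶠ a in l, ∀ f ∈ K ∩ L, RCLike.re (f (x a)) < δ by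
    filter_upwards [h] with a ha f hf using ha f ⟨hf, hKL hf⟩
  refine hK.induction_on (p := fun S => ∀ᶠ a in l, ∀ f ∈ S ∩ L, RCLike.re (f (x a)) < δ)
    (by simp) (fun S T hST hT => ?_) (fun S T hS hT => ?_) fun y hy => ?_
  · filter_upwards [hT] with a ha f hf using ha f ⟨hST hf.1, hf.2⟩
  · filter_upwards [hS, hT] with a ha hb f hf
    exact hf.1.elim (fun h => ha f ⟨h, hf.2⟩) fun h => hb f ⟨h, hf.2⟩
  · obtain ⟨V, hV, hVd⟩ := exists_nhds_of_notMem_deriv hδ₀ (hKL hy) (hd y hy)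
    refine ⟨V, mem_nhdsWithin_of_mem_nhds hV, ?_⟩
    have hre : Tendsto (fun a => RCLike.re (y (x a))) l (𝓝 0) := by
      simpa [Function.comp_def] using
        (RCLike.continuous_re.tendsto _).comp (hx (WeakDual.toStrongDual y))
    filter_upwards [hre.eventually_lt_const (sub_pos.2 hδ)] with a ha f hf
    have hfy : RCLike.re ((f - y) (x a)) ≤ δ₀ :=
      (re_apply_le (hVd f hf y ⟨mem_of_mem_nhds hV, hKL hy⟩) (x a)).trans
        (mul_le_of_le_one_right hδ₀ (hx1 a))
    have hsub : RCLike.re ((f - y) (x a)) = RCLike.re (f (x a)) - RCLike.re (y (x a)) := by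
      rw [← map_sub]
      rfl
    linarith

theorem blockProperty_zero [IsDirectedOrder D] [Nonempty D] {δ₀ : ℝ} (hδ₀ : 0 ≤ δ₀) (R : ℝ) :
    BlockProperty 𝕜 X D δ₀ R 0 := by
  intro δ hδ ι _ L O hLO x hx
  have hsmall : ∀ i, ∀ᶠ a : D in atTop, ∀ f ∈ L i \ O i, RCLike.re (f (x [(0, a)])) < δ :=
    fun i => eventually_forall_re_apply_lt hδ₀ hδ ((hLO i).isCompact.diff (hLO i).isOpen)
      Set.sdiff_subset
      (fun f hf hd => hf.2 ((hLO i).iterDeriv_subset (by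
        rw [opow_zero, ← zero_add (1 : Ordinal.{u}), iterDeriv_add_one, iterDeriv_zero]
        exact hd)))
      (fun f => hx.tendsto [] 0 (by simp [treeOne_zero]) f)
      fun a => hx.norm_le _ (by simp [treeOne_zero])
  obtain ⟨a, ha⟩ := (eventually_all.2 hsmall).exists
  refine ⟨[(0, a)], ?_, fun i f hf hfO => ?_⟩
  · rw [treeOne_zero]
    exact ⟨rfl, fun s hs _ => hs⟩
  · have hsum : weightedSum 𝕜 (coeffOne 0) x [(0, a)] = x [(0, a)] := by
      simp [weightedSum, coeffOne_zero]
    rw [hsum]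
    exact ha i f ⟨hf, hfO⟩

theorem BlockProperty.add_one {δ₀ R : ℝ} (hδ₀ : 0 ≤ δ₀) {ζ : Ordinal.{u}}
    (h : BlockProperty 𝕜 X D δ₀ R ζ) :
    BlockProperty 𝕜 X D δ₀ R (ζ + 1) := by
  intro δ hδ ι _ L O hLO x hx
  cases nonempty_fintype ι
  choose J hJ using fun i => (hLO i).exists_mul_natCast
  set j := Finset.univ.sup J
  have hj : ∀ i, Absorbed δ₀ R (ω ^ ζ * j) (L i) (O i) := fun i => (hJ i).mono (by
    gcongr
    exact Finset.le_sup (Finset.mem_univ i))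
  obtain ⟨δ', hδ', hδ'δ⟩ := exists_between hδ
  obtain ⟨n, hn⟩ := exists_nat_gt (j * R / (δ - δ'))
  rw [div_lt_iff₀ (sub_pos.2 hδ'δ)] at hn
  obtain ⟨t, ht, htb⟩ := h.exists_branch hδ₀ hδ' (n + 1) ι L O (fun _ => j) hj x
    (hx.mono fun l hl => mem_treeOne_add_one.2 ⟨n, hl⟩)
  refine ⟨t, mem_maxNodes_treeOne_add_one.2 ⟨n, ht⟩, fun i f hf hfO => ?_⟩
  rw [weightedSum_coeffOne_add_one x ht, map_smul, _root_.smul_eq_mul, RCLike.re_ofReal_mul,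
    inv_mul_lt_iff₀ (by positivity)]
  refine (htb i f hf hfO).trans_lt ?_
  push_cast
  linarith

theorem blockProperty_of_isSuccLimit {δ₀ R : ℝ} {ξ : Ordinal.{u}} (hξ : Order.IsSuccLimit ξ)
    (h : ∀ ζ < ξ, BlockProperty 𝕜 X D δ₀ R ζ) : BlockProperty 𝕜 X D δ₀ R ξ := by
  intro δ hδ ι _ L O hLO x hx
  cases nonempty_fintype ι
  choose Z hZ hZLO using fun i => (hLO i).exists_opow_lt hξ
  set ζ := Finset.univ.sup Z
  have hζ : ζ < ξ := (Finset.sup_lt_iff hξ.bot_lt).2 fun i _ => hZ i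
  have hζLO : ∀ i, Absorbed δ₀ R (ω ^ (ζ + 1)) (L i) (O i) := fun i =>
    (hZLO i).mono (opow_le_opow_right omega0_pos
      ((Finset.le_sup (f := Z) (Finset.mem_univ i)).trans le_self_add))
  obtain ⟨t, ht, htb⟩ := h (ζ + 1) (hξ.add_one_lt hζ) δ hδ ι L O hζLO
    (fun s => x (shiftPairs (ω ^ ζ) s))
    (hx.comp_shiftPairs fun s hs => (mem_treeOne_limit hξ).2 ⟨ζ, hζ, s, hs, rfl⟩)
  refine ⟨shiftPairs (ω ^ ζ) t, ?_, fun i f hf hfO => ?_⟩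
  · rw [map_fst_shiftPairs]
    exact (mem_maxNodes_treeOne_limit hξ).2 ⟨ζ, hζ, _, ht, rfl⟩
  · rw [weightedSum_coeffOne_limit hξ hζ x ht.1]
    exact htb i f hf hfO

theorem blockProperty [IsDirectedOrder D] [Nonempty D] {δ₀ : ℝ} (hδ₀ : 0 ≤ δ₀) (R : ℝ)
    (ζ : Ordinal.{u}) : BlockProperty 𝕜 X D δ₀ R ζ := by
  induction ζ using Ordinal.limitRecOn with
  | zero => exact blockProperty_zero hδ₀ R
  | add_one ζ ih => exact ih.add_one hδ₀
  | limit ξ hξ ih => exact blockProperty_of_isSuccLimit hξ ih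

end UpperTheta

section Theta

open Ordinal

variable {𝕜 : Type*} [RCLike 𝕜] {X : Type u} [NormedAddCommGroup X] [NormedSpace 𝕜 X]
  {Y : Type v} [NormedAddCommGroup Y] [NormedSpace 𝕜 Y]

theorem bddAbove_re_image_dualBallImage (A : X →L[𝕜] Y) (x : X) :
    BddAbove ((fun f : WeakDual 𝕜 X => RCLike.re (f x)) '' dualBallImage A) := by
  refine ⟨‖A‖ * ‖x‖, ?_⟩
  rintro _ ⟨f, hf, rfl⟩
  exact re_apply_le (norm_le_of_mem_dualBallImage hf) x

theorem re_apply_le_supportFun {A : X →L[𝕜] Y} {f : WeakDual 𝕜 X} (hf : f ∈ dualBallImage A)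
    (x : X) : RCLike.re (f x) ≤ supportFun (dualBallImage A) x :=
  le_csSup (bddAbove_re_image_dualBallImage A x) ⟨f, hf, rfl⟩

theorem supportFun_le {A : X →L[𝕜] Y} {x : X} {c : ℝ}
    (h : ∀ f ∈ dualBallImage A, RCLike.re (f x) ≤ c) : supportFun (dualBallImage A) x ≤ c := by
  refine csSup_le (Set.Nonempty.image _ ⟨0, zero_mem_dualBallImage A⟩) ?_
  rintro _ ⟨f, hf, rfl⟩
  exact h f hf

theorem supportFun_nonneg (A : X →L[𝕜] Y) (x : X) : 0 ≤ supportFun (dualBallImage A) x := by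
  have h := re_apply_le_supportFun (zero_mem_dualBallImage A) x
  have h0 : (0 : WeakDual 𝕜 X) x = 0 := rfl
  rwa [h0, map_zero] at h

theorem mem_maxNodes_treeD_iff {D : Type u} [Nonempty D] {ζ : Ordinal.{u}} {n : ℕ}
    {t : List (Ordinal.{u} × D)} :
    t ∈ maxNodes (treeD ζ n D) ↔ t.map Prod.fst ∈ maxNodes (tree ζ n) := by
  constructor
  · rintro ⟨ht, hmax⟩
    refine ⟨ht, ?_⟩
    rintro s hs ⟨r, rfl⟩
    obtain ⟨d⟩ := ‹Nonempty D›
    have hmap : (t ++ r.map fun ζ => (ζ, d)).map Prod.fst = t.map Prod.fst ++ r := by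
      simp [Function.comp_def]
    have := hmax (t ++ r.map fun ζ => (ζ, d)) (by
      change _ ∈ tree ζ n
      rwa [hmap]) (List.prefix_append _ _)
    rw [← hmap, this]
  · rintro ⟨ht, hmax⟩
    refine ⟨ht, fun s hs hp => ?_⟩
    have := congrArg List.length (hmax _ hs (hp.map _))
    simp only [List.length_map] at this
    exact (hp.eq_of_length this.symm).symm

variable (𝕜) in
theorem one_div_natCast_eq_ofReal (n : ℕ) : (1 / (n : 𝕜)) = (((n : ℝ)⁻¹ : ℝ) : 𝕜) := by
  rw [RCLike.ofReal_inv, RCLike.ofReal_natCast, one_div]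

theorem opTheta_nonneg (ζ : Ordinal.{u}) (n : ℕ) (A : X →L[𝕜] Y) : 0 ≤ opTheta ζ n A :=
  Real.sInf_nonneg fun _ h => h.1.le

theorem opTheta_le {A : X →L[𝕜] Y} {R δ₀ δ η : ℝ} (hA : ‖A‖ ≤ R) (hδ₀ : 0 ≤ δ₀) (hδ : δ₀ < δ)
    {ζ : Ordinal.{u}} {m n : ℕ} (hm : iterDeriv δ₀ (dualBallImage A) (ω ^ ζ * m) = ∅)
    (hη : 0 < η) (hn : m * R + (n + 1) * δ ≤ (n + 1) * η) : opTheta ζ (n + 1) A ≤ η := by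
  refine csInf_le ⟨0, fun _ h => h.1.le⟩ ⟨hη, fun D _ _ _ x hx hx1 => ?_⟩
  have hnull : NullFamily 𝕜 (tree ζ (n + 1)) x :=
    ⟨fun t ζ' ht => hx t ζ' fun a => by
      change _ ∈ tree _ _
      simpa using ht, hx1⟩
  have habsorbed : Absorbed δ₀ R (ω ^ ζ * m) (dualBallImage A) ∅ :=
    ⟨isCompact_dualBallImage A, isOpen_empty,
      fun _ hf => (norm_le_of_mem_dualBallImage hf).trans hA, hm.subset⟩
  obtain ⟨t, ht, htη⟩ := (blockProperty hδ₀ R ζ).exists_branch hδ₀ hδ (n + 1) Unit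
    (fun _ => dualBallImage A) (fun _ => ∅) (fun _ => m) (fun _ => habsorbed) x hnull
  rw [branches_add_one_eq, ← mem_maxNodes_treeD_iff] at ht
  refine (ciInf_le ⟨0, ?_⟩ ⟨t, ht⟩).trans (supportFun_le fun f hf => ?_)
  · rintro _ ⟨s, rfl⟩
    exact supportFun_nonneg A _
  · have hbound := htη () f hf (Set.notMem_empty f)
    rw [map_smul, _root_.smul_eq_mul, one_div_natCast_eq_ofReal, RCLike.re_ofReal_mul,
      inv_mul_le_iff₀ (by positivity)]
    push_cast at hbound ⊢
    exact hbound.trans hn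

end Theta

/-! ### Lower estimates for `θ_{ζ,n}` -/

theorem exists_mem_frequently_dist_lt {α E : Type*} [PseudoMetricSpace E] {l : Filter α}
    {S : Set α} (hS : ∃ᶠ z in l, z ∈ S) {T : α → E} (hT : TotallyBounded (T '' S)) {τ : ℝ}
    (hτ : 0 < τ) : ∃ u ∈ S, ∃ᶠ z in l, z ∈ S ∧ dist (T z) (T u) < τ := by
  obtain ⟨C, hCS, hC, hcover⟩ := Metric.finite_approx_of_totallyBounded hT τ hτ
  by_contra! h
  have hfar : ∀ᶠ z in l, ∀ c ∈ C, ¬(z ∈ S ∧ dist (T z) c < τ) := by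
    refine (eventually_all_finite hC).2 fun c hc => ?_
    obtain ⟨u, hu, rfl⟩ := hCS hc
    simpa using h u hu
  obtain ⟨z, hzS, hz⟩ := (hS.and_eventually hfar).exists
  obtain ⟨c, hc, hzc⟩ := Set.mem_iUnion₂.1 (hcover ⟨z, hzS, rfl⟩)
  exact hz c hc ⟨hzS, hzc⟩

section LargeVectors

variable {𝕜 : Type*} [RCLike 𝕜] {X : Type u} [NormedAddCommGroup X] [NormedSpace 𝕜 X]

theorem mem_closure_of_mem_deriv {ε : ℝ} (hε : 0 ≤ ε) {L : Set (WeakDual 𝕜 X)}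
    {y : WeakDual 𝕜 X} (hy : y ∈ deriv ε L) :
    y ∈ closure {z | z ∈ L ∧ ε / 2 < ‖WeakDual.toStrongDual (z - y)‖} := by
  refine mem_closure_iff_nhds.2 fun V hV => ?_
  obtain ⟨g, hg, h, hh, hlt⟩ := ((mem_deriv_iff hε).1 hy).2 V hV
  by_contra hempty
  have hclose : ∀ k ∈ V ∩ L, ‖WeakDual.toStrongDual (k - y)‖ ≤ ε / 2 := fun k hk => by
    by_contra! hk'
    exact hempty ⟨k, hk.1, hk.2, hk'⟩
  have htriangle := norm_sub_le (WeakDual.toStrongDual (g - y)) (WeakDual.toStrongDual (h - y))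
  rw [← map_sub, sub_sub_sub_cancel_right] at htriangle
  linarith [hclose g hg, hclose h hh]

theorem norm_half_smul_sub_le (a b : X) :
    ‖((1 / 2 : ℝ) : 𝕜) • (a - b)‖ ≤ (‖a‖ + ‖b‖) / 2 := by
  rw [norm_smul, RCLike.norm_ofReal, abs_of_pos (by norm_num)]
  linarith [norm_sub_le a b]

theorem norm_apply_half_smul_sub (f : StrongDual 𝕜 X) (a b : X) :
    ‖f (((1 / 2 : ℝ) : 𝕜) • (a - b))‖ = ‖f a - f b‖ / 2 := by
  rw [map_smul, map_sub, norm_smul, RCLike.norm_ofReal, abs_of_pos (by norm_num)]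
  ring

theorem lt_re_apply_half_smul_sub {ε : ℝ} {y z : WeakDual 𝕜 X} {a b : X}
    (ha : ε / 2 < RCLike.re (z a - y a)) (hb : ‖z b - y b‖ < ε / 20)
    (hab : ‖y a - y b‖ < ε / 20) :
    ε / 5 < RCLike.re (z (((1 / 2 : ℝ) : 𝕜) • (a - b))) := by
  have hsplit : RCLike.re (z (((1 / 2 : ℝ) : 𝕜) • (a - b))) =
      (RCLike.re (z a - y a) - RCLike.re (z b - y b) + RCLike.re (y a - y b)) / 2 := by
    rw [map_smul, map_sub, smul_eq_mul, RCLike.re_ofReal_mul]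
    simp only [map_sub]
    ring
  have hb' := (RCLike.re_le_norm _).trans hb.le
  have hab' := (abs_le.1 ((RCLike.abs_re_le_norm _).trans hab.le)).1
  rw [hsplit]
  linarith

theorem totallyBounded_image_apply {S : Set (WeakDual 𝕜 X)} {x : WeakDual 𝕜 X → X}
    (hx : ∀ z ∈ S, ‖x z‖ ≤ 1) (G : Finset (StrongDual 𝕜 X)) :
    TotallyBounded ((fun z (f : G) => f.1 (x z)) '' S) := by
  refine (isCompact_closedBall (0 : G → 𝕜) (∑ f ∈ G, ‖f‖)).totallyBounded.subset ?_
  rintro _ ⟨z, hz, rfl⟩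
  rw [mem_closedBall_zero_iff,
    pi_norm_le_iff_of_nonneg (Finset.sum_nonneg fun f _ => norm_nonneg f)]
  exact fun f => (f.1.unit_le_opNorm _ (hx z hz)).trans
    (Finset.single_le_sum (f := fun f : StrongDual 𝕜 X => ‖f‖) (fun f _ => norm_nonneg f) f.2)

/- Functionals `z` near `y` at distance more than `ε / 2` from `y` are large on vectors `x z`, and
by pigeonhole there are two of them, `z` and `u`, whose vectors are almost indistinguishable for
`y` and the functionals in `F`, with `z` moreover so close to `y` that `z - y` is small at `x u`.
Half of `x z - x u` is the required vector. -/
theorem exists_mem_and_lt_re {ε : ℝ} (hε : 0 < ε) {L : Set (WeakDual 𝕜 X)} {y : WeakDual 𝕜 X}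
    (hy : y ∈ deriv ε L) {U : Set (WeakDual 𝕜 X)} (hU : U ∈ 𝓝 y) (F : Finset (StrongDual 𝕜 X))
    {η : ℝ} (hη : 0 < η) :
    ∃ z ∈ L ∩ U, ∃ x : X, ‖x‖ ≤ 1 ∧ (∀ f ∈ F, ‖f x‖ < η) ∧ ε / 5 < RCLike.re (z x) := by
  classical
  set S : Set (WeakDual 𝕜 X) := {z | z ∈ L ∧ ε / 2 < ‖WeakDual.toStrongDual (z - y)‖}
  have hS : ∃ᶠ z in 𝓝 y, z ∈ S := mem_closure_iff_frequently.1 (mem_closure_of_mem_deriv hε.le hy)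
  have hvec : ∀ z ∈ S, ∃ x : X, ‖x‖ ≤ 1 ∧ ε / 2 < RCLike.re (WeakDual.toStrongDual (z - y) x) :=
    fun z hz => exists_lt_re_apply_of_lt_norm _ hz.2
  choose! x hx_norm hx_re using hvec
  set G : Finset (StrongDual 𝕜 X) := insert (WeakDual.toStrongDual y) F
  set τ := min η (ε / 20)
  have hτ : 0 < τ := by positivity
  obtain ⟨u, huS, hu⟩ := exists_mem_frequently_dist_lt hS
    (totallyBounded_image_apply hx_norm G) hτ
  have hnear : ∀ᶠ z in 𝓝 y, ‖z (x u) - y (x u)‖ < τ := by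
    filter_upwards [(WeakDual.eval_continuous (𝕜 := 𝕜) (x u)).tendsto y
      (Metric.ball_mem_nhds _ hτ)] with z hz
    simpa [dist_eq_norm] using hz
  obtain ⟨z, ⟨hzS, hzT⟩, hzu, hzU⟩ := (hu.and_eventually (hnear.and hU)).exists
  have hG : ∀ f ∈ G, ‖f (x z) - f (x u)‖ < τ := fun f hf => by
    rw [← dist_eq_norm]
    exact (dist_le_pi_dist (fun f : G => f.1 (x z)) _ ⟨f, hf⟩).trans_lt hzT
  refine ⟨z, ⟨hzS.1, hzU⟩, ((1 / 2 : ℝ) : 𝕜) • (x z - x u), ?_, fun f hf => ?_, ?_⟩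
  · linarith [norm_half_smul_sub_le (𝕜 := 𝕜) (x z) (x u), hx_norm z hzS, hx_norm u huS]
  · rw [norm_apply_half_smul_sub]
    linarith [hG f (Finset.mem_insert_of_mem hf), norm_nonneg (f (x z) - f (x u)),
      min_le_left η (ε / 20)]
  · exact lt_re_apply_half_smul_sub (hx_re z hzS) (hzu.trans_le (min_le_right _ _))
      ((hG _ (Finset.mem_insert_self _ _)).trans_le (min_le_right _ _))

end LargeVectors

section WeakNeighborhoods

variable {𝕜 : Type*} [RCLike 𝕜] {X : Type u} [NormedAddCommGroup X] [NormedSpace 𝕜 X]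

variable (𝕜 X) in
/-- Basic weak neighbourhoods of `0`, ordered by reverse inclusion: the directed set over which the
weakly null trees witnessing the lower estimates are indexed. -/
abbrev WeakNhds : Type u :=
  {W : Set X // ∃ (F : Finset (StrongDual 𝕜 X)) (η : ℝ), 0 < η ∧ W = {x | ∀ f ∈ F, ‖f x‖ < η}}ᵒᵈ

instance : Nonempty (WeakNhds 𝕜 X) := ⟨OrderDual.toDual ⟨_, ∅, 1, one_pos, rfl⟩⟩

instance : IsDirectedOrder (WeakNhds 𝕜 X) := ⟨by
  classical
  rintro ⟨_, F, η, hη, rfl⟩ ⟨_, F', η', hη', rfl⟩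
  refine ⟨OrderDual.toDual ⟨_, F ∪ F', min η η', lt_min hη hη', rfl⟩, ?_, ?_⟩
  · exact fun x hx f hf => (hx f (Finset.mem_union_left _ hf)).trans_le (min_le_left _ _)
  · exact fun x hx f hf => (hx f (Finset.mem_union_right _ hf)).trans_le (min_le_right _ _)⟩

theorem tendsto_of_mem_weakNhds {x : WeakNhds 𝕜 X → X} (hx : ∀ W, x W ∈ (OrderDual.ofDual W).1)
    (f : StrongDual 𝕜 X) : Tendsto (fun W => f (x W)) atTop (𝓝 0) := by
  refine Metric.tendsto_nhds.2 fun η hη => ?_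
  filter_upwards [eventually_ge_atTop
    (OrderDual.toDual ⟨_, {f}, η, hη, rfl⟩ : WeakNhds 𝕜 X)] with W hW
  rw [dist_zero_right]
  exact hW (hx W) f (Finset.mem_singleton_self f)

/-- Strictly decreasing sequences of ordinals below `α`. -/
def DecreasingBelow (α : Ordinal.{u}) (l : List Ordinal.{u}) : Prop :=
  l.Pairwise (· > ·) ∧ ∀ a ∈ l, a < α

theorem decreasingBelow_concat {α γ : Ordinal.{u}} {l : List Ordinal.{u}} :
    DecreasingBelow α (l ++ [γ]) ↔ DecreasingBelow α l ∧ γ < α ∧ ∀ a ∈ l, γ < a := by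
  simp only [DecreasingBelow, List.pairwise_append, List.mem_append, List.mem_singleton,
    List.pairwise_singleton]
  grind

/-- The functional `p.1 ∈ s_ε^{a.1}(K)` and the vector `p.2` in the weak neighbourhood `a.2` extend
the state `s`, which consists of a functional and the vectors on which it is large. -/
structure Extends (ε : ℝ) (K : Set (WeakDual 𝕜 X)) (s : WeakDual 𝕜 X × List X)
    (a : Ordinal.{u} × WeakNhds 𝕜 X) (p : WeakDual 𝕜 X × X) : Prop where
  mem_iterDeriv : p.1 ∈ iterDeriv ε K a.1
  lt_re : ∀ b ∈ p.2 :: s.2, ε / 5 < RCLike.re (p.1 b)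
  norm_le : ‖p.2‖ ≤ 1
  mem_nhds : p.2 ∈ (OrderDual.ofDual a.2).1

theorem exists_extends {ε : ℝ} (hε : 0 < ε) {K : Set (WeakDual 𝕜 X)}
    {s : WeakDual 𝕜 X × List X} {a : Ordinal.{u} × WeakNhds 𝕜 X}
    (hs : s.1 ∈ iterDeriv ε K (a.1 + 1)) (hlarge : ∀ b ∈ s.2, ε / 5 < RCLike.re (s.1 b)) :
    ∃ p, Extends ε K s a p := by
  have hU : {z : WeakDual 𝕜 X | ∀ b ∈ s.2, ε / 5 < RCLike.re (z b)} ∈ 𝓝 s.1 :=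
    (eventually_all_finite (List.finite_toSet s.2)).2 fun b hb =>
      ((RCLike.continuous_re.comp (WeakDual.eval_continuous b)).tendsto _).eventually_const_lt
        (hlarge b hb)
  rw [iterDeriv_add_one] at hs
  obtain ⟨F, η, hη, hW⟩ := (OrderDual.ofDual a.2).2
  obtain ⟨z, ⟨hz, hzU⟩, x, hx, hxF, hzx⟩ := exists_mem_and_lt_re hε hs hU F hη
  exact ⟨(z, x), hz, List.forall_mem_cons.2 ⟨hzx, hzU⟩, hx, by rw [hW]; exact hxF⟩

open Classical in
/-- A chosen extension of the state `s`, or `s` itself if it cannot be extended. -/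
noncomputable def nextState (ε : ℝ) (K : Set (WeakDual 𝕜 X)) (s : WeakDual 𝕜 X × List X)
    (a : Ordinal.{u} × WeakNhds 𝕜 X) : WeakDual 𝕜 X × List X :=
  if h : ∃ p, Extends ε K s a p then (h.choose.1, h.choose.2 :: s.2) else s

theorem nextState_spec {ε : ℝ} {K : Set (WeakDual 𝕜 X)} {s : WeakDual 𝕜 X × List X}
    {a : Ordinal.{u} × WeakNhds 𝕜 X} (h : ∃ p, Extends ε K s a p) :
    ∃ p, Extends ε K s a p ∧ nextState ε K s a = (p.1, p.2 :: s.2) :=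
  ⟨h.choose, h.choose_spec, dif_pos h⟩

/-- The state reached from the functional `y₀` along the branch `l`. -/
noncomputable def branchState (ε : ℝ) (K : Set (WeakDual 𝕜 X)) (y₀ : WeakDual 𝕜 X)
    (l : List (Ordinal.{u} × WeakNhds 𝕜 X)) : WeakDual 𝕜 X × List X :=
  l.foldl (nextState ε K) (y₀, [])

theorem branchState_concat (ε : ℝ) (K : Set (WeakDual 𝕜 X)) (y₀ : WeakDual 𝕜 X)
    (l : List (Ordinal.{u} × WeakNhds 𝕜 X)) (a : Ordinal.{u} × WeakNhds 𝕜 X) :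
    branchState ε K y₀ (l ++ [a]) = nextState ε K (branchState ε K y₀ l) a := by
  simp [branchState]

/-- The vector at the node `l` of the tree: the last one chosen along the branch `l`. -/
noncomputable def branchVector (ε : ℝ) (K : Set (WeakDual 𝕜 X)) (y₀ : WeakDual 𝕜 X)
    (l : List (Ordinal.{u} × WeakNhds 𝕜 X)) : X :=
  (branchState ε K y₀ l).2.headD 0

section Branches

variable {ε : ℝ} {K : Set (WeakDual 𝕜 X)} {α : Ordinal.{u}} {y₀ : WeakDual 𝕜 X}
  {l : List (Ordinal.{u} × WeakNhds 𝕜 X)} {a : Ordinal.{u} × WeakNhds 𝕜 X}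

theorem branchState_spec (hε : 0 < ε) (hy₀ : y₀ ∈ iterDeriv ε K α)
    (l : List (Ordinal.{u} × WeakNhds 𝕜 X)) (hl : DecreasingBelow α (l.map Prod.fst)) :
    (branchState ε K y₀ l).1 ∈ K ∧
      (∀ γ, DecreasingBelow α (l.map Prod.fst ++ [γ]) →
        (branchState ε K y₀ l).1 ∈ iterDeriv ε K (γ + 1)) ∧
      ∀ b ∈ (branchState ε K y₀ l).2, ε / 5 < RCLike.re ((branchState ε K y₀ l).1 b) := by
  induction l using List.reverseRecOn with
  | nil =>
    refine ⟨iterDeriv_subset _ _ _ hy₀, fun γ hγ => ?_, by simp [branchState]⟩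
    exact iterDeriv_antitone _ _ (Order.add_one_le_of_lt (decreasingBelow_concat.1 hγ).2.1) hy₀
  | append_singleton l a ih =>
    rw [List.map_append, List.map_singleton] at hl ⊢
    obtain ⟨-, hder, hlarge⟩ := ih (decreasingBelow_concat.1 hl).1
    obtain ⟨p, hp, hnext⟩ := nextState_spec (exists_extends hε (hder _ hl) hlarge)
    rw [branchState_concat, hnext]
    refine ⟨iterDeriv_subset _ _ _ hp.mem_iterDeriv, fun γ hγ => ?_, hp.lt_re⟩
    exact iterDeriv_antitone _ _ (Order.add_one_le_of_lt
      ((decreasingBelow_concat.1 hγ).2.2 _ (by simp))) hp.mem_iterDeriv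

theorem exists_extends_branchState_concat (hε : 0 < ε) (hy₀ : y₀ ∈ iterDeriv ε K α)
    (hl : DecreasingBelow α ((l ++ [a]).map Prod.fst)) :
    ∃ p, Extends ε K (branchState ε K y₀ l) a p ∧
      branchState ε K y₀ (l ++ [a]) = (p.1, p.2 :: (branchState ε K y₀ l).2) := by
  rw [List.map_append, List.map_singleton] at hl
  obtain ⟨-, hder, hlarge⟩ := branchState_spec hε hy₀ l (decreasingBelow_concat.1 hl).1
  rw [branchState_concat]
  exact nextState_spec (exists_extends hε (hder _ hl) hlarge)

theorem branchVector_concat_mem (hε : 0 < ε) (hy₀ : y₀ ∈ iterDeriv ε K α)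
    (hl : DecreasingBelow α ((l ++ [a]).map Prod.fst)) :
    ‖branchVector ε K y₀ (l ++ [a])‖ ≤ 1 ∧
      branchVector ε K y₀ (l ++ [a]) ∈ (OrderDual.ofDual a.2).1 := by
  obtain ⟨p, hp, hstate⟩ := exists_extends_branchState_concat hε hy₀ hl
  rw [branchVector, hstate]
  exact ⟨hp.norm_le, hp.mem_nhds⟩

theorem branchVector_mem_branchState (hε : 0 < ε) (hy₀ : y₀ ∈ iterDeriv ε K α)
    (hl : DecreasingBelow α (l.map Prod.fst)) {r : List (Ordinal.{u} × WeakNhds 𝕜 X)}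
    (hr : r ≠ []) (hrl : r <+: l) :
    branchVector ε K y₀ r ∈ (branchState ε K y₀ l).2 := by
  induction l using List.reverseRecOn with
  | nil => exact absurd (List.prefix_nil.1 hrl) hr
  | append_singleton l a ih =>
    obtain ⟨p, -, hstate⟩ := exists_extends_branchState_concat hε hy₀ hl
    rcases List.prefix_concat_iff.1 hrl with rfl | hrl
    · simp [branchVector, hstate]
    · rw [List.map_append, List.map_singleton] at hl
      rw [hstate]
      exact List.mem_cons_of_mem _ (ih (decreasingBelow_concat.1 hl).1 hrl)

end Branches

theorem exists_decreasing_tree {ε : ℝ} (hε : 0 < ε) {K : Set (WeakDual 𝕜 X)} {α : Ordinal.{u}}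
    (hne : (iterDeriv ε K α).Nonempty) :
    ∃ x : List (Ordinal.{u} × WeakNhds 𝕜 X) → X,
      (∀ l ζ W, DecreasingBelow α ((l ++ [(ζ, W)]).map Prod.fst) →
        ‖x (l ++ [(ζ, W)])‖ ≤ 1 ∧ x (l ++ [(ζ, W)]) ∈ (OrderDual.ofDual W).1) ∧
      ∀ l, DecreasingBelow α (l.map Prod.fst) →
        ∃ y ∈ K, ∀ r, r ≠ [] → r <+: l → ε / 5 < RCLike.re (y (x r)) := by
  obtain ⟨y₀, hy₀⟩ := hne
  refine ⟨branchVector ε K y₀, fun l ζ W => branchVector_concat_mem hε hy₀, fun l hl => ?_⟩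
  obtain ⟨hK, -, hlarge⟩ := branchState_spec hε hy₀ l hl
  exact ⟨_, hK, fun r hr hrl => hlarge _ (branchVector_mem_branchState hε hy₀ hl hr hrl)⟩

end WeakNeighborhoods

section LowerTheta

open Ordinal

theorem maxNodes_treeOne_nonempty (ζ : Ordinal.{u}) : (maxNodes (treeOne ζ)).Nonempty := by
  induction ζ using Ordinal.limitRecOn with
  | zero =>
    rw [treeOne_zero]
    refine ⟨[0], by simp, fun s hs _ => ?_⟩
    simpa using hs
  | add_one ζ ih =>
    obtain ⟨t, ht⟩ := ih
    exact ⟨_, mem_maxNodes_treeOne_add_one.2 ⟨0, t, ht, [], rfl, rfl⟩⟩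
  | limit ξ hξ ih =>
    obtain ⟨t, ht⟩ := ih (0 + 1) (hξ.add_one_lt hξ.bot_lt)
    exact ⟨_, (mem_maxNodes_treeOne_limit hξ).2 ⟨0, hξ.bot_lt, t, ht, rfl⟩⟩

theorem branches_nonempty (ζ : Ordinal.{u}) (n : ℕ) : (branches ζ n).Nonempty := by
  induction n with
  | zero => exact ⟨[], rfl⟩
  | succ n ih =>
    obtain ⟨s, hs⟩ := ih
    obtain ⟨t, ht⟩ := maxNodes_treeOne_nonempty ζ
    exact ⟨_, t, ht, s, hs, rfl⟩

variable {𝕜 : Type*} [RCLike 𝕜] {X : Type u} [NormedAddCommGroup X] [NormedSpace 𝕜 X]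
  {Y : Type v} [NormedAddCommGroup Y] [NormedSpace 𝕜 Y]

theorem nonempty_maxNodes_treeD (D : Type u) [Nonempty D] (ζ : Ordinal.{u}) (n : ℕ) :
    Nonempty (maxNodes (treeD ζ (n + 1) D)) := by
  obtain ⟨t, ht⟩ := branches_nonempty ζ (n + 1)
  obtain ⟨d⟩ := ‹Nonempty D›
  refine ⟨⟨t.map fun ζ => (ζ, d), ?_⟩⟩
  have : Nonempty D := ⟨d⟩
  rw [mem_maxNodes_treeD_iff, ← branches_add_one_eq]
  simpa [Function.comp_def] using ht

/-- The set whose infimum is `θ_{ζ,n}(K)`. -/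
def thetaBounds (ζ : Ordinal.{u}) (n : ℕ) (K : Set (WeakDual 𝕜 X)) : Set ℝ :=
  {θ : ℝ | 0 < θ ∧ ∀ (D : Type u) [Preorder D] [IsDirectedOrder D] [Nonempty D]
    (x : List (Ordinal.{u} × D) → X), WeaklyNull 𝕜 ζ n D x → (∀ t ∈ treeD ζ n D, ‖x t‖ ≤ 1) →
    ⨅ t : maxNodes (treeD ζ n D), supportFun K ((1 / (n : 𝕜)) • branchSum 𝕜 ζ x t) ≤ θ}

theorem norm_inv_smul_branchSum_le {D : Type u} {ζ : Ordinal.{u}} {n : ℕ}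
    {x : List (Ordinal.{u} × D) → X} (hx : ∀ t ∈ treeD ζ (n + 1) D, ‖x t‖ ≤ 1)
    {t : List (Ordinal.{u} × D)} (ht : t.map Prod.fst ∈ maxNodes (tree ζ (n + 1))) :
    ‖(1 / ((n + 1 : ℕ) : 𝕜)) • branchSum 𝕜 ζ x t‖ ≤ 1 := by
  have hsum : ‖branchSum 𝕜 ζ x t‖ ≤ ((n + 1 : ℕ) : ℝ) := by
    rw [← prefixSum_coeff (branches_add_one_eq ζ n ▸ ht)]
    exact norm_weightedSum_le (coeff_nonneg ζ) fun s hs hp =>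
      hx s (mem_tree_of_prefix ht.1 (by simpa using hs) (hp.map _))
  rw [norm_smul, norm_div, norm_one, RCLike.norm_natCast, one_div]
  exact inv_mul_le_one_of_le₀ hsum (Nat.cast_nonneg _)

theorem norm_add_one_mem_thetaBounds (ζ : Ordinal.{u}) (n : ℕ) (A : X →L[𝕜] Y) :
    ‖A‖ + 1 ∈ thetaBounds ζ (n + 1) (dualBallImage A) := by
  refine ⟨by positivity, fun D _ _ _ x _ hx => ?_⟩
  obtain ⟨t⟩ := nonempty_maxNodes_treeD D ζ n
  refine (ciInf_le ⟨0, ?_⟩ t).trans (supportFun_le fun f hf => ?_)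
  · rintro _ ⟨s, rfl⟩
    exact supportFun_nonneg A _
  · have hnorm := norm_inv_smul_branchSum_le (𝕜 := 𝕜) hx (mem_maxNodes_treeD_iff.1 t.2)
    exact (re_apply_le (norm_le_of_mem_dualBallImage hf) _).trans
      ((mul_le_of_le_one_right (norm_nonneg A) hnorm).trans (by linarith))

theorem opTheta_le_norm_add_one (ζ : Ordinal.{u}) (n : ℕ) (A : X →L[𝕜] Y) :
    opTheta ζ (n + 1) A ≤ ‖A‖ + 1 :=
  csInf_le ⟨0, fun _ h => h.1.le⟩ (norm_add_one_mem_thetaBounds ζ n A)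

theorem decreasingBelow_of_mem_tree {ζ : Ordinal.{u}} {n : ℕ} {l : List Ordinal.{u}}
    (hl : l ∈ tree ζ (n + 1)) : DecreasingBelow (ω ^ ζ * ((n + 1 : ℕ) : Ordinal.{u})) l :=
  ⟨pairwise_of_mem_tree_of (pairwise_of_mem_treeOne ζ) _ l hl,
    (stack_ok (treeOne_ok ζ) n l hl).2.1⟩

theorem le_opTheta {A : X →L[𝕜] Y} {ε : ℝ} (hε : 0 < ε) {ζ : Ordinal.{u}} {n : ℕ}
    (hne : (iterDeriv ε (dualBallImage A) (ω ^ ζ * ((n + 1 : ℕ) : Ordinal.{u}))).Nonempty) :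
    ε / 5 ≤ opTheta ζ (n + 1) A := by
  refine le_csInf ⟨_, norm_add_one_mem_thetaBounds ζ n A⟩ ?_
  rintro θ ⟨-, hθ⟩
  obtain ⟨x, hx, hy⟩ := exists_decreasing_tree hε hne
  have := nonempty_maxNodes_treeD (WeakNhds 𝕜 X) ζ n
  refine le_trans (le_ciInf fun t => ?_) (hθ (WeakNhds 𝕜 X) x ?_ ?_)
  · have ht := mem_maxNodes_treeD_iff.1 t.2
    obtain ⟨y, hyK, hyx⟩ := hy t (decreasingBelow_of_mem_tree ht.1)
    refine le_trans ?_ (re_apply_le_supportFun hyK _)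
    have hsum := le_re_apply_weightedSum (coeff_nonneg ζ) fun s hs hp => (hyx s hs hp).le
    rw [prefixSum_coeff (branches_add_one_eq ζ n ▸ ht)] at hsum
    rw [map_smul, _root_.smul_eq_mul, one_div_natCast_eq_ofReal, RCLike.re_ofReal_mul,
      le_inv_mul_iff₀ (by positivity)]
    exact hsum
  · intro t ζ' ht f
    exact tendsto_of_mem_weakNhds (fun W => (hx t ζ' W (decreasingBelow_of_mem_tree (ht W))).2) f
  · intro t ht
    have hne : t ≠ [] := by simpa using (stack_ok (treeOne_ok ζ) n _ ht).1
    obtain ⟨l, ⟨ζ', W⟩, rfl⟩ := (List.eq_nil_or_concat' t).resolve_left hne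
    exact (hx l ζ' W (decreasingBelow_of_mem_tree ht)).1

end LowerTheta

/-! ### Comparison of the conditions -/

section Ordinals

open Ordinal

theorem exists_le_opow_mul_natCast {ξ β : Ordinal.{u}} (hξ : ξ ≠ 0) (hβ : β < ω ^ ξ) :
    ∃ ζ < ξ, ∃ m : ℕ, β ≤ ω ^ ζ * m := by
  induction ξ using Ordinal.limitRecOn with
  | zero => exact absurd rfl hξ
  | add_one ζ _ =>
    rw [opow_add, opow_one, lt_mul_iff_of_isSuccLimit isSuccLimit_omega0] at hβ
    obtain ⟨c, hc, hβ⟩ := hβ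
    obtain ⟨m, rfl⟩ := lt_omega0.1 hc
    exact ⟨ζ, lt_add_one ζ, m, hβ.le⟩
  | limit ξ hl _ =>
    obtain ⟨ζ, hζ, h⟩ := (lt_opow_of_isSuccLimit omega0_ne_zero hl).1 hβ
    exact ⟨ζ, hζ, 1, by simpa using h.le⟩

theorem opow_mul_natCast_lt {ζ ξ : Ordinal.{u}} (h : ζ < ξ) (m : ℕ) :
    ω ^ ζ * (m : Ordinal.{u}) < ω ^ ξ := by
  calc ω ^ ζ * (m : Ordinal.{u}) < ω ^ ζ * ω :=
        (mul_lt_mul_iff_right₀ (omega_opow_pos ζ)).2 (natCast_lt_omega0 m)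
    _ = ω ^ (ζ + 1) := by rw [opow_add, opow_one]
    _ ≤ ω ^ ξ := opow_le_opow_right omega0_pos (Order.add_one_le_of_lt h)

end Ordinals

section Main

open Ordinal

variable {𝕜 : Type*} [RCLike 𝕜] {Λ : Type u}
  {X : Λ → Type u} [∀ l, NormedAddCommGroup (X l)] [∀ l, NormedSpace 𝕜 (X l)]
  {Y : Λ → Type v} [∀ l, NormedAddCommGroup (Y l)] [∀ l, NormedSpace 𝕜 (Y l)]
  {A : ∀ l, X l →L[𝕜] Y l} {hA : ∃ R, ∀ l, ‖A l‖ ≤ R} {p r : Exponent} {hpr : Admissible p r}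

theorem opIndex_le_opIndex_diagOp (l : Λ) : opIndex (A l) ≤ opIndex (diagOp A hA hpr) := by
  cases h : opIndex (diagOp A hA hpr) with
  | top => exact le_top
  | coe α =>
    exact index_le_iff.2 fun ε hε =>
      iterDeriv_eq_empty_of_diagOp A hA hpr hε.le (index_le_iff.1 h.le ε hε) l

theorem iSup_opIndexEps_le_iff {ε : ℝ} {α : Ordinal.{u}} :
    (⨆ l, opIndexEps (A l) ε) ≤ (α : WithTop Ordinal.{u}) ↔
      ∀ l, iterDeriv ε (dualBallImage (A l)) α = ∅ :=
  iSup_le_iff.trans (forall_congr' fun _ => indexEps_le_iff)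

theorem exists_iterDeriv_eq_empty_of_iSup_lt {ξ : Ordinal.{u}} (hξ : ξ ≠ 0) {ε : ℝ}
    (h : (⨆ l, opIndexEps (A l) ε) < ((ω ^ ξ : Ordinal.{u}) : WithTop Ordinal.{u})) :
    ∃ ζ < ξ, ∃ m : ℕ, ∀ l, iterDeriv ε (dualBallImage (A l)) (ω ^ ζ * m) = ∅ := by
  obtain ⟨β, hβ, hlt⟩ := WithTop.lt_iff_exists_coe.1 h
  rw [WithTop.coe_lt_coe] at hlt
  obtain ⟨ζ, hζ, m, hm⟩ := exists_le_opow_mul_natCast hξ hlt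
  exact ⟨ζ, hζ, m, iSup_opIndexEps_le_iff.1 (hβ.trans_le (WithTop.coe_le_coe.2 hm))⟩

theorem iSup_opIndexEps_lt {ζ ξ : Ordinal.{u}} (hζ : ζ < ξ) {m : ℕ} {ε : ℝ}
    (h : ∀ l, iterDeriv ε (dualBallImage (A l)) (ω ^ ζ * m) = ∅) :
    (⨆ l, opIndexEps (A l) ε) < ((ω ^ ξ : Ordinal.{u}) : WithTop Ordinal.{u}) :=
  (iSup_opIndexEps_le_iff.2 h).trans_lt (WithTop.coe_lt_coe.2 (opow_mul_natCast_lt hζ m))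

theorem iSup_opIndexEps_lt_of_opIndex_diagOp_le {α : Ordinal.{u}} (hα : Order.IsSuccLimit α)
    (h : opIndex (diagOp A hA hpr) ≤ (α : WithTop Ordinal.{u})) {ε : ℝ} (hε : 0 < ε) :
    (⨆ l, opIndexEps (A l) ε) < (α : WithTop Ordinal.{u}) := by
  obtain ⟨β, hβ, hsub⟩ := exists_iterDeriv_subset_of_limit (isCompact_dualBallImage _)
    isOpen_empty hα (index_le_iff.1 h ε hε).subset
  exact (iSup_opIndexEps_le_iff.2 fun l => iterDeriv_eq_empty_of_diagOp A hA hpr hε.le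
    (Set.subset_empty_iff.1 hsub) l).trans_lt (WithTop.coe_lt_coe.2 hβ)

theorem opIndex_diagOp_le_of_forall_lt {ξ : Ordinal.{u}} (hξ : ξ ≠ 0)
    (h : ∀ ε : ℝ, 0 < ε →
      (⨆ l, opIndexEps (A l) ε) < ((ω ^ ξ : Ordinal.{u}) : WithTop Ordinal.{u})) :
    opIndex (diagOp A hA hpr) ≤ ((ω ^ ξ : Ordinal.{u}) : WithTop Ordinal.{u}) := by
  refine index_le_iff.2 fun ε hε => ?_
  obtain ⟨ζ, hζ, m, hm⟩ := exists_iterDeriv_eq_empty_of_iSup_lt hξ (h (ε / 8) (by positivity))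
  obtain ⟨M, hM⟩ := exists_iterDeriv_diagOp_eq_empty A hA hpr hε hm
  exact Set.subset_empty_iff.1
    (hM ▸ iterDeriv_antitone _ _ (opow_mul_natCast_lt hζ M).le)

theorem opIndex_diagOp_le_opow_add_one {ξ : Ordinal.{u}}
    (h : ∀ l, opIndex (A l) ≤ ((ω ^ ξ : Ordinal.{u}) : WithTop Ordinal.{u})) :
    opIndex (diagOp A hA hpr) ≤ ((ω ^ (ξ + 1) : Ordinal.{u}) : WithTop Ordinal.{u}) :=
  opIndex_diagOp_le_of_forall_lt (by simp) fun ε hε =>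
    iSup_opIndexEps_lt (m := 1) (lt_add_one ξ) fun l => by
      simpa using index_le_iff.1 (h l) ε hε

theorem opow_add_one_le_opIndex_diagOp {ξ : Ordinal.{u}} (hξ : ξ ≠ 0) {ε : ℝ} (hε : 0 < ε)
    (h : ((ω ^ ξ : Ordinal.{u}) : WithTop Ordinal.{u}) ≤ ⨆ l, opIndexEps (A l) ε) :
    ((ω ^ (ξ + 1) : Ordinal.{u}) : WithTop Ordinal.{u}) ≤ opIndex (diagOp A hA hpr) := by
  refine omega0_opow_add_one_le_opIndex hε (isSuccLimit_omega0_opow hξ) fun α hα => ?_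
  rw [Set.nonempty_iff_ne_empty]
  intro hempty
  have hle := iSup_opIndexEps_le_iff.2 (iterDeriv_eq_empty_of_diagOp A hA hpr hε.le hempty)
  exact (h.trans hle).not_gt (WithTop.coe_lt_coe.2 hα)

theorem sInf_iSup_opTheta_eq_zero {R : ℝ} (hR : ∀ l, ‖A l‖ ≤ R) {ξ : Ordinal.{u}} (hξ : ξ ≠ 0)
    (h : ∀ ε : ℝ, 0 < ε →
      (⨆ l, opIndexEps (A l) ε) < ((ω ^ ξ : Ordinal.{u}) : WithTop Ordinal.{u})) :
    sInf {c : ℝ | ∃ ζ < ξ, ∃ m : ℕ, 1 ≤ m ∧ c = ⨆ l, opTheta ζ m (A l)} = 0 := by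
  have hnonneg : ∀ c ∈ {c : ℝ | ∃ ζ < ξ, ∃ m : ℕ, 1 ≤ m ∧ c = ⨆ l, opTheta ζ m (A l)}, 0 ≤ c := by
    rintro _ ⟨ζ, -, m, -, rfl⟩
    exact Real.iSup_nonneg fun l => opTheta_nonneg ζ m (A l)
  refine le_antisymm (le_of_forall_pos_le_add fun η hη => ?_) (Real.sInf_nonneg hnonneg)
  obtain ⟨ζ, hζ, m, hm⟩ := exists_iterDeriv_eq_empty_of_iSup_lt hξ (h (η / 4) (by positivity))
  obtain ⟨n, hn⟩ := exists_nat_ge (m * R / (η / 2))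
  rw [div_le_iff₀ (by positivity)] at hn
  rw [zero_add]
  refine (csInf_le ⟨0, hnonneg⟩ ⟨ζ, hζ, n + 1, by omega, rfl⟩).trans
    (Real.iSup_le (fun l => ?_) hη.le)
  exact opTheta_le (hR l) (δ₀ := η / 4) (δ := η / 2) (by positivity) (by linarith) (hm l) hη
    (by linarith)

theorem iSup_opIndexEps_lt_of_sInf_eq_zero {R : ℝ} (hR : ∀ l, ‖A l‖ ≤ R) {ξ : Ordinal.{u}}
    (hξ : ξ ≠ 0)
    (h : sInf {c : ℝ | ∃ ζ < ξ, ∃ m : ℕ, 1 ≤ m ∧ c = ⨆ l, opTheta ζ m (A l)} = 0)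
    {ε : ℝ} (hε : 0 < ε) :
    (⨆ l, opIndexEps (A l) ε) < ((ω ^ ξ : Ordinal.{u}) : WithTop Ordinal.{u}) := by
  have hlt := h.trans_lt (show (0 : ℝ) < ε / 5 by positivity)
  obtain ⟨_, ⟨ζ, hζ, m, hm, rfl⟩, hlt⟩ := exists_lt_of_csInf_lt
    (by exact ⟨_, 0, pos_iff_ne_zero.2 hξ, 1, le_rfl, rfl⟩) hlt
  obtain ⟨n, rfl⟩ := Nat.exists_eq_add_of_le' hm
  refine iSup_opIndexEps_lt (m := n + 1) hζ fun l => Set.not_nonempty_iff_eq_empty.1 fun hne => ?_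
  have hbdd : BddAbove (Set.range fun l => opTheta ζ (n + 1) (A l)) := by
    refine ⟨R + 1, ?_⟩
    rintro _ ⟨l, rfl⟩
    linarith [opTheta_le_norm_add_one ζ n (A l), hR l]
  exact ((le_opTheta hε hne).trans (le_ciSup hbdd l)).not_gt hlt

end Main

end Szlenk

theorem mainTheorem9_general {𝕜 : Type*} [RCLike 𝕜] {Λ : Type u}
    {X : Λ → Type u} [∀ l, NormedAddCommGroup (X l)] [∀ l, NormedSpace 𝕜 (X l)]
    {Y : Λ → Type v} [∀ l, NormedAddCommGroup (Y l)] [∀ l, NormedSpace 𝕜 (Y l)]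
    (A : ∀ l, X l →L[𝕜] Y l) (hA : ∃ R, ∀ l, ‖A l‖ ≤ R)
    (p r : Szlenk.Exponent) (hpr : Szlenk.Admissible p r)
    (ξ : Ordinal.{u}) (hξ : (1 : Ordinal.{u}) < ω ^ ξ)
    (hsup : (⨆ l, Szlenk.opIndex (A l)) = ((ω ^ ξ : Ordinal.{u}) : WithTop Ordinal.{u})) :
    List.TFAE
      [Szlenk.opIndex (Szlenk.diagOp A hA hpr) = ((ω ^ ξ : Ordinal.{u}) : WithTop Ordinal.{u}),
       ∀ ε : ℝ, 0 < ε →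
        (⨆ l, Szlenk.opIndexEps (A l) ε) < ((ω ^ ξ : Ordinal.{u}) : WithTop Ordinal.{u}),
       sInf {c : ℝ | ∃ ζ < ξ, ∃ m : ℕ, 1 ≤ m ∧ c = ⨆ l, Szlenk.opTheta ζ m (A l)} = 0] ∧
    (Szlenk.opIndex (Szlenk.diagOp A hA hpr) ≠ ((ω ^ ξ : Ordinal.{u}) : WithTop Ordinal.{u}) →
      Szlenk.opIndex (Szlenk.diagOp A hA hpr) =
        ((ω ^ (ξ + 1) : Ordinal.{u}) : WithTop Ordinal.{u})) := by
  have hξ0 : ξ ≠ 0 := by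
    rintro rfl
    simp at hξ
  have hle : ∀ l, Szlenk.opIndex (A l) ≤ ((ω ^ ξ : Ordinal.{u}) : WithTop Ordinal.{u}) :=
    fun l => hsup ▸ le_iSup (fun l => Szlenk.opIndex (A l)) l
  have hge : ((ω ^ ξ : Ordinal.{u}) : WithTop Ordinal.{u}) ≤
      Szlenk.opIndex (Szlenk.diagOp A hA hpr) :=
    hsup ▸ iSup_le Szlenk.opIndex_le_opIndex_diagOp
  obtain ⟨R, hR⟩ := id hA
  refine ⟨?_, fun hne => ?_⟩
  · tfae_have 1 → 2 := fun h ε hε => Szlenk.iSup_opIndexEps_lt_of_opIndex_diagOp_le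
      (Szlenk.isSuccLimit_omega0_opow hξ0) h.le hε
    tfae_have 2 → 1 := fun h => (Szlenk.opIndex_diagOp_le_of_forall_lt hξ0 h).antisymm hge
    tfae_have 2 → 3 := Szlenk.sInf_iSup_opTheta_eq_zero hR hξ0
    tfae_have 3 → 2 := fun h ε hε => Szlenk.iSup_opIndexEps_lt_of_sInf_eq_zero hR hξ0 h hε
    tfae_finish
  · refine (Szlenk.opIndex_diagOp_le_opow_add_one hle).antisymm ?_
    by_contra hlt
    refine hne (le_antisymm (Szlenk.opIndex_diagOp_le_of_forall_lt hξ0 fun ε hε => ?_) hge)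
    by_contra h
    exact hlt (Szlenk.opow_add_one_le_opIndex_diagOp hξ0 hε (not_lt.1 h))

theorem mainTheorem9 {𝕜 : Type*} [RCLike 𝕜] {Λ : Type u}
    {X : Λ → Type u} [∀ l, NormedAddCommGroup (X l)] [∀ l, NormedSpace 𝕜 (X l)]
    [∀ l, CompleteSpace (X l)]
    {Y : Λ → Type v} [∀ l, NormedAddCommGroup (Y l)] [∀ l, NormedSpace 𝕜 (Y l)]
    [∀ l, CompleteSpace (Y l)]
    (A : ∀ l, X l →L[𝕜] Y l) (hA : ∃ R, ∀ l, ‖A l‖ ≤ R)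
    (p r : Szlenk.Exponent) (hpr : Szlenk.Admissible p r)
    (ξ : Ordinal.{u}) (hξ : (1 : Ordinal.{u}) < ω ^ ξ)
    (hsup : (⨆ l, Szlenk.opIndex (A l)) = ((ω ^ ξ : Ordinal.{u}) : WithTop Ordinal.{u})) :
    List.TFAE
      [Szlenk.opIndex (Szlenk.diagOp A hA hpr) = ((ω ^ ξ : Ordinal.{u}) : WithTop Ordinal.{u}),
       ∀ ε : ℝ, 0 < ε →
        (⨆ l, Szlenk.opIndexEps (A l) ε) < ((ω ^ ξ : Ordinal.{u}) : WithTop Ordinal.{u}),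
       sInf {c : ℝ | ∃ ζ < ξ, ∃ m : ℕ, 1 ≤ m ∧ c = ⨆ l, Szlenk.opTheta ζ m (A l)} = 0] ∧
    (Szlenk.opIndex (Szlenk.diagOp A hA hpr) ≠ ((ω ^ ξ : Ordinal.{u}) : WithTop Ordinal.{u}) →
      Szlenk.opIndex (Szlenk.diagOp A hA hpr) =
        ((ω ^ (ξ + 1) : Ordinal.{u}) : WithTop Ordinal.{u})) :=
  mainTheorem9_general A hA p r hpr ξ hξ hsup
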